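/- **Conventions.** A *prederivator* is a strict 2-functor $\mathscr D\colon \mathrm{Cat}^{\mathrm{op}}\to\mathrm{CAT}$ defined on the 2-category of small categories; $\mathrm{PDER}$ is the 2-category of prederivators, pseudo-natural transformations and modifications. For $f\colon A\to B$ write $f^*\colon\mathscr D(B)\to\mathscr D(A)$ for $\mathscr D(f)$, and $X_a=a^*X\in\mathscr D(\mathbb 1)$ for $X\in \mathscr D(A)$ and an object $a\colon\mathbb 1\to A$. A prederivator is a *derivator* if (Der1) for every small family $(A_i)_{i\in I}$ the functor $\mathscr D(\coprod_i A_i)\to\prod_i\mathscr D(A_i)$ is an equivalence; (Der2) a morphism $\varphi$ of $\mathscr D(A)$ is invertible if every $\varphi_a$ is invertible; (Der3) every $f^*$ has a left adjoint $f_!$ and a right adjoint $f_*$; (Der4) for all $f\colon A\to B$ and $b\in B$ the canonical mates $(\pi_{(f/b)})_!\,p^*\to b^*f_!$ and $b^*f_*\to(\pi_{(b/f)})_*\,q^*$ are invertible, where $p\colon (f/b)\to A$ and $q\colon (b/f)\to A$ are the projections of the comma categories and $\pi_{(-)}$ are the functors to $\mathbb 1$. $\mathrm{DER}\subset\mathrm{PDER}$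 is the full sub-2-category of derivators. For a small category $A$ the shift $\mathscr D^A$ is given by $\mathscr D^A(B)=\mathscr D(A\times B)$, and a functor $f\colon A\to B$ induces a morphism $f^*\colon\mathscr D^B\to\mathscr D^A$. For $n\ge 0$ let $[1]^n=\{0,1\}^n$ be the $n$-cube (a poset, regarded as a category), let $[1]^n_{\le k}$ and $[1]^n_{\ge k}$ be its full subcategories on the vertices with at most, respectively at least, $k$ coordinates equal to $1$, and let $i_{\le k}$, $i_{\ge k}$ be their inclusions into $[1]^n$. The *source of valence $n$* is $[1]^n_{\le 1}$, and the *sink of valence $n$* is $[1]^n_{\ge n-1}$. An $n$-cube $X\in\mathscr D([1]^n)$ in a derivator is *cartesian*, *cocartesian*, *strongly cartesian*, *strongly cocartesian* if it lies in the essential image of $(i_{\ge 1})_*$, $(i_{\le n-1})_!$, $(i_{\ge n-1})_*$, $(i_{\le 1})_!$, respectively; it is *strongly bicartesian* if it is strongly cartesian and strongly cocartesian. An object of $\mathscr D^{[1]^n}(C)=\mathscr D([1]^n\times C)$ is called strongly bicartesian if its restriction to $[1]^n\times\{c\}$ is so for every object $c$ of $C$; these objects span a full subprederivator $\mathscr D^{[1]^n}_{\mathrm{sbc}}\subseteq\mathscr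 D^{[1]^n}$. A derivator is *stable* if $\mathscr D(\mathbb 1)$ has a zero object and a square ($2$-cube) is cartesian if and only if it is cocartesian (that is, if and only if it is *bicartesian*). A morphism (pseudo-natural transformation) of stable derivators is *exact* if it preserves zero objects and bicartesian squares. Let $\mathrm{DER}_{\mathrm{St},\mathrm{ex}}$ be the 2-category of stable derivators, exact morphisms and all modifications. Every small category $A$ gives a 2-functor $(-)^A\colon\mathrm{DER}_{\mathrm{St},\mathrm{ex}}\to\mathrm{DER}$, $\mathscr D\mapsto\mathscr D^A$. Two small categories $A$, $A'$ are *strongly stably equivalent* if there is a *strong stable equivalence* between them: a pseudo-natural equivalence $\Phi\colon(-)^A\xrightarrow{\ \simeq\ }(-)^{A'}$ of such 2-functors. **Statement.** For every $n\ge 0$, the source $[1]^n_{\le 1}$ and the sink $[1]^n_{\ge n-1}$ of valence $n$ are strongly stably equivalent. More precisely, there is a strong stable equivalence $\Phi\colon(-)^{[1]^n_{\le 1}}\xrightarrow{\ \simeq\ }(-)^{[1]^n_{\ge n-1}}$ such that for every stable derivator $\mathscr D$ the following hold. 1. An $n$-cube $X\in\mathscr D([1]^n)$ is strongly cartesian if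 and only if it is strongly cocartesian. 2. The morphism $(i_{\le 1})^*\colon\mathscr D^{[1]^n}\to\mathscr D^{[1]^n_{\le 1}}$ has a left adjoint $(i_{\le 1})_!$ and the morphism $(i_{\ge n-1})^*\colon\mathscr D^{[1]^n}\to\mathscr D^{[1]^n_{\ge n-1}}$ has a right adjoint $(i_{\ge n-1})_*$ in the 2-category $\mathrm{PDER}$. Up to isomorphism, these adjoints factor through the inclusion $\mathscr D^{[1]^n}_{\mathrm{sbc}}\subseteq\mathscr D^{[1]^n}$ via equivalences $$e_L\colon\mathscr D^{[1]^n_{\le 1}}\xrightarrow{\ \simeq\ }\mathscr D^{[1]^n}_{\mathrm{sbc}},\qquad e_R\colon\mathscr D^{[1]^n_{\ge n-1}}\xrightarrow{\ \simeq\ }\mathscr D^{[1]^n}_{\mathrm{sbc}}.$$ 3. The component $\Phi_{\mathscr D}$ is compatible with these identifications: $e_R\circ\Phi_{\mathscr D}\cong e_L$. -/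

import Mathlib

open CategoryTheory Bicategory Opposite
open scoped CategoryTheory.Pseudofunctor.StrongTrans

universe w v u

noncomputable section

namespace Derivators

universe w₁ w₂ w₃ v₁ v₂ v₃ u₁ u₂ u₃

/-- The `2`-category `Cat^op` (1-cells reversed, 2-cells not reversed) is strict. -/
instance strictCatOp : Bicategory.Strict (Cat.{w, w})ᵒᵖ where
  id_comp f := congrArg Quiver.Hom.op (Bicategory.Strict.comp_id f.unop)
  comp_id f := congrArg Quiver.Hom.op (Bicategory.Strict.id_comp f.unop)
  assoc _ _ _ := rfl
  leftUnitor_eqToIso _ := rfl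
  rightUnitor_eqToIso _ := rfl
  associator_eqToIso _ _ _ := rfl

set_option linter.checkUnivs false in
/-- A prederivator is a (strict) 2-functor `Cat^op ⥤ CAT`. Here `Cat.{w, w}` is the 2-category of
small categories. -/
abbrev Prederivator := StrictPseudofunctor (Cat.{w, w})ᵒᵖ Cat.{v, u}

set_option linter.checkUnivs false in
/-- The 2-category of prederivators: 1-cells are the pseudo-natural transformations, 2-cells are
the modifications. The 2-category of derivators is its full sub-2-category on the derivators. -/
abbrev PDER := InducedBicategory (Pseudofunctor (Cat.{w, w})ᵒᵖ Cat.{v, u})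
  (fun D : Prederivator.{w, v, u} => D.toPseudofunctor)

/-- A prederivator, regarded as an object of the 2-category `PDER`. -/
abbrev toPDER (D : Prederivator.{w, v, u}) : PDER.{w, v, u} := D

/-- The strict 2-functor `B × -` on `Cat^op`. -/
def prodLeft (B : Cat.{w, w}) : StrictPseudofunctor (Cat.{w, w})ᵒᵖ (Cat.{w, w})ᵒᵖ :=
  StrictPseudofunctor.mk''
    { obj := fun A => op (Cat.of (B × A.unop))
      map := fun f => ((𝟭 B).prod f.unop.toFunctor).toCatHom.op
      map₂ := fun α => Bicategory.Opposite.op2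
        (NatTrans.toCatHom₂ (NatTrans.prod (𝟙 (𝟭 B)) α.unop2.toNatTrans))
      map₂_id := fun _ => rfl
      map₂_comp := fun η θ => by
        refine congrArg (fun t => Bicategory.Opposite.op2 (NatTrans.toCatHom₂ t)) ?_
        ext x
        · exact (Category.comp_id _).symm
        · rfl
      map₂_whisker_left := fun f _ _ η => by
        refine Eq.trans ?_ (Category.id_comp _).symm
        exact (Category.comp_id _).symm
      map₂_whisker_right := fun η f => by
        refine Eq.trans ?_ (Category.id_comp _).symm
        exact (Category.comp_id _).symm }

section
variable {B : Type u₁} [Bicategory.{w₁, v₁} B] {C : Type u₂} [Bicategory.{w₂, v₂} C]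
    {D : Type u₃} [Bicategory.{w₃, v₃} D]

theorem naturality_id_aux {F G : Pseudofunctor C D} (η : F ⟶ G) {a : C} {p : a ⟶ a}
    (e : p ⟶ 𝟙 a) :
    (η.naturality p).hom ≫ η.app a ◁ (G.map₂ e ≫ (G.mapId a).hom) =
      (F.map₂ e ≫ (F.mapId a).hom) ▷ η.app a ≫ (λ_ (η.app a)).hom ≫ (ρ_ (η.app a)).inv := by
  rw [whiskerLeft_comp, comp_whiskerRight, Category.assoc,
    ← η.naturality_naturality_assoc, η.naturality_id]

theorem naturality_comp_aux {F G : Pseudofunctor C D} (η : F ⟶ G) {a b c : C}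
    {p : a ⟶ c} {f : a ⟶ b} {g : b ⟶ c} (e : p ⟶ f ≫ g) :
    (η.naturality p).hom ≫ η.app a ◁ (G.map₂ e ≫ (G.mapComp f g).hom) =
      (F.map₂ e ≫ (F.mapComp f g).hom) ▷ η.app c ≫ (α_ _ _ _).hom ≫
        F.map f ◁ (η.naturality g).hom ≫ (α_ _ _ _).inv ≫ (η.naturality f).hom ▷ G.map g ≫
        (α_ _ _ _).hom := by
  rw [whiskerLeft_comp, comp_whiskerRight, Category.assoc,
    ← η.naturality_naturality_assoc, η.naturality_comp]

/-- Precomposition of a pseudo-natural transformation with a pseudofunctor. -/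
def precomp₁ (P : Pseudofunctor B C) {F G : Pseudofunctor C D}
    (η : F ⟶ G) : P.comp F ⟶ P.comp G where
  app b := η.app (P.obj b)
  naturality f := η.naturality (P.map f)
  naturality_naturality α := η.naturality_naturality (P.map₂ α)
  naturality_id a := naturality_id_aux η (P.mapId a).hom
  naturality_comp f g := naturality_comp_aux η (P.mapComp f g).hom

theorem postcomp_naturality_aux (F : Pseudofunctor C D) {a b a' b' : C} {f g : a ⟶ b}
    {f' g' : a' ⟶ b'} {x : a ⟶ a'} {y : b ⟶ b'} (σ : f ⟶ g) (σ' : f' ⟶ g')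
    (m : f ≫ y ⟶ x ≫ f') (n : g ≫ y ⟶ x ≫ g') (h : σ ▷ y ≫ n = m ≫ x ◁ σ') :
    F.map₂ σ ▷ F.map y ≫ (F.mapComp g y).inv ≫ F.map₂ n ≫ (F.mapComp x g').hom =
      ((F.mapComp f y).inv ≫ F.map₂ m ≫ (F.mapComp x f').hom) ≫ F.map x ◁ F.map₂ σ' := by
  have h' := congrArg F.map₂ h
  simp only [F.map₂_comp, F.map₂_whisker_left, F.map₂_whisker_right, Category.assoc] at h'
  rw [← cancel_epi (F.mapComp f y).hom, ← cancel_mono (F.mapComp x g').inv]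
  simpa using h'

theorem postcomp_id_aux (F : Pseudofunctor C D) {a a' : C} {p : a ⟶ a} {p' : a' ⟶ a'}
    {x : a ⟶ a'} (e : p ⟶ 𝟙 a) (e' : p' ⟶ 𝟙 a') (m : p ≫ x ⟶ x ≫ p')
    (h : m ≫ x ◁ e' = e ▷ x ≫ (λ_ x).hom ≫ (ρ_ x).inv) :
    ((F.mapComp p x).inv ≫ F.map₂ m ≫ (F.mapComp x p').hom) ≫
        F.map x ◁ (F.map₂ e' ≫ (F.mapId a').hom) =
      (F.map₂ e ≫ (F.mapId a).hom) ▷ F.map x ≫ (λ_ (F.map x)).hom ≫ (ρ_ (F.map x)).inv := by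
  have h' : F.map₂ (m ≫ x ◁ e') ≫ F.map₂ (ρ_ x).hom = F.map₂ (e ▷ x) ≫ F.map₂ (λ_ x).hom := by
    rw [h, ← F.map₂_comp, ← F.map₂_comp]
    simp
  simp only [F.map₂_comp, F.map₂_whisker_left, F.map₂_whisker_right, Category.assoc,
    F.map₂_left_unitor, F.map₂_right_unitor, Iso.inv_hom_id_assoc] at h'
  rw [← cancel_epi (F.mapComp p x).hom, ← cancel_mono (ρ_ (F.map x)).hom]
  simpa using h'

theorem postcomp_comp_aux (F : Pseudofunctor C D) {a b c a' b' c' : C} {p : a ⟶ c}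
    {f : a ⟶ b} {g : b ⟶ c} {p' : a' ⟶ c'} {f' : a' ⟶ b'} {g' : b' ⟶ c'}
    {x : a ⟶ a'} {y : b ⟶ b'} {z : c ⟶ c'} (e : p ⟶ f ≫ g) (e' : p' ⟶ f' ≫ g')
    (m : p ≫ z ⟶ x ≫ p') (k : f ≫ y ⟶ x ≫ f') (l : g ≫ z ⟶ y ≫ g')
    (h : m ≫ x ◁ e' = e ▷ z ≫ (α_ _ _ _).hom ≫ f ◁ l ≫ (α_ _ _ _).inv ≫ k ▷ g' ≫
      (α_ _ _ _).hom) :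
    ((F.mapComp p z).inv ≫ F.map₂ m ≫ (F.mapComp x p').hom) ≫
        F.map x ◁ (F.map₂ e' ≫ (F.mapComp f' g').hom) =
      (F.map₂ e ≫ (F.mapComp f g).hom) ▷ F.map z ≫ (α_ _ _ _).hom ≫
        F.map f ◁ ((F.mapComp g z).inv ≫ F.map₂ l ≫ (F.mapComp y g').hom) ≫ (α_ _ _ _).inv ≫
        ((F.mapComp f y).inv ≫ F.map₂ k ≫ (F.mapComp x f').hom) ▷ F.map g' ≫
        (α_ _ _ _).hom := by
  have h' := congrArg F.map₂ h
  have ha : F.map₂ (α_ f y g').inv = (F.mapComp f (y ≫ g')).hom ≫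
      F.map f ◁ (F.mapComp y g').hom ≫ (α_ _ _ _).inv ≫ (F.mapComp f y).inv ▷ F.map g' ≫
      (F.mapComp (f ≫ y) g').inv := by
    have := F.mapComp_assoc_right_hom f y g'
    rw [reassoc_of% this]
    simp
  simp only [F.map₂_comp, F.map₂_whisker_left, F.map₂_whisker_right, Category.assoc,
    F.map₂_associator, ha] at h'
  rw [← cancel_epi (F.mapComp p z).hom, ← cancel_mono (F.map x ◁ (F.mapComp f' g').inv),
    ← cancel_mono (F.mapComp x (f' ≫ g')).inv]
  simpa using h'

/-- Postcomposition of a pseudo-natural transformation with a pseudofunctor. -/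
def postcomp₁ (F : Pseudofunctor C D) {P Q : Pseudofunctor B C} (θ : P ⟶ Q) :
    P.comp F ⟶ Q.comp F where
  app b := F.map (θ.app b)
  naturality f := (F.mapComp _ _).symm ≪≫ F.map₂Iso (θ.naturality f) ≪≫ F.mapComp _ _
  naturality_naturality α := postcomp_naturality_aux F _ _ _ _ (θ.naturality_naturality α)
  naturality_id a := postcomp_id_aux F _ _ _ (θ.naturality_id a)
  naturality_comp f g := postcomp_comp_aux F _ _ _ _ _ (θ.naturality_comp f g)

/-- Precomposition of a modification with a pseudofunctor. -/
def precomp₂ (P : Pseudofunctor B C) {F G : Pseudofunctor C D} {η θ : F ⟶ G} (Γ : η ⟶ θ) :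
    precomp₁ P η ⟶ precomp₁ P θ where
  as :=
    { app := fun b => Γ.as.app (P.obj b)
      naturality := fun f => Γ.as.naturality (P.map f) }

end

/-- The shifted prederivator `D^B`, with `D^B(A) = D(B × A)`. -/
def shift (B : Cat.{w, w}) (D : Prederivator.{w, v, u}) : Prederivator.{w, v, u} :=
  (prodLeft B).comp D

/-- The shift `F^B : D^B ⟶ E^B` of a morphism of prederivators, with components `F_{B × A}`. -/
def shift₁ (B : Cat.{w, w}) {D E : Prederivator.{w, v, u}} (F : toPDER D ⟶ toPDER E) :
    toPDER (shift B D) ⟶ toPDER (shift B E) :=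
  InducedBicategory.mkHom (precomp₁ (prodLeft B).toPseudofunctor F.hom)


theorem catOpHom₂_ext {A B : (Cat.{w, w})ᵒᵖ} {f g : A ⟶ B} {α β : f ⟶ g}
    (h : ∀ x : B.unop, α.unop2.toNatTrans.app x = β.unop2.toNatTrans.app x) : α = β :=
  congrArg Bicategory.Opposite.Hom2.op2' (Cat.Hom₂.ext (NatTrans.ext (funext h)))

section
variable {B : Type u₁} [Bicategory.{w₁, v₁} B] {C : Type u₂} [Bicategory.{w₂, v₂} C]

/-- A strictly natural transformation of strict 2-functors, as a pseudo-natural one. -/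
def strictTrans [Bicategory.Strict C] (P Q : StrictPseudofunctor B C)
    (app : ∀ b, P.obj b ⟶ Q.obj b)
    (comm : ∀ {a b : B} (f : a ⟶ b), P.map f ≫ app b = app a ≫ Q.map f)
    (comm₂ : ∀ {a b : B} {f g : a ⟶ b} (α : f ⟶ g),
      P.map₂ α ▷ app b ≫ eqToHom (comm g) = eqToHom (comm f) ≫ app a ◁ Q.map₂ α) :
    P.toPseudofunctor ⟶ Q.toPseudofunctor where
  app := app
  naturality f := eqToIso (comm f)
  naturality_naturality α := comm₂ α
  naturality_id a := by
    simp only [StrictlyUnitaryPseudofunctor.mapId_eq_eqToIso, Bicategory.Strict.leftUnitor_eqToIso,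
      Bicategory.Strict.rightUnitor_eqToIso, eqToIso.hom, eqToIso.inv, whiskerLeft_eqToHom,
      eqToHom_whiskerRight, eqToHom_trans]
  naturality_comp {a b c} f g := by
    simp only [StrictPseudofunctor.mapComp_eq_eqToIso, Bicategory.Strict.associator_eqToIso,
      eqToIso.hom, eqToIso.inv, whiskerLeft_eqToHom, eqToHom_whiskerRight, eqToHom_trans]

end

/-- A functor `f : A ⟶ B` induces `f × C : A × C ⟶ B × C`, strictly 2-natural in `C`. -/
def prodRight {A B : Cat.{w, w}} (u : A ⟶ B) :
    (prodLeft B).toPseudofunctor ⟶ (prodLeft A).toPseudofunctor :=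
  strictTrans (prodLeft B) (prodLeft A)
    (fun C => (u.toFunctor.prod (𝟭 C.unop)).toCatHom.op) (fun _ => rfl)
    (fun α => by
      refine (Category.comp_id _).trans (Eq.trans ?_ (Category.id_comp _).symm)
      refine catOpHom₂_ext fun x => Prod.ext ?_ ?_
      · exact (u.toFunctor.map_id x.1).symm
      · rfl)

/-- The restriction morphism `f^* : D^B ⟶ D^A` of prederivators, for `f : A ⟶ B`. -/
def restr {A B : Cat.{w, w}} (u : A ⟶ B) (D : Prederivator.{w, v, u}) :
    toPDER (shift B D) ⟶ toPDER (shift A D) :=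
  InducedBicategory.mkHom (postcomp₁ D.toPseudofunctor (prodRight u))


/-- The category `D(A)`. -/
abbrev val (D : Prederivator.{w, v, u}) (A : Cat.{w, w}) : Cat.{v, u} := D.obj (op A)

/-- The restriction functor `f^* : D(B) ⥤ D(A)`. -/
abbrev res (D : Prederivator.{w, v, u}) {A B : Cat.{w, w}} (f : A ⟶ B) : val D B ⥤ val D A :=
  (D.map f.op).toFunctor

/-- The terminal category. -/
def pt : Cat.{w, w} := Cat.of (Discrete PUnit.{w + 1})

/-- The functor `1 ⟶ A` classifying the object `a`. -/
def ptHom {A : Cat.{w, w}} (a : A) : pt.{w} ⟶ A := (Functor.fromPUnit a).toCatHom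

/-- The functor `A ⟶ 1`. -/
def toPt (A : Cat.{w, w}) : A ⟶ pt.{w} := (Functor.star A).toCatHom

/-- The evaluation functor `X ↦ X_a`. -/
abbrev eval (D : Prederivator.{w, v, u}) {A : Cat.{w, w}} (a : A) : val D A ⥤ val D pt.{w} :=
  res D (ptHom a)

/-- (Der3): all restriction functors have a left and a right adjoint. -/
class HasKan (D : Prederivator.{w, v, u}) : Prop where
  left {A B : Cat.{w, w}} (f : A ⟶ B) : (res D f).IsRightAdjoint
  right {A B : Cat.{w, w}} (f : A ⟶ B) : (res D f).IsLeftAdjoint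

attribute [instance] HasKan.left HasKan.right

/-- The left Kan extension functor `f_!`. -/
def lan (D : Prederivator.{w, v, u}) [HasKan D] {A B : Cat.{w, w}} (f : A ⟶ B) :
    val D A ⥤ val D B := (res D f).leftAdjoint

/-- The right Kan extension functor `f_*`. -/
def ran (D : Prederivator.{w, v, u}) [HasKan D] {A B : Cat.{w, w}} (f : A ⟶ B) :
    val D A ⥤ val D B := (res D f).rightAdjoint

/-- The adjunction `f_! ⊣ f^*`. -/
def lanAdj (D : Prederivator.{w, v, u}) [HasKan D] {A B : Cat.{w, w}} (f : A ⟶ B) :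
    lan D f ⊣ res D f := CategoryTheory.Adjunction.ofIsRightAdjoint (res D f)

/-- The adjunction `f^* ⊣ f_*`. -/
def ranAdj (D : Prederivator.{w, v, u}) [HasKan D] {A B : Cat.{w, w}} (f : A ⟶ B) :
    res D f ⊣ ran D f := CategoryTheory.Adjunction.ofIsLeftAdjoint (res D f)

section
variable (D : Prederivator.{w, v, u}) {A B C E : Cat.{w, w}} {p : E ⟶ A} {q : E ⟶ B}
  {f : A ⟶ C} {g : B ⟶ C}

/-- The transformation `p^* f^* ⟶ q^* g^*` induced by a square `α : f p ⟶ g q`. -/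
def resSquare (α : p ≫ f ⟶ q ≫ g) : res D f ⋙ res D p ⟶ res D g ⋙ res D q :=
  (D.mapComp f.op p.op).inv.toNatTrans ≫ (D.map₂ (Bicategory.Opposite.op2 α)).toNatTrans ≫
    (D.mapComp g.op q.op).hom.toNatTrans

/-- The canonical mate `q_! p^* ⟶ q_! p^* f^* f_! ⟶ q_! q^* g^* f_! ⟶ g^* f_!`. -/
def leftMate [HasKan D] (α : p ≫ f ⟶ q ≫ g) :
    res D p ⋙ lan D q ⟶ lan D f ⋙ res D g :=
  ((mateEquiv (lanAdj D f) (lanAdj D q)).symm (.mk _ _ _ _ (resSquare D α))).natTrans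

/-- The canonical mate `f^* g_* ⟶ p_* p^* f^* g_* ⟶ p_* q^* g^* g_* ⟶ p_* q^*`. -/
def rightMate [HasKan D] (α : p ≫ f ⟶ q ≫ g) :
    ran D g ⋙ res D f ⟶ res D q ⋙ ran D p :=
  (mateEquiv (ranAdj D g) (ranAdj D p) (.mk _ _ _ _ (resSquare D α))).natTrans

end


section
variable {A B : Cat.{w, w}} (f : A ⟶ B) (b : B)

/-- The comma category `(f / b)`, with objects `(a, f a ⟶ b)`. -/
def overCat : Cat.{w, w} := Cat.of (CostructuredArrow f.toFunctor b)

/-- The projection `(f / b) ⟶ A`. -/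
def overProj : overCat f b ⟶ A := (CostructuredArrow.proj f.toFunctor b).toCatHom

/-- The canonical transformation `f ∘ p ⟶ b ∘ π` on `(f / b)`. -/
def overCell : overProj f b ≫ f ⟶ toPt (overCat f b) ≫ ptHom b :=
  Cat.Hom₂.ofNatTrans
    { app := fun (x : CostructuredArrow f.toFunctor b) => x.hom
      naturality := fun (x y : CostructuredArrow f.toFunctor b) (φ : x ⟶ y) =>
        (CostructuredArrow.w φ).trans (Category.comp_id _).symm }

/-- The comma category `(b / f)`, with objects `(a, b ⟶ f a)`. -/
def underCat : Cat.{w, w} := Cat.of (StructuredArrow b f.toFunctor)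

/-- The projection `(b / f) ⟶ A`. -/
def underProj : underCat f b ⟶ A := (StructuredArrow.proj b f.toFunctor).toCatHom

/-- The canonical transformation `b ∘ π ⟶ f ∘ q` on `(b / f)`. -/
def underCell : toPt (underCat f b) ≫ ptHom b ⟶ underProj f b ≫ f :=
  Cat.Hom₂.ofNatTrans
    { app := fun (x : StructuredArrow b f.toFunctor) => x.hom
      naturality := fun (x y : StructuredArrow b f.toFunctor) (φ : x ⟶ y) =>
        (Category.id_comp _).trans (StructuredArrow.w φ).symm }

end

/-- The coproduct (disjoint union) of a small family of small categories. -/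
def coprod {I : Type w} (A : I → Cat.{w, w}) : Cat.{w, w} := Cat.of (Σ i, A i)

/-- The inclusion of a summand. -/
def coprodIncl {I : Type w} (A : I → Cat.{w, w}) (i : I) : A i ⟶ coprod A :=
  Cat.Hom.ofFunctor (Sigma.incl (C := fun j => (A j : Type w)) i)

/-- Derivators: (Der1) coproducts are taken to products, (Der2) isomorphisms are detected
pointwise, (Der3) Kan extensions exist, (Der4) Kan extensions are computed pointwise. -/
class IsDerivator (D : Prederivator.{w, v, u}) : Prop extends HasKan D where
  der1 (I : Type w) (A : I → Cat.{w, w}) :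
    (Functor.pi' fun i => res D (coprodIncl A i)).IsEquivalence
  der2 {A : Cat.{w, w}} {X Y : val D A} (φ : X ⟶ Y)
    (h : ∀ a : A, IsIso ((eval D a).map φ)) : IsIso φ
  der4_left {A B : Cat.{w, w}} (f : A ⟶ B) (b : B) : IsIso (leftMate D (overCell f b))
  der4_right {A B : Cat.{w, w}} (f : A ⟶ B) (b : B) : IsIso (rightMate D (underCell f b))

/-- Vertices of the `n`-cube `[1]^n`. -/
structure Cube (n : ℕ) : Type w where
  coord : Fin n → Fin 2

instance (n : ℕ) : PartialOrder (Cube.{w} n) :=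
  PartialOrder.lift Cube.coord fun _ _ h => congrArg Cube.mk h

/-- The number `m_1 + ... + m_n`, i.e. the cardinality of the corresponding subset. -/
def Cube.card {n : ℕ} (m : Cube.{w} n) : ℕ := ∑ i, (m.coord i : ℕ)

/-- The `n`-cube `[1]^n` as a small category (poset). -/
def cube (n : ℕ) : Cat.{w, w} := Cat.of (Cube.{w} n)

/-- The full subcategory `[1]^n_{≤ k}`. -/
def cubeLE (n k : ℕ) : Cat.{w, w} := Cat.of {m : Cube.{w} n // m.card ≤ k}

/-- The full subcategory `[1]^n_{≥ k}`. -/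
def cubeGE (n k : ℕ) : Cat.{w, w} := Cat.of {m : Cube.{w} n // k ≤ m.card}

/-- The inclusion `i_{≤ k}`. -/
def inclLE (n k : ℕ) : cubeLE.{w} n k ⟶ cube n :=
  Cat.Hom.ofFunctor (Subtype.mono_coe fun m : Cube.{w} n => m.card ≤ k).functor

/-- The inclusion `i_{≥ k}`. -/
def inclGE (n k : ℕ) : cubeGE.{w} n k ⟶ cube n :=
  Cat.Hom.ofFunctor (Subtype.mono_coe fun m : Cube.{w} n => k ≤ m.card).functor

/-- The source of valence `n`, i.e. `[1]^n_{≤ 1}`. -/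
def source (n : ℕ) : Cat.{w, w} := cubeLE n 1

/-- The sink of valence `n`, i.e. `[1]^n_{≥ n - 1}` (for `n = 0` the truncated subtraction gives the
whole cube, as does `≥ -1`). -/
def sink (n : ℕ) : Cat.{w, w} := cubeGE n (n - 1)

section
variable (D : Prederivator.{w, v, u}) [HasKan D] {n : ℕ}

/-- The `n`-cube `X` lies in the essential image of `(i_{≥ 1})_*`. -/
def IsCartesian (X : val D (cube.{w} n)) : Prop := (ran D (inclGE n 1)).essImage X

/-- The `n`-cube `X` lies in the essential image of `(i_{≤ n - 1})_!`. -/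
def IsCocartesian (X : val D (cube.{w} n)) : Prop := (lan D (inclLE n (n - 1))).essImage X

/-- The `n`-cube `X` lies in the essential image of `(i_{≥ n - 1})_*`. -/
def IsStronglyCartesian (X : val D (cube.{w} n)) : Prop := (ran D (inclGE n (n - 1))).essImage X

/-- The `n`-cube `X` lies in the essential image of `(i_{≤ 1})_!`. -/
def IsStronglyCocartesian (X : val D (cube.{w} n)) : Prop := (lan D (inclLE n 1)).essImage X

end

/-- Stable derivators: pointed derivators in which cartesian and cocartesian squares coincide. -/
class IsStable (D : Prederivator.{w, v, u}) : Prop extends IsDerivator D where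
  pointed : Limits.HasZeroObject (val D pt.{w})
  stable (X : val D (cube.{w} 2)) : IsCartesian D X ↔ IsCocartesian D X

/-- A morphism of stable derivators is exact if it preserves zero objects and bicartesian squares. -/
structure IsExact {D E : Prederivator.{w, v, u}} [IsStable D] [IsStable E]
    (F : toPDER D ⟶ toPDER E) : Prop where
  zero (X : val D pt.{w}) (hX : Limits.IsZero X) :
    Limits.IsZero ((F.hom.app (op pt.{w})).toFunctor.obj X)
  bicartesian (X : val D (cube.{w} 2)) (hX : IsCartesian D X ∧ IsCocartesian D X) :
    IsCartesian E ((F.hom.app (op (cube.{w} 2))).toFunctor.obj X) ∧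
      IsCocartesian E ((F.hom.app (op (cube.{w} 2))).toFunctor.obj X)

set_option linter.checkUnivs false in
/-- Objects of the 2-category `DER_{St,ex}`. -/
structure StableDerivator where
  pre : Prederivator.{w, v, u}
  [isStable : IsStable pre]

attribute [instance] StableDerivator.isStable

/-- 1-cells of `DER_{St,ex}`: exact morphisms. -/
structure ExactMor (D E : StableDerivator.{w, v, u}) where
  hom : toPDER D.pre ⟶ toPDER E.pre
  exact : IsExact hom

instance : CategoryStruct StableDerivator.{w, v, u} where
  Hom := ExactMor
  id D := ⟨𝟙 (toPDER D.pre), ⟨fun _ h => h, fun _ h => h⟩⟩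
  comp F G := ⟨F.hom ≫ G.hom, ⟨fun _ h => G.exact.zero _ (F.exact.zero _ h),
    fun _ h => G.exact.bicartesian _ (F.exact.bicartesian _ h)⟩⟩

/-- 2-cells of `DER_{St,ex}`: arbitrary transformations (modifications). -/
structure ExactMor₂ {D E : StableDerivator.{w, v, u}} (F G : D ⟶ E) where
  hom : F.hom ⟶ G.hom

theorem ExactMor₂.ext {D E : StableDerivator.{w, v, u}} {F G : D ⟶ E} {α β : ExactMor₂ F G}
    (h : α.hom = β.hom) : α = β := by
  cases α; cases β; cases h; rfl

instance (D E : StableDerivator.{w, v, u}) : Category (D ⟶ E) where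
  Hom F G := ExactMor₂ F G
  id F := ⟨𝟙 F.hom⟩
  comp α β := ⟨α.hom ≫ β.hom⟩
  id_comp _ := ExactMor₂.ext (Category.id_comp _)
  comp_id _ := ExactMor₂.ext (Category.comp_id _)
  assoc _ _ _ := ExactMor₂.ext (Category.assoc _ _ _)

/-- Invertible 2-cells of `DER_{St,ex}`. -/
def exactIso {D E : StableDerivator.{w, v, u}} {F G : D ⟶ E} (e : F.hom ≅ G.hom) : F ≅ G where
  hom := ⟨e.hom⟩
  inv := ⟨e.inv⟩
  hom_inv_id := ExactMor₂.ext e.hom_inv_id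
  inv_hom_id := ExactMor₂.ext e.inv_hom_id

/-- The 2-category `DER_{St,ex}` of stable derivators, exact morphisms and all transformations. -/
instance : Bicategory StableDerivator.{w, v, u} where
  homCategory := inferInstance
  whiskerLeft F _ _ α := ExactMor₂.mk (F.hom ◁ ExactMor₂.hom α)
  whiskerRight α G := ExactMor₂.mk (ExactMor₂.hom α ▷ G.hom)
  associator F G H := exactIso (α_ F.hom G.hom H.hom)
  leftUnitor F := exactIso (λ_ F.hom)
  rightUnitor F := exactIso (ρ_ F.hom)
  whiskerLeft_id _ _ := ExactMor₂.ext (Bicategory.whiskerLeft_id _ _)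
  whiskerLeft_comp _ _ _ _ _ _ := ExactMor₂.ext (Bicategory.whiskerLeft_comp _ _ _)
  id_whiskerLeft _ := ExactMor₂.ext (Bicategory.id_whiskerLeft _)
  comp_whiskerLeft _ _ _ _ _ := ExactMor₂.ext (Bicategory.comp_whiskerLeft _ _ _)
  id_whiskerRight _ _ := ExactMor₂.ext (Bicategory.id_whiskerRight _ _)
  comp_whiskerRight _ _ _ := ExactMor₂.ext (Bicategory.comp_whiskerRight _ _ _)
  whiskerRight_id _ := ExactMor₂.ext (Bicategory.whiskerRight_id _)
  whiskerRight_comp _ _ _ := ExactMor₂.ext (Bicategory.whiskerRight_comp _ _ _)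
  whisker_assoc _ _ _ _ _ := ExactMor₂.ext (Bicategory.whisker_assoc _ _ _)
  whisker_exchange _ _ := ExactMor₂.ext (Bicategory.whisker_exchange _ _)
  pentagon _ _ _ _ := ExactMor₂.ext (Bicategory.pentagon _ _ _ _)
  triangle _ _ := ExactMor₂.ext (Bicategory.triangle _ _)

/-- The shift of a transformation of morphisms of prederivators. -/
def shift₂ (B : Cat.{w, w}) {D E : Prederivator.{w, v, u}} {F G : toPDER D ⟶ toPDER E} (α : F ⟶ G) :
    shift₁ B F ⟶ shift₁ B G :=
  InducedBicategory.mkHom₂ (precomp₂ (prodLeft B).toPseudofunctor α.hom)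

theorem pder₂_ext {D E : PDER.{w, v, u}} {F G : D ⟶ E} {α β : F ⟶ G}
    (h : ∀ C, α.hom.as.app C = β.hom.as.app C) : α = β :=
  InducedBicategory.hom₂_ext (Pseudofunctor.StrongTrans.homCategory.ext h)

section
variable {B : Type u₁} [Bicategory.{w₁, v₁} B] {a b c d : B}

theorem associator_aux (f : a ⟶ b) (g : b ⟶ c) (h : c ⟶ d) :
    (α_ f g h).hom = 𝟙 _ ≫ 𝟙 (f ≫ g) ▷ h ≫ (α_ f g h).hom ≫ f ◁ 𝟙 (g ≫ h) ≫ 𝟙 _ := by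
  simp

theorem leftUnitor_aux (f : a ⟶ b) : (λ_ f).hom = 𝟙 _ ≫ 𝟙 (𝟙 a) ▷ f ≫ (λ_ f).hom := by
  simp

theorem rightUnitor_aux (f : a ⟶ b) : (ρ_ f).hom = 𝟙 _ ≫ f ◁ 𝟙 (𝟙 b) ≫ (ρ_ f).hom := by
  simp

end

/-- The 2-functor `(-)^B` on `DER_{St,ex}`. Its values are derivators; as `DER` is a full
sub-2-category of `PDER`, transformations and equivalences between such 2-functors are the same
whether taken with values in `DER` or in `PDER`. -/
def shiftFunctor (B : Cat.{w, w}) : Pseudofunctor StableDerivator.{w, v, u} PDER.{w, v, u} where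
  obj D := toPDER (shift B D.pre)
  map F := shift₁ B (ExactMor.hom F)
  map₂ α := shift₂ B (ExactMor₂.hom α)
  map₂_id _ := rfl
  map₂_comp _ _ := rfl
  mapId _ := Iso.refl _
  mapComp _ _ := Iso.refl _
  map₂_whisker_left _ _ _ _ := pder₂_ext fun _ =>
    ((Category.id_comp _).trans (Category.comp_id _)).symm
  map₂_whisker_right _ _ := pder₂_ext fun _ =>
    ((Category.id_comp _).trans (Category.comp_id _)).symm
  map₂_associator F G H := pder₂_ext fun C =>
    associator_aux (((shift₁ B (ExactMor.hom F)).hom.app C))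
      ((shift₁ B (ExactMor.hom G)).hom.app C) ((shift₁ B (ExactMor.hom H)).hom.app C)
  map₂_left_unitor F := pder₂_ext fun C => leftUnitor_aux ((shift₁ B (ExactMor.hom F)).hom.app C)
  map₂_right_unitor F := pder₂_ext fun C => rightUnitor_aux ((shift₁ B (ExactMor.hom F)).hom.app C)

set_option linter.checkUnivs false in
/-- A strong stable equivalence between small categories `A` and `B`: a pseudo-natural
transformation between the 2-functors `(-)^A` and `(-)^B` on `DER_{St,ex}` all of whose components
are equivalences, i.e. a pseudo-natural equivalence. -/
structure StrongStableEquivalence (A B : Cat.{w, w}) where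
  trans : Pseudofunctor.StrongTrans (shiftFunctor.{w, v, u} A) (shiftFunctor.{w, v, u} B)
  isEquivalence (D : StableDerivator.{w, v, u}) :
    ∃ e : Bicategory.Equivalence (toPDER (shift A D.pre)) (toPDER (shift B D.pre)),
      e.hom = trans.app D

section
variable (D : Prederivator.{w, v, u}) (P : D.toPseudofunctor.ObjectProperty)

theorem fullSub_functor_ext {C : Type u₁} [Category.{v₁} C] {Q : ObjectProperty C} {C' : Type u₂}
    [Category.{v₂} C'] {F G : C' ⥤ Q.FullSubcategory} (h : F ⋙ Q.ι = G ⋙ Q.ι) : F = G := by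
  have ho : ∀ X, F.obj X = G.obj X := fun X => by
    have := Functor.congr_obj h X
    exact ObjectProperty.FullSubcategory.ext this
  refine CategoryTheory.Functor.ext ho fun X Y f => ?_
  apply Q.ι.map_injective
  have := Functor.congr_hom h f
  simp only [Functor.comp_map] at this
  rw [this]
  simp

theorem fullSub_iso_ext {C : Cat.{v, u}} {X : (Cat.{w, w})ᵒᵖ}
    {F G : C ⟶ Cat.of (P.Obj X)} (h : F = G) (e : F ≅ G)
    (h' : ∀ M : C, ∃ k, (P.prop X).ι.map (e.hom.toNatTrans.app M) = eqToHom k) :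
    e = eqToIso h := by
  subst h
  refine Iso.ext (Cat.Hom₂.ext (NatTrans.ext (funext fun M => ?_)))
  obtain ⟨k, hk⟩ := h' M
  apply (P.prop X).ι.map_injective
  rw [hk, eqToHom_refl]
  exact ((P.prop X).ι.map_id _).symm

variable [P.IsClosedUnderMapObj]

/-- The full subprederivator spanned by a property of objects which is stable under restriction. -/
def fullSub : Prederivator.{w, v, u} where
  toPseudofunctor := P.fullsubcategory
  map_id A := by
    refine Cat.ext (fullSub_functor_ext ?_)
    exact congrArg (fun t => (P.prop A).ι ⋙ Cat.Hom.toFunctor t) (D.map_id A)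
  mapId_eq_eqToIso A := by
    refine fullSub_iso_ext D P _ _ fun M => ⟨Functor.congr_obj (congrArg Cat.Hom.toFunctor
      (D.map_id A)) M.obj, ?_⟩
    change (D.mapId A).hom.toNatTrans.app M.obj = _
    rw [D.mapId_eq_eqToIso A]
    exact Cat.eqToHom_app _ _ (D.map_id A) M.obj
  map_comp f g := by
    refine Cat.ext (fullSub_functor_ext ?_)
    exact congrArg (fun t => (P.prop _).ι ⋙ Cat.Hom.toFunctor t) (D.map_comp f g)
  mapComp_eq_eqToIso f g := by
    refine fullSub_iso_ext D P _ _ fun M => ⟨Functor.congr_obj (congrArg Cat.Hom.toFunctor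
      (D.map_comp f g)) M.obj, ?_⟩
    change (D.mapComp f g).hom.toNatTrans.app M.obj = _
    rw [D.mapComp_eq_eqToIso f g]
    exact Cat.eqToHom_app _ _ (D.map_comp f g) M.obj

/-- The inclusion of a full subprederivator. -/
def fullSubIncl : toPDER (fullSub D P) ⟶ toPDER D :=
  InducedBicategory.mkHom P.ι

end


/-- The functor `B ⟶ B × C`, `b ↦ (b, c)`. -/
def atObj (B : Cat.{w, w}) {C : Cat.{w, w}} (c : C) : B ⟶ Cat.of (B × C) :=
  Cat.Hom.ofFunctor (Functor.prod' (𝟭 B) ((Functor.const B).obj c))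

theorem atObj_comp (B : Cat.{w, w}) {C C' : Cat.{w, w}} (f : C ⟶ C') (c : C) :
    atObj B c ≫ ((𝟭 B).prod f.toFunctor).toCatHom = atObj B (f.toFunctor.obj c) :=
  Cat.ext (CategoryTheory.Functor.ext (fun _ => rfl) fun X Y g => by
    refine Eq.trans (b := Prod.mkHom g (𝟙 (f.toFunctor.obj c))) ?_
      ((Category.id_comp _).trans (Category.comp_id _)).symm
    exact Prod.ext rfl (f.toFunctor.map_id c))

section
variable (D : Prederivator.{w, v, u}) [HasKan D] (n : ℕ)

/-- An object of `D^{[1]^n}(C)` is strongly bicartesian if for all `c : C` the `n`-cube `X_c` in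
`D([1]^n)` is strongly cartesian and strongly cocartesian. -/
def stronglyBicartesianProp : (shift (cube.{w} n) D).toPseudofunctor.ObjectProperty where
  prop C X := ∀ c : C.unop,
    IsStronglyCartesian D ((res D (atObj (cube n) c)).obj X) ∧
      IsStronglyCocartesian D ((res D (atObj (cube n) c)).obj X)

instance : (stronglyBicartesianProp D n).IsClosedUnderMapObj where
  map_obj {C C'} X hX f c := by
    have h : (res D (atObj (cube n) c)).obj ((((shift (cube n) D).map f).toFunctor).obj X) =
        (res D (atObj (cube n) (f.unop.toFunctor.obj c))).obj X := by
      have := congrArg Quiver.Hom.op (atObj_comp (cube.{w} n) f.unop c)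
      have h2 := D.map_comp ((𝟭 (cube.{w} n)).prod f.unop.toFunctor).toCatHom.op
        (atObj (cube n) c).op
      exact (Functor.congr_obj (congrArg Cat.Hom.toFunctor
        (h2.symm.trans (congrArg D.map this))) X)
    have := hX (f.unop.toFunctor.obj c)
    rw [← h] at this
    exact this

/-- The full subprederivator of `D^{[1]^n}` spanned by the strongly bicartesian `n`-cubes. -/
def StronglyBicartesianCubes : Prederivator.{w, v, u} := fullSub _ (stronglyBicartesianProp D n)

/-- The inclusion of the strongly bicartesian `n`-cubes into `D^{[1]^n}`. -/
def stronglyBicartesianIncl :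
    toPDER (StronglyBicartesianCubes D n) ⟶ toPDER (shift (cube n) D) :=
  fullSubIncl _ (stronglyBicartesianProp D n)

end

end Derivators

end

open Derivators

/-! Describe a vertex of the cube by the set of its coordinates equal to 1. A cube is strongly
cocartesian when its value at each vertex b is the colimit of its values at the subsets of b with at
most one element. The decisive point is that this holds at all vertices if and only if every
two-dimensional face is cocartesian. For b = U ∪ {s, t}, let K be the set of vertices below U ∪ {s}
or below U ∪ {t}. By induction the diagram on K is left Kan extended from its vertices of
cardinality at most one, so these compute the colimit over K; on the other hand {U, U ∪ {s}, U ∪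
{t}} is final in K. Hence b is the colimit of its small subsets exactly when the square from U to b
is a pushout (`star_iff_square`). The argument needs only finality, transitivity of extensions and
the colimit of a diagram with a terminal object, so it is carried out for an abstract predicate;
reading vertices by their zero coordinates gives the dual. In a stable derivator cartesian and
cocartesian faces agree, whence strongly cartesian and strongly cocartesian cubes agree.

Since the inclusion of the source is fully faithful, left Kan extension along it identifies diagrams
on the source with the cubes M for which maps out of M correspond to maps between restrictions
(`IsLeftExt`). These are the strongly cocartesian, hence the strongly bicartesian cubes. The sink is
dual. With a parameter category C the condition can be checked at each object of C
(`isLeftExt_prodMap_iff`).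

Coherence is handled by one principle: pointwise left adjoints of a pseudo-natural transformation
assemble to a left adjoint as soon as their mates are invertible (`leftAdjTransAdj`). If the units
are invertible, each mate becomes invertible after restriction; so it is invertible once its two
ends lie in a class of objects on which restriction reflects isomorphisms. With C varying, this
gives the adjoints and equivalences in `PDER`. With the stable derivator varying, it makes extension
from the source pseudo-natural, because exact morphisms preserve bicartesian squares and hence, by
the face criterion, strongly cocartesian cubes (`isIso_leftAdjMate_restrTrans`). The equivalence Φ
extends from the source to the cube and restricts to the sink; its compatibility with the two
identifications is formal. -/

noncomputable section

namespace Derivators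

universe w₁ w₂ w₃ v₁ v₂ v₃ u₁ u₂ u₃

/-! ### The 2-functorial calculus of restriction. -/

section restriction
variable (D : Prederivator.{w, v, u}) {A B C E : Cat.{w, w}}

/-- The transformation of restriction functors induced by a transformation of functors. -/
def res₂ {f g : A ⟶ B} (α : f ⟶ g) : res D f ⟶ res D g :=
  (D.map₂ (Bicategory.Opposite.op2 α)).toNatTrans

/-- Restriction along a composite. -/
def resComp (f : A ⟶ B) (g : B ⟶ C) : res D (f ≫ g) ≅ res D g ⋙ res D f where
  hom := (D.mapComp g.op f.op).hom.toNatTrans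
  inv := (D.mapComp g.op f.op).inv.toNatTrans
  hom_inv_id := congrArg Cat.Hom₂.toNatTrans (D.mapComp g.op f.op).hom_inv_id
  inv_hom_id := congrArg Cat.Hom₂.toNatTrans (D.mapComp g.op f.op).inv_hom_id

/-- Restriction along the identity. -/
def resId (A : Cat.{w, w}) : res D (𝟙 A) ≅ 𝟭 (val D A) where
  hom := (D.mapId (op A)).hom.toNatTrans
  inv := (D.mapId (op A)).inv.toNatTrans
  hom_inv_id := congrArg Cat.Hom₂.toNatTrans (D.mapId (op A)).hom_inv_id
  inv_hom_id := congrArg Cat.Hom₂.toNatTrans (D.mapId (op A)).inv_hom_id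

@[simp]
theorem res₂_id (f : A ⟶ B) : res₂ D (𝟙 f) = 𝟙 _ :=
  congrArg Cat.Hom₂.toNatTrans (D.map₂_id f.op)

theorem res₂_comp {f g h : A ⟶ B} (α : f ⟶ g) (β : g ⟶ h) :
    res₂ D (α ≫ β) = res₂ D α ≫ res₂ D β :=
  congrArg Cat.Hom₂.toNatTrans (D.map₂_comp (Bicategory.Opposite.op2 α)
    (Bicategory.Opposite.op2 β))

instance isIso_res₂ {f g : A ⟶ B} (α : f ⟶ g) [IsIso α] : IsIso (res₂ D α) :=
  ⟨res₂ D (inv α), by rw [← res₂_comp, IsIso.hom_inv_id, res₂_id],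
    by rw [← res₂_comp, IsIso.inv_hom_id, res₂_id]⟩

theorem res₂_whiskerLeft (k : A ⟶ B) {f g : B ⟶ C} (α : f ⟶ g) (M : val D C) :
    (res₂ D (k ◁ α)).app M ≫ (resComp D k g).hom.app M =
      (resComp D k f).hom.app M ≫ (res D k).map ((res₂ D α).app M) := by
  -- Reversal of 1-cells exchanges left and right whiskering.
  have h := D.map₂_whisker_right (Bicategory.Opposite.op2 α) k.op
  rw [← Category.assoc, Iso.eq_comp_inv] at h
  exact congrArg (fun t => t.toNatTrans.app M) h

theorem res₂_whiskerRight {f g : A ⟶ B} (α : f ⟶ g) (h : B ⟶ C) (M : val D C) :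
    (res₂ D (α ▷ h)).app M ≫ (resComp D g h).hom.app M =
      (resComp D f h).hom.app M ≫ (res₂ D α).app ((res D h).obj M) := by
  have h := D.map₂_whisker_left h.op (Bicategory.Opposite.op2 α)
  rw [← Category.assoc, Iso.eq_comp_inv] at h
  exact congrArg (fun t => t.toNatTrans.app M) h

theorem res₂_associator_inv (f : A ⟶ B) (g : B ⟶ C) (h : C ⟶ E) (M : val D E) :
    (res₂ D (α_ f g h).inv).app M ≫ (resComp D (f ≫ g) h).hom.app M ≫
        (resComp D f g).hom.app ((res D h).obj M) =
      (resComp D f (g ≫ h)).hom.app M ≫ (res D f).map ((resComp D g h).hom.app M) := by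
  have := D.map₂_associator h.op g.op f.op
  have := congrArg (fun t => t.toNatTrans.app M) this
  refine (congrArg (fun t => t ≫ (resComp D (f ≫ g) h).hom.app M ≫
    (resComp D f g).hom.app ((res D h).obj M)) this).trans ?_
  change ((resComp D f (g ≫ h)).hom.app M ≫ (res D f).map ((resComp D g h).hom.app M) ≫
    𝟙 _ ≫ (resComp D f g).inv.app ((res D h).obj M) ≫ (resComp D (f ≫ g) h).inv.app M) ≫
    (resComp D (f ≫ g) h).hom.app M ≫ (resComp D f g).hom.app ((res D h).obj M) = _
  simp

end restriction

/-! ### Restriction along adjoint functors, and the point. -/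

/-- An adjunction in a bicategory gives an adjunction in its opposite. -/
def opAdj {B : Type*} [Bicategory B] {a b : B} {l : a ⟶ b} {k : b ⟶ a}
    (adj : Bicategory.Adjunction l k) : Bicategory.Adjunction k.op l.op where
  unit := Bicategory.Opposite.op2 adj.unit
  counit := Bicategory.Opposite.op2 adj.counit
  left_triangle := by
    -- Reversing 1-cells but not 2-cells exchanges the two triangle identities.
    have h := congrArg Bicategory.Opposite.op2 adj.right_triangle
    simp only [rightZigzag, leftZigzag, bicategoricalComp, Bicategory.Opposite.op2_comp] at h ⊢
    simpa [BicategoricalCoherence.iso] using h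
  right_triangle := by
    have h := congrArg Bicategory.Opposite.op2 adj.left_triangle
    simp only [rightZigzag, leftZigzag, bicategoricalComp, Bicategory.Opposite.op2_comp] at h ⊢
    simpa [BicategoricalCoherence.iso] using h

section
variable (D : Prederivator.{w, v, u}) {A B C E : Cat.{w, w}}

/-- An adjunction between small categories induces an adjunction of restriction functors. -/
def resAdj {l : A ⟶ B} {k : B ⟶ A} (adj : Bicategory.Adjunction l k) : res D k ⊣ res D l :=
  Adjunction.ofCat (D.toPseudofunctor.mapAdjunction (opAdj adj))

theorem resAdj_unit {l : A ⟶ B} {k : B ⟶ A} (adj : Bicategory.Adjunction l k) (X : val D A) :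
    (resAdj D adj).unit.app X =
      (resId D A).inv.app X ≫ (res₂ D adj.unit).app X ≫ (resComp D l k).hom.app X := rfl

theorem resAdj_counit {l : A ⟶ B} {k : B ⟶ A} (adj : Bicategory.Adjunction l k) (X : val D B) :
    (resAdj D adj).counit.app X =
      (resComp D k l).inv.app X ≫ (res₂ D adj.counit).app X ≫ (resId D B).hom.app X := rfl

instance : Subsingleton pt.{w} := inferInstanceAs (Subsingleton (Discrete PUnit))

instance (x y : pt.{w}) : Subsingleton (x ⟶ y) :=
  inferInstanceAs (Subsingleton (ULift (PLift (_ = _))))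

/-- Units and counits become invertible after whiskering with a functor to the point; the finality
of right adjoints and the initiality of left adjoints rest on this. -/
instance isIso_to_pt {f g : A ⟶ pt.{w}} (α : f ⟶ g) : IsIso α := by
  refine ⟨Cat.Hom₂.ofNatTrans
    { app := fun x => eqToHom (Subsingleton.elim _ _)
      naturality := fun _ _ _ => Subsingleton.elim _ _ }, ?_, ?_⟩
  all_goals exact Cat.Hom₂.ext (NatTrans.ext (funext fun x => Subsingleton.elim _ _))

theorem eq_toPt (f : A ⟶ pt.{w}) : f = toPt A :=
  Cat.ext (CategoryTheory.Functor.ext (fun _ => Subsingleton.elim _ _)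
    fun _ _ _ => Subsingleton.elim _ _)

end

/-! ### Universal arrows and the pointwise criterion for Kan extensions. -/

section universal
variable (D : Prederivator.{w, v, u}) {A B C : Cat.{w, w}}

/-- `φ : Y ⟶ q^* W` exhibits `W` as the left Kan extension of `Y` along `q`. -/
def IsUniv (q : A ⟶ B) {Y : val D A} {W : val D B} (φ : Y ⟶ (res D q).obj W) : Prop :=
  ∀ Z : val D B, Function.Bijective fun g : W ⟶ Z => φ ≫ (res D q).map g

/-- `φ : q^* W ⟶ Y` exhibits `W` as the right Kan extension of `Y` along `q`. -/
def IsCouniv (q : A ⟶ B) {Y : val D A} {W : val D B} (φ : (res D q).obj W ⟶ Y) : Prop :=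
  ∀ Z : val D B, Function.Bijective fun g : Z ⟶ W => (res D q).map g ≫ φ

variable {D}

theorem bijective_precomp_iff {C : Type*} [Category* C] {X Y : C} (f : X ⟶ Y) :
    (∀ Z, Function.Bijective fun g : Y ⟶ Z => f ≫ g) ↔ IsIso f := by
  constructor
  · intro h
    obtain ⟨g, hg⟩ := (h X).2 (𝟙 X)
    refine ⟨g, hg, (h Y).1 ?_⟩
    dsimp only at hg ⊢
    rw [← Category.assoc, hg, Category.id_comp, Category.comp_id]
  · intro _ Z
    exact ⟨fun a b h => (cancel_epi f).1 h, fun b => ⟨inv f ≫ b, by simp⟩⟩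

theorem bijective_postcomp_iff {C : Type*} [Category* C] {X Y : C} (f : X ⟶ Y) :
    (∀ Z, Function.Bijective fun g : Z ⟶ X => g ≫ f) ↔ IsIso f := by
  constructor
  · intro h
    obtain ⟨g, hg⟩ := (h Y).2 (𝟙 Y)
    refine ⟨g, (h X).1 ?_, hg⟩
    dsimp only at hg ⊢
    rw [Category.assoc, hg, Category.id_comp, Category.comp_id]
  · intro _ Z
    exact ⟨fun a b h => (cancel_mono f).1 h, fun b => ⟨b ≫ inv f, by simp⟩⟩

/-- Transposition turns the map in the definition of `IsUniv` into precomposition with the transpose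
of φ, and the Yoneda lemma applies. -/
theorem isUniv_iff_isIso [HasKan D] (q : A ⟶ B) {Y : val D A} {W : val D B}
    (φ : Y ⟶ (res D q).obj W) :
    IsUniv D q φ ↔ IsIso (((lanAdj D q).homEquiv Y W).symm φ) := by
  rw [← bijective_precomp_iff]
  refine forall_congr' fun Z => ?_
  rw [← Function.Bijective.of_comp_iff' ((lanAdj D q).homEquiv Y Z).symm.bijective]
  refine iff_of_eq (congrArg _ (funext fun g => ?_))
  exact (lanAdj D q).homEquiv_naturality_right_symm φ g

theorem isCouniv_iff_isIso [HasKan D] (q : A ⟶ B) {Y : val D A} {W : val D B}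
    (φ : (res D q).obj W ⟶ Y) :
    IsCouniv D q φ ↔ IsIso ((ranAdj D q).homEquiv W Y φ) := by
  rw [← bijective_postcomp_iff]
  refine forall_congr' fun Z => ?_
  rw [← Function.Bijective.of_comp_iff' ((ranAdj D q).homEquiv Z Y).bijective]
  refine iff_of_eq (congrArg _ (funext fun g => ?_))
  exact (ranAdj D q).homEquiv_naturality_left g φ

theorem isUniv_unit [HasKan D] (q : A ⟶ B) (Y : val D A) :
    IsUniv D q ((lanAdj D q).unit.app Y) := by
  refine (isUniv_iff_isIso q _).2 ?_
  have h : ((lanAdj D q).homEquiv Y _).symm ((lanAdj D q).unit.app Y) = 𝟙 _ :=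
    (Equiv.symm_apply_eq _).2 ((lanAdj D q).homEquiv_id Y).symm
  exact (congrArg IsIso h).mpr (IsIso.id _)

theorem isCouniv_counit [HasKan D] (q : A ⟶ B) (Y : val D A) :
    IsCouniv D q ((ranAdj D q).counit.app Y) := by
  refine (isCouniv_iff_isIso q _).2 ?_
  have h : (ranAdj D q).homEquiv _ Y ((ranAdj D q).counit.app Y) = 𝟙 _ :=
    ((Equiv.symm_apply_eq _).1 ((ranAdj D q).homEquiv_symm_id Y)).symm
  exact h ▸ inferInstance

theorem isUniv_precomp_iff (q : A ⟶ B) {Y Y' : val D A} {W : val D B}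
    (e : Y' ⟶ Y) [IsIso e] (φ : Y ⟶ (res D q).obj W) :
    IsUniv D q (e ≫ φ) ↔ IsUniv D q φ := by
  refine forall_congr' fun Z => ?_
  rw [← Function.Bijective.of_comp_iff' (((bijective_precomp_iff e).2 ‹_›) _)]
  simp [Function.comp_def]

theorem isUniv_postcomp_iff (q : A ⟶ B) {Y : val D A} {W W' : val D B}
    (φ : Y ⟶ (res D q).obj W) (e : W ⟶ W') [IsIso e] :
    IsUniv D q (φ ≫ (res D q).map e) ↔ IsUniv D q φ := by
  refine forall_congr' fun Z => ?_
  rw [← Function.Bijective.of_comp_iff _ (((bijective_precomp_iff e).2 ‹_›) _)]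
  simp [Function.comp_def]

theorem isCouniv_postcomp_iff (q : A ⟶ B) {Y Y' : val D A} {W : val D B}
    (φ : (res D q).obj W ⟶ Y) (e : Y ⟶ Y') [IsIso e] :
    IsCouniv D q (φ ≫ e) ↔ IsCouniv D q φ := by
  refine forall_congr' fun Z => ?_
  rw [← Function.Bijective.of_comp_iff' (((bijective_postcomp_iff e).2 ‹_›) _)]
  simp [Function.comp_def]

theorem isCouniv_precomp_iff (q : A ⟶ B) {Y : val D A} {W W' : val D B}
    (e : W' ⟶ W) [IsIso e] (φ : (res D q).obj W ⟶ Y) :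
    IsCouniv D q ((res D q).map e ≫ φ) ↔ IsCouniv D q φ := by
  refine forall_congr' fun Z => ?_
  rw [← Function.Bijective.of_comp_iff _ (((bijective_postcomp_iff e).2 ‹_›) _)]
  simp [Function.comp_def]

/-- Left Kan extensions are detected pointwise. -/
theorem isUniv_iff_pointwise [IsDerivator D] (f : A ⟶ B) {Y : val D A} {X : val D B}
    (y : Y ⟶ (res D f).obj X) :
    IsUniv D f y ↔ ∀ b : B, IsUniv D (toPt (overCat f b))
      ((res D (overProj f b)).map y ≫ (resSquare D (overCell f b)).app X) := by
  set t := ((lanAdj D f).homEquiv Y X).symm y with ht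
  have h1 : IsIso t ↔ ∀ b : B, IsIso ((eval D b).map t) :=
    ⟨fun _ _ => inferInstance, IsDerivator.der2 t⟩
  rw [isUniv_iff_isIso, ← ht, h1]
  refine forall_congr' fun b => ?_
  have := IsDerivator.der4_left (D := D) f b
  -- By (Der4) the mate is invertible and may be inserted. The composite is then the transpose of
  -- the arrow over (f/b), by the identity relating units and mates.
  have h2 : IsIso ((eval D b).map t) ↔
      IsIso ((leftMate D (overCell f b)).app Y ≫ (eval D b).map t) :=
    (isIso_comp_left_iff _ _).symm
  rw [h2, isUniv_iff_isIso]
  refine iff_of_eq (congrArg IsIso ?_)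
  rw [Equiv.eq_symm_apply, Adjunction.homEquiv_unit, Functor.map_comp]
  have h3 := unit_mateEquiv_symm (lanAdj D f) (lanAdj D (toPt (overCat f b)))
    (.mk _ _ _ _ (resSquare D (overCell f b))) Y
  refine ((Category.assoc _ _ _).symm.trans (congrArg (· ≫ _) h3.symm)).trans ?_
  have h4 := (resSquare D (overCell f b)).naturality t
  refine (Category.assoc _ _ _).trans ((congrArg (_ ≫ ·) h4.symm).trans ?_)
  rw [← Category.assoc]
  refine congrArg (· ≫ _) ?_
  refine ((res D (overProj f b)).map_comp _ _).symm.trans (congrArg _ ?_)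
  exact ((lanAdj D f).homEquiv_unit _ _ _).symm.trans (Equiv.apply_symm_apply _ _)

/-- Right Kan extensions are detected pointwise. -/
theorem isCouniv_iff_pointwise [IsDerivator D] (f : A ⟶ B) {Y : val D A} {X : val D B}
    (y : (res D f).obj X ⟶ Y) :
    IsCouniv D f y ↔ ∀ b : B, IsCouniv D (toPt (underCat f b))
      ((resSquare D (underCell f b)).app X ≫ (res D (underProj f b)).map y) := by
  set t := (ranAdj D f).homEquiv X Y y with ht
  have h1 : IsIso t ↔ ∀ b : B, IsIso ((eval D b).map t) :=
    ⟨fun _ _ => inferInstance, IsDerivator.der2 t⟩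
  rw [isCouniv_iff_isIso, ← ht, h1]
  refine forall_congr' fun b => ?_
  have := IsDerivator.der4_right (D := D) f b
  have h2 : IsIso ((eval D b).map t) ↔
      IsIso ((eval D b).map t ≫ (rightMate D (underCell f b)).app Y) :=
    (isIso_comp_right_iff _ _).symm
  rw [h2, isCouniv_iff_isIso]
  refine iff_of_eq (congrArg IsIso ?_)
  rw [← Equiv.symm_apply_eq, Adjunction.homEquiv_counit, Functor.map_comp]
  have h3 := mateEquiv_counit (ranAdj D f) (ranAdj D (toPt (underCat f b)))
    (.mk _ _ _ _ (resSquare D (underCell f b))) Y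
  refine ((Category.assoc _ _ _).trans (congrArg (_ ≫ ·) h3)).trans ?_
  have h4 := (resSquare D (underCell f b)).naturality t
  refine (Category.assoc _ _ _).symm.trans ((congrArg (· ≫ _) h4).trans ?_)
  rw [Category.assoc]
  refine congrArg (_ ≫ ·) ?_
  refine ((res D (underProj f b)).map_comp _ _).symm.trans (congrArg _ ?_)
  exact ((ranAdj D f).homEquiv_counit _ _ _).symm.trans (Equiv.symm_apply_apply _ _)

/-- Restricting a left Kan extension along `k`. -/
theorem isUniv_restrict_iff (k : A ⟶ B) (q : B ⟶ C) {Y : val D B} {W : val D C}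
    (φ : Y ⟶ (res D q).obj W)
    (H : ∀ Z : val D C, Function.Bijective
      fun g : Y ⟶ (res D q).obj Z => (res D k).map g) :
    IsUniv D (k ≫ q) ((res D k).map φ ≫ (resComp D k q).inv.app W) ↔ IsUniv D q φ := by
  refine forall_congr' fun Z => ?_
  rw [← Function.Bijective.of_comp_iff' (H Z), ← Function.Bijective.of_comp_iff'
    (((bijective_postcomp_iff ((resComp D k q).inv.app Z)).2 inferInstance) _)]
  refine iff_of_eq (congrArg _ (funext fun g => ?_))
  have := (resComp D k q).inv.naturality g
  simp only [Function.comp_apply, Functor.map_comp, Category.assoc]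
  exact congrArg (_ ≫ ·) this.symm

theorem isCouniv_restrict_iff (k : A ⟶ B) (q : B ⟶ C) {Y : val D B} {W : val D C}
    (φ : (res D q).obj W ⟶ Y)
    (H : ∀ Z : val D C, Function.Bijective
      fun g : (res D q).obj Z ⟶ Y => (res D k).map g) :
    IsCouniv D (k ≫ q) ((resComp D k q).hom.app W ≫ (res D k).map φ) ↔ IsCouniv D q φ := by
  refine forall_congr' fun Z => ?_
  rw [← Function.Bijective.of_comp_iff' (H Z), ← Function.Bijective.of_comp_iff'
    (((bijective_precomp_iff ((resComp D k q).hom.app Z)).2 inferInstance) _)]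
  refine iff_of_eq (congrArg _ (funext fun g => ?_))
  have := (resComp D k q).hom.naturality g
  simp only [Function.comp_apply, Functor.map_comp]
  exact ((Category.assoc _ _ _).symm.trans (congrArg (· ≫ _) this)).trans (Category.assoc _ _ _)

/-- Functors with a left adjoint are final. -/
theorem bijective_restrict_of_rightAdjoint {l : B ⟶ A} {k : A ⟶ B}
    (adj : Bicategory.Adjunction l k) (q : B ⟶ pt.{w}) (Y : val D B) (Z : val D pt.{w}) :
    Function.Bijective fun g : Y ⟶ (res D q).obj Z => (res D k).map g := by
  -- The unit whiskered with q is a 2-cell into the point, hence invertible. So the unit of the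
  -- adjunction of restriction functors is invertible at q^* Z.
  have h := res₂_whiskerRight D adj.unit q Z
  have h' : IsIso ((res₂ D adj.unit).app ((res D q).obj Z)) := by
    have h₁ : IsIso ((res₂ D (adj.unit ▷ q)).app Z ≫ (resComp D (l ≫ k) q).hom.app Z) :=
      inferInstance
    rw [h] at h₁
    exact IsIso.of_isIso_comp_left ((resComp D (𝟙 B) q).hom.app Z) _
  have : IsIso ((resAdj D adj).unit.app ((res D q).obj Z)) := by
    rw [resAdj_unit]
    infer_instance
  -- Restriction followed by transposition is postcomposition with the unit.
  rw [← Function.Bijective.of_comp_iff' ((resAdj D adj).homEquiv Y _).bijective]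
  refine (iff_of_eq (congrArg _ (funext fun g => ?_))).1
    (((bijective_postcomp_iff ((resAdj D adj).unit.app ((res D q).obj Z))).2 this) Y)
  exact ((resAdj D adj).unit_naturality g).symm.trans (Adjunction.homEquiv_unit _ _ _ _).symm

/-- Functors with a right adjoint are initial. -/
theorem bijective_restrict_of_leftAdjoint {k : A ⟶ B} {r : B ⟶ A}
    (adj : Bicategory.Adjunction k r) (q : B ⟶ pt.{w}) (Y : val D B) (Z : val D pt.{w}) :
    Function.Bijective fun g : (res D q).obj Z ⟶ Y => (res D k).map g := by
  have h := res₂_whiskerRight D adj.counit q Z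
  have h' : IsIso ((res₂ D adj.counit).app ((res D q).obj Z)) := by
    have h₁ : IsIso ((res₂ D (adj.counit ▷ q)).app Z ≫ (resComp D (𝟙 B) q).hom.app Z) :=
      inferInstance
    rw [h] at h₁
    exact IsIso.of_isIso_comp_left ((resComp D (r ≫ k) q).hom.app Z) _
  have : IsIso ((resAdj D adj).counit.app ((res D q).obj Z)) := by
    rw [resAdj_counit]
    infer_instance
  rw [← Function.Bijective.of_comp_iff' ((resAdj D adj).homEquiv _ Y).symm.bijective]
  refine (iff_of_eq (congrArg _ (funext fun g => ?_))).1
    (((bijective_precomp_iff ((resAdj D adj).counit.app ((res D q).obj Z))).2 this) Y)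
  exact ((resAdj D adj).counit_naturality g).symm.trans (Adjunction.homEquiv_counit _ _ _ _).symm

end universal

/-! ### Cones, cocones and their change of shape and base. -/

section cones
variable (D : Prederivator.{w, v, u}) {A B C J K K' : Cat.{w, w}}

/-- The map `p^* M ⟶ q^* g^* M` induced by a transformation `p ⟶ q ≫ g`. -/
def coconeMap {p : K ⟶ B} {q : K ⟶ J} {g : J ⟶ B} (γ : p ⟶ q ≫ g) (M : val D B) :
    (res D p).obj M ⟶ (res D q).obj ((res D g).obj M) :=
  (res₂ D γ).app M ≫ (resComp D q g).hom.app M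

/-- The map `q^* g^* M ⟶ p^* M` induced by a transformation `q ≫ g ⟶ p`. -/
def coneMap {p : K ⟶ B} {q : K ⟶ J} {g : J ⟶ B} (γ : q ≫ g ⟶ p) (M : val D B) :
    (res D q).obj ((res D g).obj M) ⟶ (res D p).obj M :=
  (resComp D q g).inv.app M ≫ (res₂ D γ).app M

/-- Reindexing the shape of a cocone changes its map only by restriction and by comparison
isomorphisms. This and the following compatibilities let universality be transported along finality
and along pullback of the diagram. -/
theorem coconeMap_whiskerLeft (k : K' ⟶ K) {p : K ⟶ B} {q : K ⟶ J} {g : J ⟶ B}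
    (γ : p ⟶ q ≫ g) (M : val D B) :
    coconeMap D (k ◁ γ ≫ (α_ k q g).inv) M =
      (resComp D k p).hom.app M ≫ (res D k).map (coconeMap D γ M) ≫
        (resComp D k q).inv.app ((res D g).obj M) := by
  have h₁ := res₂_whiskerLeft D k γ M
  have h₂ := res₂_associator_inv D k q g M
  rw [coconeMap, coconeMap, res₂_comp, NatTrans.comp_app, ← cancel_mono
    ((resComp D k q).hom.app ((res D g).obj M)), Category.assoc, Category.assoc, h₂,
    Functor.map_comp, ← Category.assoc, h₁]
  simp

theorem coneMap_whiskerLeft (k : K' ⟶ K) {p : K ⟶ B} {q : K ⟶ J} {g : J ⟶ B}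
    (γ : q ≫ g ⟶ p) (M : val D B) :
    coneMap D ((α_ k q g).hom ≫ k ◁ γ) M =
      (resComp D k q).hom.app ((res D g).obj M) ≫ (res D k).map (coneMap D γ M) ≫
        (resComp D k p).inv.app M := by
  have h₁ := res₂_whiskerLeft D k γ M
  have h₂ := res₂_associator_inv D k q g M
  have h₃ : (res₂ D (α_ k q g).inv).app M ≫ (res₂ D (α_ k q g).hom).app M = 𝟙 _ := by
    rw [← NatTrans.comp_app, ← res₂_comp, Iso.inv_hom_id, res₂_id]; rfl
  rw [coneMap, coneMap, res₂_comp, NatTrans.comp_app, ← cancel_mono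
    ((resComp D k p).hom.app M), Category.assoc ((resComp D (k ≫ q) g).inv.app M),
    Category.assoc ((res₂ D (α_ k q g).hom).app M), h₁,
    ← cancel_epi ((resComp D (k ≫ q) g).hom.app M),
    ← cancel_epi ((res₂ D (α_ k q g).inv).app M)]
  simp only [Functor.map_comp, Iso.hom_inv_id_app_assoc, Category.assoc, Iso.inv_hom_id_app,
    reassoc_of% h₂, reassoc_of% h₃]
  rw [← Functor.map_comp_assoc]
  simp

theorem coconeMap_whiskerRight {p : K ⟶ B} {q : K ⟶ J} {g : J ⟶ B}
    (γ : p ⟶ q ≫ g) (f : B ⟶ C) (M : val D C) :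
    coconeMap D (γ ▷ f ≫ (α_ q g f).hom) M =
      (resComp D p f).hom.app M ≫ coconeMap D γ ((res D f).obj M) ≫
        (res D q).map ((resComp D g f).inv.app M) := by
  have h₁ := res₂_whiskerRight D γ f M
  have h₂ := res₂_associator_inv D q g f M
  have h₃ : (res₂ D (α_ q g f).hom).app M ≫ (res₂ D (α_ q g f).inv).app M = 𝟙 _ := by
    rw [← NatTrans.comp_app, ← res₂_comp, Iso.hom_inv_id, res₂_id]; rfl
  rw [coconeMap, coconeMap, res₂_comp, NatTrans.comp_app, ← cancel_mono
    ((res D q).map ((resComp D g f).hom.app M)), Category.assoc, Category.assoc, ← h₂,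
    reassoc_of% h₃, reassoc_of% h₁]
  simp only [Category.assoc, ← Functor.map_comp, Iso.inv_hom_id_app]
  simp

theorem coneMap_whiskerRight {p : K ⟶ B} {q : K ⟶ J} {g : J ⟶ B}
    (γ : q ≫ g ⟶ p) (f : B ⟶ C) (M : val D C) :
    coneMap D ((α_ q g f).inv ≫ γ ▷ f) M =
      (res D q).map ((resComp D g f).hom.app M) ≫ coneMap D γ ((res D f).obj M) ≫
        (resComp D p f).inv.app M := by
  have h₁ := res₂_whiskerRight D γ f M
  have h₂ := res₂_associator_inv D q g f M
  rw [coneMap, coneMap, res₂_comp, NatTrans.comp_app, ← cancel_mono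
    ((resComp D p f).hom.app M), Category.assoc, Category.assoc, h₁,
    ← cancel_epi ((resComp D q (g ≫ f)).hom.app M)]
  simp only [Iso.hom_inv_id_app_assoc, Category.assoc, Iso.inv_hom_id_app,
    ← reassoc_of% h₂]
  simp

theorem coconeMap_comp {p p' : K ⟶ B} {q : K ⟶ J} {g : J ⟶ B} (e : p' ⟶ p)
    (γ : p ⟶ q ≫ g) (M : val D B) :
    coconeMap D (e ≫ γ) M = (res₂ D e).app M ≫ coconeMap D γ M := by
  simp [coconeMap, res₂_comp]

theorem coneMap_comp {p p' : K ⟶ B} {q : K ⟶ J} {g : J ⟶ B} (γ : q ≫ g ⟶ p)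
    (e : p ⟶ p') (M : val D B) :
    coneMap D (γ ≫ e) M = coneMap D γ M ≫ (res₂ D e).app M := by
  simp [coneMap, res₂_comp]

theorem coconeMap_comp_whiskerLeft {p : K ⟶ B} {q : K ⟶ J} {g g' : J ⟶ B}
    (γ : p ⟶ q ≫ g) (i : g ⟶ g') (M : val D B) :
    coconeMap D (γ ≫ q ◁ i) M = coconeMap D γ M ≫ (res D q).map ((res₂ D i).app M) := by
  simp [coconeMap, res₂_comp, res₂_whiskerLeft]

theorem coneMap_whiskerLeft_comp {p : K ⟶ B} {q : K ⟶ J} {g g' : J ⟶ B}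
    (i : g' ⟶ g) (γ : q ≫ g ⟶ p) (M : val D B) :
    coneMap D (q ◁ i ≫ γ) M = (res D q).map ((res₂ D i).app M) ≫ coneMap D γ M := by
  have := res₂_whiskerLeft D q i M
  rw [coneMap, coneMap, res₂_comp, NatTrans.comp_app, ← cancel_epi
    ((resComp D q g').hom.app M), ← reassoc_of% this]
  simp

theorem coconeMap_naturality {p : K ⟶ B} {q : K ⟶ J} {g : J ⟶ B} (γ : p ⟶ q ≫ g)
    {M M' : val D B} (m : M ⟶ M') :
    (res D p).map m ≫ coconeMap D γ M' =
      coconeMap D γ M ≫ (res D q).map ((res D g).map m) := by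
  have := (resComp D q g).hom.naturality m
  dsimp only [Functor.comp_map] at this
  simp [coconeMap, this]

theorem coneMap_naturality {p : K ⟶ B} {q : K ⟶ J} {g : J ⟶ B} (γ : q ≫ g ⟶ p)
    {M M' : val D B} (m : M ⟶ M') :
    (res D q).map ((res D g).map m) ≫ coneMap D γ M' =
      coneMap D γ M ≫ (res D p).map m := by
  have := (resComp D q g).inv.naturality m
  dsimp only [Functor.comp_map] at this
  simp [coneMap, reassoc_of% this]

theorem resSquare_app {K B A C : Cat.{w, w}} {p : K ⟶ A} {q : K ⟶ B} {f : A ⟶ C} {g : B ⟶ C}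
    (α : p ≫ f ⟶ q ≫ g) (M : val D C) :
    (resSquare D α).app M = (resComp D p f).inv.app M ≫ coconeMap D α M := rfl

theorem resSquare_app' {K B A C : Cat.{w, w}} {p : K ⟶ A} {q : K ⟶ B} {f : A ⟶ C} {g : B ⟶ C}
    (α : p ≫ f ⟶ q ≫ g) (M : val D C) :
    (resSquare D α).app M = coneMap D α M ≫ (resComp D q g).hom.app M :=
  (Category.assoc _ _ _).symm

/-- The cocone `p^* M ⟶ q^* g^* M` is a left Kan extension. -/
def IsColim {p : K ⟶ B} {q : K ⟶ J} {g : J ⟶ B} (γ : p ⟶ q ≫ g) (M : val D B) : Prop :=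
  IsUniv D q (coconeMap D γ M)

/-- The cone `q^* g^* M ⟶ p^* M` is a right Kan extension. -/
def IsLim {p : K ⟶ B} {q : K ⟶ J} {g : J ⟶ B} (γ : q ≫ g ⟶ p) (M : val D B) : Prop :=
  IsCouniv D q (coneMap D γ M)

variable {D} {p : K ⟶ B} {q : K ⟶ J} {g : J ⟶ B}

/-- Invariance under a change of shape. The hypothesis holds either because k is final or because
p^* M is a left extension along k; both cases are used. -/
theorem isColim_whiskerLeft_iff (k : K' ⟶ K) (γ : p ⟶ q ≫ g) (M : val D B)
    (H : ∀ Z : val D J, Function.Bijective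
      fun h : (res D p).obj M ⟶ (res D q).obj Z => (res D k).map h) :
    IsColim D (k ◁ γ ≫ (α_ k q g).inv) M ↔ IsColim D γ M := by
  rw [IsColim, coconeMap_whiskerLeft, isUniv_precomp_iff, isUniv_restrict_iff _ _ _ H, IsColim]

theorem isLim_whiskerLeft_iff (k : K' ⟶ K) (γ : q ≫ g ⟶ p) (M : val D B)
    (H : ∀ Z : val D J, Function.Bijective
      fun h : (res D q).obj Z ⟶ (res D p).obj M => (res D k).map h) :
    IsLim D ((α_ k q g).hom ≫ k ◁ γ) M ↔ IsLim D γ M := by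
  rw [IsLim, coneMap_whiskerLeft, ← Category.assoc, isCouniv_postcomp_iff,
    isCouniv_restrict_iff _ _ _ H, IsLim]

/-- Cocones on f^* M are cocones on M along the composite diagram; this moves colimits between a
face or subposet and the ambient poset. -/
theorem isColim_whiskerRight_iff (γ : p ⟶ q ≫ g) (f : B ⟶ C) (M : val D C) :
    IsColim D (γ ▷ f ≫ (α_ q g f).hom) M ↔ IsColim D γ ((res D f).obj M) := by
  rw [IsColim, coconeMap_whiskerRight, isUniv_precomp_iff]
  exact isUniv_postcomp_iff q _ ((resComp D g f).inv.app M)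

theorem isLim_whiskerRight_iff (γ : q ≫ g ⟶ p) (f : B ⟶ C) (M : val D C) :
    IsLim D ((α_ q g f).inv ≫ γ ▷ f) M ↔ IsLim D γ ((res D f).obj M) := by
  rw [IsLim, coneMap_whiskerRight, ← Category.assoc, isCouniv_postcomp_iff]
  exact isCouniv_precomp_iff q ((resComp D g f).hom.app M) _

theorem isColim_comp_iff {p' : K ⟶ B} (e : p' ⟶ p) [IsIso e] (γ : p ⟶ q ≫ g) (M : val D B) :
    IsColim D (e ≫ γ) M ↔ IsColim D γ M := by
  rw [IsColim, coconeMap_comp, isUniv_precomp_iff, IsColim]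

theorem isLim_comp_iff {p' : K ⟶ B} (e : p ⟶ p') [IsIso e] (γ : q ≫ g ⟶ p) (M : val D B) :
    IsLim D (γ ≫ e) M ↔ IsLim D γ M := by
  rw [IsLim, coneMap_comp, isCouniv_postcomp_iff, IsLim]

theorem isColim_comp_whiskerLeft_iff {g' : J ⟶ B} (γ : p ⟶ q ≫ g) (i : g ⟶ g') [IsIso i]
    (M : val D B) : IsColim D (γ ≫ q ◁ i) M ↔ IsColim D γ M := by
  rw [IsColim, coconeMap_comp_whiskerLeft, isUniv_postcomp_iff, IsColim]

theorem isLim_whiskerLeft_comp_iff {g' : J ⟶ B} (i : g' ⟶ g) [IsIso i] (γ : q ≫ g ⟶ p)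
    (M : val D B) : IsLim D (q ◁ i ≫ γ) M ↔ IsLim D γ M := by
  rw [IsLim, coneMap_whiskerLeft_comp, isCouniv_precomp_iff, IsLim]

theorem isColim_congr (γ : p ⟶ q ≫ g) {M M' : val D B} (m : M ≅ M') :
    IsColim D γ M ↔ IsColim D γ M' := by
  rw [IsColim, ← isUniv_postcomp_iff q _ ((res D g).map m.hom), ← coconeMap_naturality,
    isUniv_precomp_iff, IsColim]

theorem isLim_congr (γ : q ≫ g ⟶ p) {M M' : val D B} (m : M ≅ M') :
    IsLim D γ M ↔ IsLim D γ M' := by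
  rw [IsLim, ← isCouniv_postcomp_iff q _ ((res D p).map m.hom), ← coneMap_naturality,
    isCouniv_precomp_iff, IsLim]

/-- `M` is the left Kan extension of its restriction along `f`. -/
def IsLeftExt (D : Prederivator.{w, v, u}) (f : A ⟶ B) (M : val D B) : Prop :=
  ∀ X : val D B, Function.Bijective fun m : M ⟶ X => (res D f).map m

/-- `M` is the right Kan extension of its restriction along `f`. -/
def IsRightExt (D : Prederivator.{w, v, u}) (f : A ⟶ B) (M : val D B) : Prop :=
  ∀ X : val D B, Function.Bijective fun m : X ⟶ M => (res D f).map m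

theorem isLeftExt_iff_isUniv (f : A ⟶ B) (M : val D B) :
    IsLeftExt D f M ↔ IsUniv D f (𝟙 ((res D f).obj M)) := by
  simp [IsLeftExt, IsUniv]

theorem isRightExt_iff_isCouniv (f : A ⟶ B) (M : val D B) :
    IsRightExt D f M ↔ IsCouniv D f (𝟙 ((res D f).obj M)) := by
  simp [IsRightExt, IsCouniv]

/-- The pointwise criterion applied to the identity of f^* M. Being an extension thus becomes a
family of colimit conditions, the form used for all the combinatorics. -/
theorem isLeftExt_iff [IsDerivator D] (f : A ⟶ B) (M : val D B) :
    IsLeftExt D f M ↔ ∀ b : B, IsColim D (overCell f b) M := by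
  rw [isLeftExt_iff_isUniv, isUniv_iff_pointwise]
  refine forall_congr' fun b => ?_
  rw [CategoryTheory.Functor.map_id, Category.id_comp, resSquare_app]
  exact isUniv_precomp_iff _ _ _

theorem isRightExt_iff [IsDerivator D] (f : A ⟶ B) (M : val D B) :
    IsRightExt D f M ↔ ∀ b : B, IsLim D (underCell f b) M := by
  rw [isRightExt_iff_isCouniv, isCouniv_iff_pointwise]
  refine forall_congr' fun b => ?_
  rw [CategoryTheory.Functor.map_id]
  refine (iff_of_eq (congrArg _ (Category.comp_id _))).trans ?_
  rw [resSquare_app']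
  exact isCouniv_postcomp_iff _ _ _

theorem isLeftExt_of_isUniv (f : A ⟶ B) {Y : val D A} {M : val D B}
    (φ : Y ⟶ (res D f).obj M) [IsIso φ] : IsUniv D f φ ↔ IsLeftExt D f M := by
  rw [isLeftExt_iff_isUniv, ← isUniv_precomp_iff f φ, Category.comp_id]

theorem isRightExt_of_isCouniv (f : A ⟶ B) {Y : val D A} {M : val D B}
    (φ : (res D f).obj M ⟶ Y) [IsIso φ] : IsCouniv D f φ ↔ IsRightExt D f M := by
  rw [isRightExt_iff_isCouniv, ← isCouniv_postcomp_iff f _ φ, Category.id_comp]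

theorem IsLeftExt.congr (f : A ⟶ B) {M M' : val D B} (m : M ≅ M') (h : IsLeftExt D f M) :
    IsLeftExt D f M' := by
  intro X
  rw [← Function.Bijective.of_comp_iff' (((bijective_precomp_iff ((res D f).map m.hom)).2
    inferInstance) _), ← Function.Bijective.of_comp_iff _ (((bijective_precomp_iff m.inv).2
    inferInstance) _)]
  simpa [Function.comp_def, ← Functor.map_comp] using h X

theorem IsRightExt.congr (f : A ⟶ B) {M M' : val D B} (m : M ≅ M') (h : IsRightExt D f M) :
    IsRightExt D f M' := by
  intro X
  rw [← Function.Bijective.of_comp_iff' (((bijective_postcomp_iff ((res D f).map m.inv)).2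
    inferInstance) _), ← Function.Bijective.of_comp_iff _ (((bijective_postcomp_iff m.hom).2
    inferInstance) _)]
  simpa [Function.comp_def, ← Functor.map_comp] using h X

end cones

/-! ### Kan extension along fully faithful functors. -/

theorem isIso_of_isIso_app {A B : Cat.{v, u}} {f g : A ⟶ B} (α : f ⟶ g)
    [∀ x, IsIso (α.toNatTrans.app x)] : IsIso α := by
  have := NatIso.isIso_of_isIso_app α.toNatTrans
  exact ⟨Cat.Hom₂.ofNatTrans (inv α.toNatTrans), Cat.Hom₂.ext (IsIso.hom_inv_id α.toNatTrans),
    Cat.Hom₂.ext (IsIso.inv_hom_id α.toNatTrans)⟩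

section
variable {D : Prederivator.{w, v, u}} {A B C K : Cat.{w, w}}

/-- A terminal object gives a right adjoint of the functor to the terminal category. -/
def toPtAdj {k : K} (hk : Limits.IsTerminal k) : Bicategory.Adjunction (toPt K) (ptHom k) :=
  Adjunction.toCat (F := Functor.star K) (G := Functor.fromPUnit k)
    { unit := { app := fun x => hk.from x, naturality := fun _ _ _ => hk.hom_ext _ _ }
      counit :=
        { app := fun _ => eqToHom (Subsingleton.elim (α := pt.{w}) _ _)
          naturality := fun _ _ _ => rfl }
      left_triangle_components := fun x =>
        Subsingleton.elim (α := ((Functor.star K).obj x : pt.{w}) ⟶ (Functor.star K).obj x) _ _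
      right_triangle_components := fun _ => hk.hom_ext _ _ }

/-- An initial object gives a left adjoint of the functor to the terminal category. -/
def ptToAdj {k : K} (hk : Limits.IsInitial k) : Bicategory.Adjunction (ptHom k) (toPt K) :=
  Adjunction.toCat (F := Functor.fromPUnit k) (G := Functor.star K)
    { counit := { app := fun x => hk.to x, naturality := fun _ _ _ => hk.hom_ext _ _ }
      unit :=
        { app := fun _ => eqToHom (Subsingleton.elim (α := pt.{w}) _ _)
          naturality := fun _ _ _ => rfl }
      left_triangle_components := fun _ => hk.hom_ext _ _
      right_triangle_components := fun _ => rfl }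

/-- An endofunctor of the point is the identity, whose restriction functor is isomorphic to the
identity, so the Yoneda lemma applies. It finishes every reduction to a terminal object. -/
theorem isUniv_pt_iff (q : pt.{w} ⟶ pt.{w}) {Y W : val D pt.{w}} (φ : Y ⟶ (res D q).obj W) :
    IsUniv D q φ ↔ IsIso φ := by
  obtain rfl : q = 𝟙 pt.{w} := (eq_toPt _).trans (eq_toPt _).symm
  let e := resId D pt.{w}
  rw [← bijective_precomp_iff]
  have key : ∀ Z : val D pt.{w}, (Function.Bijective fun g : W ⟶ Z => φ ≫ (res D (𝟙 pt.{w})).map g) ↔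
      Function.Bijective fun g : (res D (𝟙 pt.{w})).obj W ⟶ Z => φ ≫ g := by
    intro Z
    rw [← Function.Bijective.of_comp_iff _
      (((bijective_precomp_iff (e.hom.app W)).2 inferInstance) _),
      ← Function.Bijective.of_comp_iff'
      (((bijective_postcomp_iff (e.hom.app Z)).2 inferInstance) _)]
    refine iff_of_eq (congrArg _ (funext fun g => ?_))
    have := e.hom.naturality g
    exact (Category.assoc _ _ _).trans (congrArg (φ ≫ ·) this)
  exact forall_congr' key

theorem isCouniv_pt_iff (q : pt.{w} ⟶ pt.{w}) {Y W : val D pt.{w}} (φ : (res D q).obj W ⟶ Y) :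
    IsCouniv D q φ ↔ IsIso φ := by
  obtain rfl : q = 𝟙 pt.{w} := (eq_toPt _).trans (eq_toPt _).symm
  let e := resId D pt.{w}
  rw [← bijective_postcomp_iff]
  have key : ∀ Z : val D pt.{w}, (Function.Bijective fun g : Z ⟶ W => (res D (𝟙 pt.{w})).map g ≫ φ) ↔
      Function.Bijective fun g : Z ⟶ (res D (𝟙 pt.{w})).obj W => g ≫ φ := by
    intro Z
    rw [← Function.Bijective.of_comp_iff _
      (((bijective_postcomp_iff (e.inv.app W)).2 inferInstance) _),
      ← Function.Bijective.of_comp_iff'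
      (((bijective_precomp_iff (e.inv.app Z)).2 inferInstance) _)]
    refine iff_of_eq (congrArg _ (funext fun g => ?_))
    have := e.inv.naturality g
    exact (Category.assoc _ _ _).symm.trans (congrArg (· ≫ φ) this.symm)
  exact forall_congr' key

variable [IsDerivator D]

/-- Full faithfulness makes (a, id) terminal in the comma category over f a, so the colimit there is
evaluation at a. By (Der2) this suffices. -/
theorem isIso_of_isUniv (f : A ⟶ B) [f.toFunctor.Full] [f.toFunctor.Faithful] {Y : val D A}
    {X : val D B} (y : Y ⟶ (res D f).obj X) (hy : IsUniv D f y) : IsIso y := by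
  refine IsDerivator.der2 y fun a => ?_
  set b := f.toFunctor.obj a
  have h := (isUniv_iff_pointwise f y).1 hy b
  have hk : Limits.IsTerminal (C := CostructuredArrow f.toFunctor b)
    (CostructuredArrow.mk (𝟙 (f.toFunctor.obj a))) := CostructuredArrow.mkIdTerminal
  let t : pt.{w} ⟶ overCat f b := ptHom (A := overCat f b) (CostructuredArrow.mk (𝟙 (f.toFunctor.obj a)))
  rw [← isUniv_restrict_iff t _ _ fun Z => bijective_restrict_of_rightAdjoint (toPtAdj hk) _ _ Z,
    isUniv_pt_iff, isIso_comp_right_iff, CategoryTheory.Functor.map_comp, resSquare_app] at h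
  -- The canonical cell is an identity at (a, id), so its contribution is invertible and can be
  -- cancelled, leaving the component of y at a.
  have h₁ : IsIso ((res D t).map (coconeMap D (overCell f b) X)) := by
    have h₂ := coconeMap_whiskerLeft D t (overCell f b) X
    have : IsIso (t ◁ overCell f b) := by
      have : ∀ x, IsIso ((t ◁ overCell f b).toNatTrans.app x) := fun x =>
        inferInstanceAs (IsIso (𝟙 (f.toFunctor.obj a)))
      exact isIso_of_isIso_app _
    have h₃ : IsIso (coconeMap D (t ◁ overCell f b ≫ (α_ t _ _).inv) X) := by
      unfold coconeMap; infer_instance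
    rw [h₂, isIso_comp_left_iff, isIso_comp_right_iff] at h₃
    exact h₃
  rw [CategoryTheory.Functor.map_comp, isIso_comp_right_iff] at h
  have h₄ := (resComp D t (overProj f b)).hom.naturality y
  have h₅ : IsIso ((res D (t ≫ overProj f b)).map y) := by
    have : IsIso ((res D (t ≫ overProj f b)).map y ≫ (resComp D t (overProj f b)).hom.app _) := by
      rw [h₄, isIso_comp_left_iff]; exact h
    exact IsIso.of_isIso_comp_right _ ((resComp D t (overProj f b)).hom.app _)
  let i : ptHom a ≅ t ≫ overProj f b := Cat.Hom.isoMk (Discrete.natIso fun _ => Iso.refl _)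
  have h₆ := (res₂ D i.hom).naturality y
  have : IsIso ((res D (ptHom a)).map y ≫ (res₂ D i.hom).app _) := by
    rw [h₆]; infer_instance
  exact IsIso.of_isIso_comp_right _ ((res₂ D i.hom).app _)

theorem isIso_of_isCouniv (f : A ⟶ B) [f.toFunctor.Full] [f.toFunctor.Faithful] {Y : val D A}
    {X : val D B} (y : (res D f).obj X ⟶ Y) (hy : IsCouniv D f y) : IsIso y := by
  refine IsDerivator.der2 y fun a => ?_
  set b := f.toFunctor.obj a
  have h := (isCouniv_iff_pointwise f y).1 hy b
  have hk : Limits.IsInitial (C := StructuredArrow b f.toFunctor)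
    (StructuredArrow.mk (𝟙 (f.toFunctor.obj a))) := StructuredArrow.mkIdInitial
  let t : pt.{w} ⟶ underCat f b := ptHom (A := underCat f b) (StructuredArrow.mk (𝟙 (f.toFunctor.obj a)))
  rw [← isCouniv_restrict_iff t _ _ fun Z => bijective_restrict_of_leftAdjoint (ptToAdj hk) _ _ Z,
    isCouniv_pt_iff, isIso_comp_left_iff, CategoryTheory.Functor.map_comp, resSquare_app'] at h
  have h₁ : IsIso ((res D t).map (coneMap D (underCell f b) X)) := by
    have h₂ := coneMap_whiskerLeft D t (underCell f b) X
    have : IsIso (t ◁ underCell f b) := by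
      have : ∀ x, IsIso ((t ◁ underCell f b).toNatTrans.app x) := fun x =>
        inferInstanceAs (IsIso (𝟙 (f.toFunctor.obj a)))
      exact isIso_of_isIso_app _
    have h₃ : IsIso (coneMap D ((α_ t _ _).hom ≫ t ◁ underCell f b) X) := by
      unfold coneMap; infer_instance
    rw [h₂, isIso_comp_left_iff, isIso_comp_right_iff] at h₃
    exact h₃
  rw [CategoryTheory.Functor.map_comp, Category.assoc, isIso_comp_left_iff,
    isIso_comp_left_iff] at h
  have h₄ := (resComp D t (underProj f b)).hom.naturality y
  have h₅ : IsIso ((res D (t ≫ underProj f b)).map y) := by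
    have : IsIso ((res D (t ≫ underProj f b)).map y ≫ (resComp D t (underProj f b)).hom.app _) := by
      rw [h₄, isIso_comp_left_iff]; exact h
    exact IsIso.of_isIso_comp_right _ ((resComp D t (underProj f b)).hom.app _)
  let i : ptHom a ≅ t ≫ underProj f b := Cat.Hom.isoMk (Discrete.natIso fun _ => Iso.refl _)
  have h₆ := (res₂ D i.hom).naturality y
  have : IsIso ((res D (ptHom a)).map y ≫ (res₂ D i.hom).app _) := by
    rw [h₆]; infer_instance
  exact IsIso.of_isIso_comp_right _ ((res₂ D i.hom).app _)

theorem isLeftExt_lan (f : A ⟶ B) [f.toFunctor.Full] [f.toFunctor.Faithful] (Y : val D A) :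
    IsLeftExt D f ((lan D f).obj Y) := by
  have := isIso_of_isUniv f _ (isUniv_unit f Y)
  exact (isLeftExt_of_isUniv f _).1 (isUniv_unit f Y)

theorem isRightExt_ran (f : A ⟶ B) [f.toFunctor.Full] [f.toFunctor.Faithful] (Y : val D A) :
    IsRightExt D f ((ran D f).obj Y) := by
  have := isIso_of_isCouniv f _ (isCouniv_counit f Y)
  exact (isRightExt_of_isCouniv f _).1 (isCouniv_counit f Y)

theorem exists_isLeftExt (f : A ⟶ B) [f.toFunctor.Full] [f.toFunctor.Faithful] (Y : val D A) :
    ∃ X, IsLeftExt D f X ∧ Nonempty ((res D f).obj X ≅ Y) := by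
  have := isIso_of_isUniv f _ (isUniv_unit f Y)
  exact ⟨_, isLeftExt_lan f Y, ⟨(asIso ((lanAdj D f).unit.app Y)).symm⟩⟩

theorem exists_isRightExt (f : A ⟶ B) [f.toFunctor.Full] [f.toFunctor.Faithful] (Y : val D A) :
    ∃ X, IsRightExt D f X ∧ Nonempty ((res D f).obj X ≅ Y) := by
  have := isIso_of_isCouniv f _ (isCouniv_counit f Y)
  exact ⟨_, isRightExt_ran f Y, ⟨asIso ((ranAdj D f).counit.app Y)⟩⟩

/-- Replaces membership in an essential image, as in the definitions of the classes of cubes, by a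
bijectivity condition that can be checked pointwise. -/
theorem essImage_lan_iff (f : A ⟶ B) [f.toFunctor.Full] [f.toFunctor.Faithful] (X : val D B) :
    (lan D f).essImage X ↔ IsLeftExt D f X := by
  constructor
  · rintro ⟨Y, ⟨e⟩⟩
    exact (isLeftExt_lan f Y).congr f e
  · intro h
    have := (isUniv_iff_isIso f _).1 ((isLeftExt_iff_isUniv f X).1 h)
    exact ⟨_, ⟨asIso (((lanAdj D f).homEquiv _ X).symm (𝟙 _))⟩⟩

theorem essImage_ran_iff (f : A ⟶ B) [f.toFunctor.Full] [f.toFunctor.Faithful] (X : val D B) :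
    (ran D f).essImage X ↔ IsRightExt D f X := by
  constructor
  · rintro ⟨Y, ⟨e⟩⟩
    exact (isRightExt_ran f Y).congr f e
  · intro h
    have := (isCouniv_iff_isIso f _).1 ((isRightExt_iff_isCouniv f X).1 h)
    exact ⟨_, ⟨(asIso ((ranAdj D f).homEquiv X _ (𝟙 _))).symm⟩⟩

end

/-! ### Kan extensions with a parameter category. -/

section
variable {D : Prederivator.{w, v, u}} {A B C : Cat.{w, w}}

/-- The product of a functor with an identity functor. -/
def prodMap (f : A ⟶ B) (C : Cat.{w, w}) : Cat.of (A × C) ⟶ Cat.of (B × C) :=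
  (f.toFunctor.prod (𝟭 C)).toCatHom

instance (f : A ⟶ B) [f.toFunctor.Full] : (prodMap f C).toFunctor.Full where
  map_surjective := fun g =>
    ⟨(f.toFunctor.preimage g.1, g.2), Prod.ext (f.toFunctor.map_preimage _) rfl⟩

instance (f : A ⟶ B) [f.toFunctor.Faithful] : (prodMap f C).toFunctor.Faithful where
  map_injective := fun h =>
    Prod.ext (f.toFunctor.map_injective (congrArg Prod.fst h)) (Prod.ext_iff.1 h).2

/-- The inclusion of a comma category of `f` into one of `f × C`. -/
def overIncl (f : A ⟶ B) (b : B) (c : C) :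
    CostructuredArrow f.toFunctor b ⥤ CostructuredArrow (f.toFunctor.prod (𝟭 C)) (b, c) where
  obj x := CostructuredArrow.mk (S := f.toFunctor.prod (𝟭 C)) (Y := (x.left, c)) (x.hom, 𝟙 c)
  map φ := CostructuredArrow.homMk (φ.left, 𝟙 c)
    (Prod.ext (CostructuredArrow.w φ) (Category.comp_id _))
  map_comp _ _ := by ext <;> simp

/-- The left adjoint of `overIncl`. -/
def overRetr (f : A ⟶ B) (b : B) (c : C) :
    CostructuredArrow (f.toFunctor.prod (𝟭 C)) (b, c) ⥤ CostructuredArrow f.toFunctor b where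
  obj x := CostructuredArrow.mk (S := f.toFunctor) (Y := x.left.1) x.hom.1
  map φ := CostructuredArrow.homMk φ.left.1 (congrArg Prod.fst (CostructuredArrow.w φ))

/-- The adjunction between `overRetr` and `overIncl`. -/
def overInclAdj (f : A ⟶ B) (b : B) (c : C) :
    CategoryTheory.Adjunction (overRetr f b c) (overIncl f b c) where
  unit :=
    { app := fun x => CostructuredArrow.homMk (𝟙 x.left.1, x.hom.2)
        (Prod.ext (by simp [overIncl, overRetr]) (by simp [overIncl]))
      naturality := fun x y φ => by
        have h := congrArg Prod.snd (CostructuredArrow.w φ)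
        refine CostructuredArrow.hom_ext _ _ (Prod.ext ?_ ?_)
        · simp [overIncl, overRetr]
        · simpa [overIncl, overRetr] using h }
  counit :=
    { app := fun x => CostructuredArrow.homMk (𝟙 x.left) (by simp [overIncl, overRetr])
      naturality := fun x y φ => CostructuredArrow.hom_ext _ _
        ((Category.comp_id φ.left).trans (Category.id_comp φ.left).symm) }
  left_triangle_components x := CostructuredArrow.hom_ext _ _ (Category.comp_id (𝟙 x.left.1))
  right_triangle_components x := CostructuredArrow.hom_ext _ _
    (Prod.ext (Category.comp_id (𝟙 x.left)) (Category.comp_id (𝟙 c)))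

/-- The inclusion of a comma category of `f` into one of `f × C`. -/
def underIncl (f : A ⟶ B) (b : B) (c : C) :
    StructuredArrow b f.toFunctor ⥤ StructuredArrow (b, c) (f.toFunctor.prod (𝟭 C)) where
  obj x := StructuredArrow.mk (T := f.toFunctor.prod (𝟭 C)) (Y := (x.right, c)) (x.hom, 𝟙 c)
  map φ := StructuredArrow.homMk (φ.right, 𝟙 c)
    (Prod.ext (StructuredArrow.w φ) (Category.comp_id _))
  map_comp _ _ := by ext <;> simp

/-- The right adjoint of `underIncl`. -/
def underRetr (f : A ⟶ B) (b : B) (c : C) :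
    StructuredArrow (b, c) (f.toFunctor.prod (𝟭 C)) ⥤ StructuredArrow b f.toFunctor where
  obj x := StructuredArrow.mk (T := f.toFunctor) (Y := x.right.1) x.hom.1
  map φ := StructuredArrow.homMk φ.right.1 (congrArg Prod.fst (StructuredArrow.w φ))

/-- The adjunction between `underIncl` and `underRetr`. -/
def underInclAdj (f : A ⟶ B) (b : B) (c : C) :
    CategoryTheory.Adjunction (underIncl f b c) (underRetr f b c) where
  counit :=
    { app := fun x => StructuredArrow.homMk (𝟙 x.right.1, x.hom.2)
        (Prod.ext (by simp [underIncl, underRetr]) (by simp [underIncl]))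
      naturality := fun x y φ => by
        have h := congrArg Prod.snd (StructuredArrow.w φ)
        refine StructuredArrow.hom_ext _ _ (Prod.ext ?_ ?_)
        · simp [underIncl, underRetr]
        · simpa [underIncl, underRetr] using h.symm }
  unit :=
    { app := fun x => StructuredArrow.homMk (𝟙 x.right) (by simp [underIncl, underRetr])
      naturality := fun x y φ => StructuredArrow.hom_ext _ _
        ((Category.comp_id φ.right).trans (Category.id_comp φ.right).symm) }
  right_triangle_components x := StructuredArrow.hom_ext _ _ (Category.comp_id (𝟙 x.right.1))
  left_triangle_components x := StructuredArrow.hom_ext _ _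
    (Prod.ext (Category.comp_id (𝟙 x.right)) (Category.comp_id (𝟙 c)))

/-- The image of `(b, -)` in a slice of a product. -/
def ptHomProd (b : B) (c : C) :
    ptHom b ≫ atObj B c ≅ ptHom (A := Cat.of (B × C)) (b, c) :=
  Cat.Hom.isoMk (Discrete.natIso fun _ => Iso.refl _)

/-- The slice (f/b) embeds in the slice of f × C over (b, c) at the identity of c. This embedding is
right adjoint to the projection, hence final. -/
theorem isColim_prodMap_iff (f : A ⟶ B) (b : B) (c : C) (M : val D (Cat.of (B × C))) :
    IsColim D (overCell (prodMap f C) ((b, c) : B × C)) M ↔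
      IsColim D (overCell f b) ((res D (atObj B c)).obj M) := by
  rw [← isColim_whiskerRight_iff, ← isColim_comp_whiskerLeft_iff _ (ptHomProd b c).hom]
  let k : overCat f b ⟶ overCat (prodMap f C) ((b, c) : B × C) := (overIncl f b c).toCatHom
  rw [← isColim_whiskerLeft_iff k (overCell (prodMap f C) ((b, c) : B × C)) M fun Z =>
    bijective_restrict_of_rightAdjoint (overInclAdj f b c).toCat _ _ Z]
  let e : (overProj f b ≫ f) ≫ atObj B c ≅ k ≫ overProj (prodMap f C) ((b, c) : B × C) ≫
    prodMap f C := Iso.refl _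
  rw [← isColim_comp_iff e.hom]
  refine iff_of_eq ?_
  refine congrArg (fun t => IsColim D t M) (Cat.Hom₂.ext (NatTrans.ext (funext fun x => ?_)))
  refine Prod.ext ?_ ?_
  · change 𝟙 _ ≫ CostructuredArrow.hom x ≫ 𝟙 _ = (CostructuredArrow.hom x ≫ 𝟙 _) ≫ 𝟙 _
    simp
  · change 𝟙 c ≫ 𝟙 c ≫ 𝟙 c = (𝟙 c ≫ 𝟙 c) ≫ 𝟙 c
    simp

theorem isLim_prodMap_iff (f : A ⟶ B) (b : B) (c : C) (M : val D (Cat.of (B × C))) :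
    IsLim D (underCell (prodMap f C) ((b, c) : B × C)) M ↔
      IsLim D (underCell f b) ((res D (atObj B c)).obj M) := by
  rw [← isLim_whiskerRight_iff, ← isLim_whiskerLeft_comp_iff (ptHomProd b c).inv]
  let k : underCat f b ⟶ underCat (prodMap f C) ((b, c) : B × C) := (underIncl f b c).toCatHom
  rw [← isLim_whiskerLeft_iff k (underCell (prodMap f C) ((b, c) : B × C)) M fun Z =>
    bijective_restrict_of_leftAdjoint (underInclAdj f b c).toCat _ _ Z]
  let e : k ≫ underProj (prodMap f C) ((b, c) : B × C) ≫ prodMap f C ≅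
    (underProj f b ≫ f) ≫ atObj B c := Iso.refl _
  rw [← isLim_comp_iff e.hom]
  refine iff_of_eq ?_
  refine congrArg (fun t => IsLim D t M) (Cat.Hom₂.ext (NatTrans.ext (funext fun x => ?_)))
  refine Prod.ext ?_ ?_
  · change (𝟙 _ ≫ StructuredArrow.hom x) ≫ 𝟙 _ = 𝟙 _ ≫ 𝟙 _ ≫ StructuredArrow.hom x
    simp
  · change (𝟙 c ≫ 𝟙 c) ≫ 𝟙 c = 𝟙 c ≫ 𝟙 c ≫ 𝟙 c
    simp

variable [IsDerivator D]

/-- Both sides amount to the same colimits, indexed by pairs (b, c). This links extensions in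
shifted derivators to conditions imposed at single objects c. -/
theorem isLeftExt_prodMap_iff (f : A ⟶ B) (M : val D (Cat.of (B × C))) :
    IsLeftExt D (prodMap f C) M ↔ ∀ c : C, IsLeftExt D f ((res D (atObj B c)).obj M) := by
  simp only [isLeftExt_iff]
  exact ⟨fun h c b => (isColim_prodMap_iff f b c M).1 (h (b, c)),
    fun h b => (isColim_prodMap_iff f b.1 b.2 M).2 (h b.2 b.1)⟩

theorem isRightExt_prodMap_iff (f : A ⟶ B) (M : val D (Cat.of (B × C))) :
    IsRightExt D (prodMap f C) M ↔ ∀ c : C, IsRightExt D f ((res D (atObj B c)).obj M) := by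
  simp only [isRightExt_iff]
  exact ⟨fun h c b => (isLim_prodMap_iff f b c M).1 (h (b, c)),
    fun h b => (isLim_prodMap_iff f b.1 b.2 M).2 (h b.2 b.1)⟩

end

/-! ### Colimits and limits over subsets of a poset. -/

section thin
variable {D : Prederivator.{w, v, u}} {K K' : Cat.{w, w}}
variable {B B' : Type w} [PartialOrder B] [PartialOrder B']

theorem hom₂_eq_of_thin {A B : Cat.{v, u}} [Quiver.IsThin B] {f g : A ⟶ B} (α β : f ⟶ g) :
    α = β :=
  Cat.Hom₂.ext (NatTrans.ext (funext fun _ => Subsingleton.elim _ _))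

instance (B : Type w) [PartialOrder B] : Quiver.IsThin (Cat.of B) :=
  fun x y => ⟨fun f g =>
    Subsingleton.elim (α := ULift (PLift (@LE.le B _ x y))) f g⟩

/-- Adjunctions between thin categories. -/
def thinAdj {A B : Type w} [Category.{w} A] [Category.{w} B] [Quiver.IsThin A] [Quiver.IsThin B]
    (l : A ⥤ B) (r : B ⥤ A) (η : ∀ x, x ⟶ r.obj (l.obj x)) (δ : ∀ y, l.obj (r.obj y) ⟶ y) :
    CategoryTheory.Adjunction l r where
  unit := { app := η, naturality := fun _ _ _ => Subsingleton.elim _ _ }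
  counit := { app := δ, naturality := fun _ _ _ => Subsingleton.elim _ _ }
  left_triangle_components _ := Subsingleton.elim _ _
  right_triangle_components _ := Subsingleton.elim _ _

/-- Comparison of cocones in a poset. -/
theorem isColim_iff_of_thin {p : K ⟶ Cat.of B} {g : pt.{w} ⟶ Cat.of B} (γ : p ⟶ toPt K ≫ g)
    {p' : K' ⟶ Cat.of B} {g' : pt.{w} ⟶ Cat.of B} (γ' : p' ⟶ toPt K' ≫ g') (k : K' ⟶ K)
    (e : p' ≅ k ≫ p) (i : g ≅ g') (M : val D (Cat.of B))
    (H : ∀ Z : val D pt.{w}, Function.Bijective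
      fun h : (res D p).obj M ⟶ (res D (toPt K)).obj Z => (res D k).map h) :
    IsColim D γ' M ↔ IsColim D γ M := by
  rw [← isColim_whiskerLeft_iff k γ M H, ← isColim_comp_whiskerLeft_iff _ i.hom,
    ← isColim_comp_iff e.hom]
  generalize_proofs
  -- The two functors to the point are equal only propositionally; once they are identified, any two
  -- parallel cells into a poset coincide.
  generalize hq : toPt K' = q at γ'
  obtain rfl : k ≫ toPt K = q := (eq_toPt _).trans hq
  rw [hom₂_eq_of_thin γ']

theorem isLim_iff_of_thin {p : K ⟶ Cat.of B} {g : pt.{w} ⟶ Cat.of B} (γ : toPt K ≫ g ⟶ p)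
    {p' : K' ⟶ Cat.of B} {g' : pt.{w} ⟶ Cat.of B} (γ' : toPt K' ≫ g' ⟶ p') (k : K' ⟶ K)
    (e : p' ≅ k ≫ p) (i : g ≅ g') (M : val D (Cat.of B))
    (H : ∀ Z : val D pt.{w}, Function.Bijective
      fun h : (res D (toPt K)).obj Z ⟶ (res D p).obj M => (res D k).map h) :
    IsLim D γ' M ↔ IsLim D γ M := by
  rw [← isLim_whiskerLeft_iff k γ M H, ← isLim_whiskerLeft_comp_iff i.inv,
    ← isLim_comp_iff e.inv]
  generalize hq : toPt K' = q at γ'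
  obtain rfl : k ≫ toPt K = q := (eq_toPt _).trans hq
  rw [hom₂_eq_of_thin γ']

/-- The functor between posets given by a monotone map. -/
def monoHom (f : B →o B') : Cat.of B ⟶ Cat.of B' := Cat.Hom.ofFunctor f.monotone.functor

/-- The inclusion of a subset of a poset, as a monotone map. -/
def inclHom (S : Set B) : S →o B := ⟨Subtype.val, fun _ _ h => h⟩

/-- The inclusion of a subset of a poset. -/
def setIncl (S : Set B) : Cat.of S ⟶ Cat.of B := monoHom (inclHom S)

instance (S : Set B) : (setIncl S).toFunctor.Full where
  map_surjective f := ⟨homOfLE (X := S) (leOfHom (X := B) f), rfl⟩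

instance (S : Set B) : (setIncl S).toFunctor.Faithful where
  map_injective {x y} f g _ :=
    Subsingleton.elim (α := ULift (PLift (@LE.le S _ x y))) f g

/-- The cocone of all elements of `S` under an upper bound `b`. -/
def upperCocone (S : Set B) (b : B) (h : b ∈ upperBounds S) :
    setIncl S ⟶ toPt (Cat.of S) ≫ ptHom (A := Cat.of B) b :=
  Cat.Hom₂.ofNatTrans
    { app := fun x => homOfLE (X := B) (h x.2)
      naturality := fun _ _ _ => rfl }

/-- The cone of all elements of `S` over a lower bound `b`. -/
def lowerCone (S : Set B) (b : B) (h : b ∈ lowerBounds S) :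
    toPt (Cat.of S) ≫ ptHom (A := Cat.of B) b ⟶ setIncl S :=
  Cat.Hom₂.ofNatTrans
    { app := fun x => homOfLE (X := B) (h x.2)
      naturality := fun _ _ _ => rfl }

/-- `M_b` is the colimit of the restriction of `M` to `S`. -/
def ColimAt (D : Prederivator.{w, v, u}) (M : val D (Cat.of B)) (S : Set B) (b : B) : Prop :=
  ∃ h : b ∈ upperBounds S, IsColim D (upperCocone S b h) M

/-- `M_b` is the limit of the restriction of `M` to `S`. -/
def LimAt (D : Prederivator.{w, v, u}) (M : val D (Cat.of B)) (S : Set B) (b : B) : Prop :=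
  ∃ h : b ∈ lowerBounds S, IsLim D (lowerCone S b h) M

variable {M : val D (Cat.of B)} {S T : Set B} {b : B}

/-- The inclusion functor of a subset of a poset. -/
abbrev setFunctor (S : Set B) : S ⥤ B := (inclHom S).monotone.functor

/-- Elements of `S` below `b`, as objects of the comma category. -/
def toOver (S : Set B) (b : B) :
    (S ∩ Set.Iic b : Set B) ⥤ CostructuredArrow (setFunctor S) b where
  obj x := CostructuredArrow.mk (S := setFunctor S) (Y := (⟨x.1, x.2.1⟩ : S)) (homOfLE x.2.2)
  map f := CostructuredArrow.homMk (homOfLE (leOfHom f)) rfl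

/-- Objects of the comma category as elements of `S` below `b`. -/
def ofOver (S : Set B) (b : B) :
    CostructuredArrow (setFunctor S) b ⥤ (S ∩ Set.Iic b : Set B) where
  obj x := ⟨x.left.1, x.left.2, leOfHom x.hom⟩
  map f := homOfLE (leOfHom f.left)

instance (S : Set B) (b : B) : Quiver.IsThin (CostructuredArrow (setFunctor S) b) :=
  fun _ _ => ⟨fun f g => CostructuredArrow.hom_ext f g (Subsingleton.elim _ _)⟩

/-- Elements of `S` above `b`, as objects of the comma category. -/
def toUnder (S : Set B) (b : B) :
    (S ∩ Set.Ici b : Set B) ⥤ StructuredArrow b (setFunctor S) where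
  obj x := StructuredArrow.mk (T := setFunctor S) (Y := (⟨x.1, x.2.1⟩ : S)) (homOfLE x.2.2)
  map f := StructuredArrow.homMk (homOfLE (leOfHom f)) rfl

/-- Objects of the comma category as elements of `S` above `b`. -/
def ofUnder (S : Set B) (b : B) :
    StructuredArrow b (setFunctor S) ⥤ (S ∩ Set.Ici b : Set B) where
  obj x := ⟨x.right.1, x.right.2, leOfHom x.hom⟩
  map f := homOfLE (leOfHom f.right)

instance (S : Set B) (b : B) : Quiver.IsThin (StructuredArrow b (setFunctor S)) :=
  fun _ _ => ⟨fun f g => StructuredArrow.hom_ext f g (Subsingleton.elim _ _)⟩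

/-- The comma category of a subset inclusion over b is the poset of elements of the subset below b;
one of the comparison functors is a right adjoint, hence final. -/
theorem colimAt_inter_Iic_iff :
    ColimAt D M (S ∩ Set.Iic b) b ↔ IsColim D (overCell (setIncl S) b) M := by
  have h : b ∈ upperBounds (S ∩ Set.Iic b) := fun x hx => hx.2
  let k : Cat.of (S ∩ Set.Iic b : Set B) ⟶ overCat (setIncl S) b := (toOver S b).toCatHom
  rw [← isColim_iff_of_thin (overCell (setIncl S) b) (upperCocone _ b h)
    k (Iso.refl _) (Iso.refl _) M
    fun Z => bijective_restrict_of_rightAdjoint (thinAdj (ofOver S b) (toOver S b)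
      (fun x => CostructuredArrow.homMk (𝟙 _) rfl) (fun x => 𝟙 _)).toCat _ _ Z]
  exact ⟨fun h => h.2, fun h' => ⟨h, h'⟩⟩

theorem limAt_inter_Ici_iff :
    LimAt D M (S ∩ Set.Ici b) b ↔ IsLim D (underCell (setIncl S) b) M := by
  have h : b ∈ lowerBounds (S ∩ Set.Ici b) := fun x hx => hx.2
  let k : Cat.of (S ∩ Set.Ici b : Set B) ⟶ underCat (setIncl S) b := (toUnder S b).toCatHom
  rw [← isLim_iff_of_thin (underCell (setIncl S) b) (lowerCone _ b h)
    k (Iso.refl _) (Iso.refl _) M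
    fun Z => bijective_restrict_of_leftAdjoint (thinAdj (toUnder S b) (ofUnder S b)
      (fun x => 𝟙 _) (fun x => StructuredArrow.homMk (𝟙 _) rfl)).toCat _ _ Z]
  exact ⟨fun h => h.2, fun h' => ⟨h, h'⟩⟩

theorem isLeftExt_setIncl_iff [IsDerivator D] :
    IsLeftExt D (setIncl S) M ↔ ∀ b, ColimAt D M (S ∩ Set.Iic b) b := by
  rw [isLeftExt_iff]
  exact forall_congr' fun b => colimAt_inter_Iic_iff.symm

theorem isRightExt_setIncl_iff [IsDerivator D] :
    IsRightExt D (setIncl S) M ↔ ∀ b, LimAt D M (S ∩ Set.Ici b) b := by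
  rw [isRightExt_iff]
  exact forall_congr' fun b => limAt_inter_Ici_iff.symm

/-- A map between posets induces a map of subsets. -/
def mapsToHom (f : B →o B') {S : Set B} {S' : Set B'} (h : Set.MapsTo f S S') : S →o S' where
  toFun x := ⟨f x, h x.2⟩
  monotone' _ _ hxy := f.monotone hxy

/-- Colimits of restrictions along final maps. -/
theorem colimAt_restrict_iff (f : B →o B') (M : val D (Cat.of B')) {S : Set B} {S' : Set B'}
    {b : B} (h : Set.MapsTo f S S') (hb : b ∈ upperBounds S) (hb' : f b ∈ upperBounds S')
    (hf : ∀ t ∈ S', ∃ s ∈ S, t ≤ f s ∧ ∀ r ∈ S, t ≤ f r → s ≤ r) :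
    ColimAt D ((res D (monoHom f)).obj M) S b ↔ ColimAt D M S' (f b) := by
  -- The hypothesis provides a least element of S whose image lies above t. These choices form a
  -- left adjoint of the map S → S' induced by f, which is therefore final.
  choose l hlS hl hmin using hf
  let k := mapsToHom f h
  let L : S' →o S :=
    { toFun := fun t => ⟨l t.1 t.2, hlS t.1 t.2⟩
      monotone' := fun s t hst => hmin _ _ _ (hlS _ _) (le_trans hst (hl _ _)) }
  have key := isColim_iff_of_thin (upperCocone S' (f b) hb')
    (upperCocone S b hb ▷ monoHom f ≫ (α_ _ _ _).hom) (monoHom k) (Iso.refl _)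
    (Cat.Hom.isoMk (Discrete.natIso fun _ => Iso.refl _)) M
    fun Z => bijective_restrict_of_rightAdjoint (thinAdj L.monotone.functor k.monotone.functor
      (fun x => homOfLE (hl x.1 x.2))
      (fun x => homOfLE (hmin _ (h x.2) _ x.2 le_rfl))).toCat _ _ Z
  rw [isColim_whiskerRight_iff] at key
  exact ⟨fun h => ⟨hb', key.1 h.2⟩, fun h => ⟨hb, key.2 h.2⟩⟩

/-- Limits of restrictions along initial maps. -/
theorem limAt_restrict_iff (f : B →o B') (M : val D (Cat.of B')) {S : Set B} {S' : Set B'}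
    {b : B} (h : Set.MapsTo f S S') (hb : b ∈ lowerBounds S) (hb' : f b ∈ lowerBounds S')
    (hf : ∀ t ∈ S', ∃ s ∈ S, f s ≤ t ∧ ∀ r ∈ S, f r ≤ t → r ≤ s) :
    LimAt D ((res D (monoHom f)).obj M) S b ↔ LimAt D M S' (f b) := by
  choose l hlS hl hmax using hf
  let k := mapsToHom f h
  let L : S' →o S :=
    { toFun := fun t => ⟨l t.1 t.2, hlS t.1 t.2⟩
      monotone' := fun s t hst => hmax _ _ _ (hlS _ _) (le_trans (hl _ _) hst) }
  have key := isLim_iff_of_thin (lowerCone S' (f b) hb')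
    ((α_ _ _ _).inv ≫ lowerCone S b hb ▷ monoHom f) (monoHom k) (Iso.refl _)
    (Cat.Hom.isoMk (Discrete.natIso fun _ => Iso.refl _)) M
    fun Z => bijective_restrict_of_leftAdjoint (thinAdj k.monotone.functor L.monotone.functor
      (fun x => homOfLE (hmax _ (h x.2) _ x.2 le_rfl))
      (fun x => homOfLE (hl x.1 x.2))).toCat _ _ Z
  rw [isLim_whiskerRight_iff] at key
  exact ⟨fun h => ⟨hb', key.1 h.2⟩, fun h => ⟨hb, key.2 h.2⟩⟩

/-- The case of the identity map: the inclusion of S in T has a left adjoint. -/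
theorem colimAt_iff_of_final (h : S ⊆ T) (hb : b ∈ upperBounds T)
    (hf : ∀ t ∈ T, ∃ s ∈ S, t ≤ s ∧ ∀ r ∈ S, t ≤ r → s ≤ r) :
    ColimAt D M S b ↔ ColimAt D M T b := by
  have e : (res D (monoHom OrderHom.id)).obj M ≅ M := (resId D (Cat.of B)).app M
  exact (exists_congr fun _ => (isColim_congr _ e).symm).trans
    (colimAt_restrict_iff OrderHom.id M h (fun _ hx => hb (h hx)) hb hf)

theorem limAt_iff_of_initial (h : S ⊆ T) (hb : b ∈ lowerBounds T)
    (hf : ∀ t ∈ T, ∃ s ∈ S, s ≤ t ∧ ∀ r ∈ S, r ≤ t → r ≤ s) :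
    LimAt D M S b ↔ LimAt D M T b := by
  have e : (res D (monoHom OrderHom.id)).obj M ≅ M := (resId D (Cat.of B)).app M
  exact (exists_congr fun _ => (isLim_congr _ e).symm).trans
    (limAt_restrict_iff OrderHom.id M h (fun _ hx => hb (h hx)) hb hf)

theorem isIso_upperCocone_singleton (h : b ∈ upperBounds {b}) : IsIso (upperCocone {b} b h) := by
  have : ∀ x, IsIso ((upperCocone {b} b h).toNatTrans.app x) := fun x =>
    ⟨homOfLE (X := B) (le_of_eq x.2.symm), Subsingleton.elim _ _, Subsingleton.elim _ _⟩
  exact isIso_of_isIso_app _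

theorem isIso_lowerCone_singleton (h : b ∈ lowerBounds {b}) : IsIso (lowerCone {b} b h) := by
  have : ∀ x, IsIso ((lowerCone {b} b h).toNatTrans.app x) := fun x =>
    ⟨homOfLE (X := B) (le_of_eq x.2), Subsingleton.elim _ _, Subsingleton.elim _ _⟩
  exact isIso_of_isIso_app _

/-- The vertex b is a terminal object of S, so {b} is final in S and the cocone is invertible there.
-/
theorem colimAt_of_mem (hb : b ∈ upperBounds S) (hbS : b ∈ S) : ColimAt D M S b := by
  have hb' : b ∈ upperBounds {b} := fun _ hx => le_of_eq hx
  rw [← colimAt_iff_of_final (S := {b}) (Set.singleton_subset_iff.2 hbS) hb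
    fun t ht => ⟨b, rfl, hb ht, fun r hr _ => le_of_eq hr.symm⟩]
  refine ⟨hb', ?_⟩
  have hx : Limits.IsTerminal (C := ({b} : Set B)) ⟨b, rfl⟩ :=
    Limits.IsTerminal.ofUniqueHom (fun y => homOfLE (hb' y.2)) fun _ _ => Subsingleton.elim _ _
  rw [IsColim, ← isUniv_restrict_iff (ptHom (A := Cat.of ({b} : Set B)) ⟨b, rfl⟩) _ _
    fun Z => bijective_restrict_of_rightAdjoint (toPtAdj hx) _ _ Z, isUniv_pt_iff,
    isIso_comp_right_iff]
  have := isIso_upperCocone_singleton hb'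
  unfold coconeMap; infer_instance

theorem limAt_of_mem (hb : b ∈ lowerBounds S) (hbS : b ∈ S) : LimAt D M S b := by
  have hb' : b ∈ lowerBounds {b} := fun _ hx => le_of_eq hx.symm
  rw [← limAt_iff_of_initial (S := {b}) (Set.singleton_subset_iff.2 hbS) hb
    fun t ht => ⟨b, rfl, hb ht, fun r hr _ => le_of_eq hr⟩]
  refine ⟨hb', ?_⟩
  have hx : Limits.IsInitial (C := ({b} : Set B)) ⟨b, rfl⟩ :=
    Limits.IsInitial.ofUniqueHom (fun y => homOfLE (hb' y.2)) fun _ _ => Subsingleton.elim _ _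
  rw [IsLim, ← isCouniv_restrict_iff (ptHom (A := Cat.of ({b} : Set B)) ⟨b, rfl⟩) _ _
    fun Z => bijective_restrict_of_leftAdjoint (ptToAdj hx) _ _ Z, isCouniv_pt_iff,
    isIso_comp_left_iff]
  have := isIso_lowerCone_singleton hb'
  unfold coneMap; infer_instance

/-- By the pointwise criterion M restricted to T is the left Kan extension of its restriction to S,
and passing to a left Kan extension does not change colimits. -/
theorem colimAt_iff_of_ext [IsDerivator D] (h : S ⊆ T) (hb : b ∈ upperBounds T)
    (hT : ∀ t ∈ T, ColimAt D M (S ∩ Set.Iic t) t) : ColimAt D M S b ↔ ColimAt D M T b := by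
  let S' : Set T := {x | x.1 ∈ S}
  have hS' : IsLeftExt D (setIncl S') ((res D (setIncl T)).obj M) := by
    rw [isLeftExt_setIncl_iff]
    intro t
    refine (colimAt_restrict_iff (inclHom T) M (S' := S ∩ Set.Iic t.1)
      (fun x hx => ⟨hx.1, hx.2⟩) (fun x hx => hx.2) (fun x hx => hx.2) fun s hs => ?_).2
      (hT t.1 t.2)
    exact ⟨⟨s, h hs.1⟩, ⟨hs.1, hs.2⟩, le_rfl, fun r _ hr => hr⟩
  have hbS : b ∈ upperBounds S := fun x hx => hb (h hx)
  -- S as a subset of the poset and S' as a subset of T are isomorphic posets, so passing between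
  -- them is harmless.
  let k : S →o S' := ⟨fun x => ⟨⟨x.1, h x.2⟩, x.2⟩, fun _ _ hxy => hxy⟩
  let k' : S' →o S := ⟨fun x => ⟨x.1.1, x.2⟩, fun _ _ hxy => hxy⟩
  have h₁ := isColim_iff_of_thin (D := D) (upperCocone T b hb)
    (setIncl S' ◁ upperCocone T b hb ≫ (α_ _ _ _).inv) (setIncl S') (Iso.refl _) (Iso.refl _) M
    fun Z => hS' _
  have h₂ := isColim_iff_of_thin (D := D) (setIncl S' ◁ upperCocone T b hb ≫ (α_ _ _ _).inv)
    (upperCocone S b hbS) (monoHom k) (Iso.refl _) (Iso.refl _) M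
    fun Z => bijective_restrict_of_rightAdjoint (thinAdj k'.monotone.functor k.monotone.functor
      (fun x => 𝟙 x) (fun x => 𝟙 x)).toCat _ _ Z
  exact ⟨fun h => ⟨hb, (h₂.trans h₁).1 h.2⟩, fun h => ⟨hbS, (h₂.trans h₁).2 h.2⟩⟩

theorem limAt_iff_of_ext [IsDerivator D] (h : S ⊆ T) (hb : b ∈ lowerBounds T)
    (hT : ∀ t ∈ T, LimAt D M (S ∩ Set.Ici t) t) : LimAt D M S b ↔ LimAt D M T b := by
  let S' : Set T := {x | x.1 ∈ S}
  have hS' : IsRightExt D (setIncl S') ((res D (setIncl T)).obj M) := by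
    rw [isRightExt_setIncl_iff]
    intro t
    refine (limAt_restrict_iff (inclHom T) M (S' := S ∩ Set.Ici t.1)
      (fun x hx => ⟨hx.1, hx.2⟩) (fun x hx => hx.2) (fun x hx => hx.2) fun s hs => ?_).2
      (hT t.1 t.2)
    exact ⟨⟨s, h hs.1⟩, ⟨hs.1, hs.2⟩, le_rfl, fun r _ hr => hr⟩
  have hbS : b ∈ lowerBounds S := fun x hx => hb (h hx)
  let k : S →o S' := ⟨fun x => ⟨⟨x.1, h x.2⟩, x.2⟩, fun _ _ hxy => hxy⟩
  let k' : S' →o S := ⟨fun x => ⟨x.1.1, x.2⟩, fun _ _ hxy => hxy⟩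
  have h₁ := isLim_iff_of_thin (D := D) (lowerCone T b hb)
    ((α_ _ _ _).hom ≫ setIncl S' ◁ lowerCone T b hb) (setIncl S') (Iso.refl _) (Iso.refl _) M
    fun Z => hS' _
  have h₂ := isLim_iff_of_thin (D := D) ((α_ _ _ _).hom ≫ setIncl S' ◁ lowerCone T b hb)
    (lowerCone S b hbS) (monoHom k) (Iso.refl _) (Iso.refl _) M
    fun Z => bijective_restrict_of_leftAdjoint (thinAdj k.monotone.functor k'.monotone.functor
      (fun x => 𝟙 x) (fun x => 𝟙 x)).toCat _ _ Z
  exact ⟨fun h => ⟨hb, (h₂.trans h₁).1 h.2⟩, fun h => ⟨hbS, (h₂.trans h₁).2 h.2⟩⟩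

end thin

/-! ### From stars to squares in the lattice of finite subsets. -/

section combinatorics
variable {α : Type*} [DecidableEq α]

/-- Let `P S b` express that `b` is the colimit of `S`. If the vertices below `b` are colimits of
their faces of cardinality at most one, then `b` is such a colimit if and only if it is the
pushout of a square. -/
theorem star_iff_square (P : Set (Finset α) → Finset α → Prop)
    (final : ∀ S T b, S ⊆ T → b ∈ upperBounds T →
      (∀ t ∈ T, ∃ s ∈ S, t ≤ s ∧ ∀ r ∈ S, t ≤ r → s ≤ r) → (P S b ↔ P T b))
    (ext : ∀ S T b, S ⊆ T → b ∈ upperBounds T →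
      (∀ t ∈ T, P (S ∩ Set.Iic t) t) → (P S b ↔ P T b))
    {U : Finset α} {s t : α} (hs : s ∉ U) (ht : t ∉ U) (hst : s ≠ t)
    (IH : ∀ m < insert s (insert t U), P ({x | x.card ≤ 1} ∩ Set.Iic m) m) :
    P ({x | x.card ≤ 1} ∩ Set.Iic (insert s (insert t U))) (insert s (insert t U)) ↔
      P {U, insert s U, insert t U} (insert s (insert t U)) := by
  set b := insert s (insert t U) with hb
  -- K is the common comparison shape: the induction hypothesis makes it an extension of the star,
  -- and the span under b is final in it.
  let K : Set (Finset α) := Set.Iic (insert s U) ∪ Set.Iic (insert t U)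
  have hsb : insert s U < b := by
    rw [hb, Finset.insert_comm]
    exact Finset.ssubset_insert (by simp [ht, hst.symm])
  have htb : insert t U < b := Finset.ssubset_insert (by simp [hs, hst])
  have hKb : ∀ m ∈ K, m < b := by
    rintro m (hm | hm)
    · exact lt_of_le_of_lt hm hsb
    · exact lt_of_le_of_lt hm htb
  have hub : b ∈ upperBounds K := fun m hm => (hKb m hm).le
  rw [final {U, insert s U, insert t U} K b ?_ hub ?_, ext _ K b ?_ hub ?_]
  -- A set with at most one element cannot contain both s and t, so it lies in K.
  · rintro m ⟨hm₁, hm₂⟩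
    simp only [Set.mem_ofPred_eq, Finset.card_le_one] at hm₁
    by_cases h : t ∈ m
    · right
      intro x hx
      have := hm₁ x hx t h
      simp [this]
    · left
      intro x hx
      have := hm₂ hx
      simp only [hb, Finset.mem_insert] at this ⊢
      rcases this with h' | h' | h'
      · exact .inl h'
      · exact absurd (h' ▸ hx) h
      · exact .inr h'
  · intro m hm
    have : {x : Finset α | x.card ≤ 1} ∩ Set.Iic b ∩ Set.Iic m =
        {x : Finset α | x.card ≤ 1} ∩ Set.Iic m := by
      ext x
      exact ⟨fun h => ⟨h.1.1, h.2⟩, fun h => ⟨⟨h.1, h.2.trans (hub hm)⟩, h.2⟩⟩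
    rw [this]
    exact IH m (hKb m hm)
  · rintro m (rfl | rfl | rfl)
    · exact .inl (Finset.subset_insert _ _)
    · exact .inl (Set.mem_Iic.2 le_rfl)
    · exact .inr (Set.mem_Iic.2 le_rfl)
  -- The least member of the span above m is decided by membership: insert s U if s is in m, insert
  -- t U if t is in m, and U otherwise. No m in K contains both.
  · intro m hm
    by_cases hsm : s ∈ m
    · have htm : t ∉ m := by
        intro h
        rcases hm with hm | hm
        · have := hm h
          simp [ht, hst.symm] at this
        · have := hm hsm
          simp [hs, hst] at this
      refine ⟨insert s U, by simp, ?_, ?_⟩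
      · rcases hm with hm | hm
        · exact hm
        · have := hm hsm
          simp [hs, hst] at this
      · rintro r (rfl | rfl | rfl) hr
        · exact absurd (hr hsm) hs
        · exact le_rfl
        · have := hr hsm
          simp [hs, hst] at this
    · by_cases htm : t ∈ m
      · refine ⟨insert t U, by simp, ?_, ?_⟩
        · rcases hm with hm | hm
          · have := hm htm
            simp [ht, hst.symm] at this
          · exact hm
        · rintro r (rfl | rfl | rfl) hr
          · exact absurd (hr htm) ht
          · have := hr htm
            simp [ht, hst.symm] at this
          · exact le_rfl
      · have hmU : m ≤ U := by
          intro x hx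
          rcases hm with hm | hm
          · rcases Finset.mem_insert.1 (hm hx) with h | h
            · exact absurd (h ▸ hx) hsm
            · exact h
          · rcases Finset.mem_insert.1 (hm hx) with h | h
            · exact absurd (h ▸ hx) htm
            · exact h
        refine ⟨U, by simp, hmU, ?_⟩
        rintro r (rfl | rfl | rfl) -
        · exact le_rfl
        · exact Finset.subset_insert _ _
        · exact Finset.subset_insert _ _

/-- Strong induction on b. A vertex of cardinality at most one belongs to its own star, so nothing
is to be checked; a larger one is the last corner of a square, obtained by removing two of its
elements. The predicate is abstract so that it can mean colimits or, after reversing the order,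
limits. -/
theorem forall_star_iff_forall_square (P : Set (Finset α) → Finset α → Prop)
    (final : ∀ S T b, S ⊆ T → b ∈ upperBounds T →
      (∀ t ∈ T, ∃ s ∈ S, t ≤ s ∧ ∀ r ∈ S, t ≤ r → s ≤ r) → (P S b ↔ P T b))
    (ext : ∀ S T b, S ⊆ T → b ∈ upperBounds T →
      (∀ t ∈ T, P (S ∩ Set.Iic t) t) → (P S b ↔ P T b))
    (top : ∀ S b, b ∈ upperBounds S → b ∈ S → P S b) :
    (∀ b, P ({x | x.card ≤ 1} ∩ Set.Iic b) b) ↔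
      ∀ (U : Finset α) (s t : α), s ∉ U → t ∉ U → s ≠ t →
        P {U, insert s U, insert t U} (insert s (insert t U)) := by
  constructor
  · intro h U s t hs ht hst
    exact (star_iff_square P final ext hs ht hst fun m _ => h m).1 (h _)
  · intro h b
    induction b using Finset.strongInduction with
    | H b IH =>
      by_cases hb : b.card ≤ 1
      · exact top _ _ (fun _ hx => hx.2) ⟨hb, le_refl b⟩
      · obtain ⟨s, hs, t, ht, hst⟩ := Finset.one_lt_card.1 (not_le.1 hb)
        obtain ⟨U, hsU, htU, rfl⟩ : ∃ U, s ∉ U ∧ t ∉ U ∧ b = insert s (insert t U) :=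
          ⟨(b.erase s).erase t, by simp, by simp, by
            rw [Finset.insert_erase (Finset.mem_erase.2 ⟨hst.symm, ht⟩), Finset.insert_erase hs]⟩
        exact (star_iff_square P final ext hsU htU hst IH).2 (h U s t hsU htU hst)

end combinatorics

/-! ### Vertices of the cube as finite sets. -/

section cube
variable {n : ℕ}

/-- The subset of coordinates equal to `1`. -/
def Cube.ones (m : Cube.{w} n) : Finset (Fin n) := {i | m.coord i = 1}

/-- The subset of coordinates equal to `0`. -/
def Cube.zeros (m : Cube.{w} n) : Finset (Fin n) := {i | m.coord i = 0}

/-- The vertex with given coordinates equal to `1`. -/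
def Cube.ofOnes (s : Finset (Fin n)) : Cube.{w} n := ⟨fun i => if i ∈ s then 1 else 0⟩

/-- The vertex with given coordinates equal to `0`. -/
def Cube.ofZeros (s : Finset (Fin n)) : Cube.{w} n := ⟨fun i => if i ∈ s then 0 else 1⟩

theorem Cube.le_def {m m' : Cube.{w} n} : m ≤ m' ↔ ∀ i, m.coord i ≤ m'.coord i := Iff.rfl

@[ext]
theorem Cube.ext {m m' : Cube.{w} n} (h : ∀ i, m.coord i = m'.coord i) : m = m' := by
  cases m; cases m'; exact congrArg _ (funext h)

theorem Cube.card_eq_ones (m : Cube.{w} n) : m.card = m.ones.card := by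
  rw [Cube.card, Cube.ones, Finset.card_filter]
  refine Finset.sum_congr rfl fun i _ => ?_
  generalize m.coord i = x
  fin_cases x <;> rfl

theorem Cube.card_add_zeros (m : Cube.{w} n) : m.card + m.zeros.card = n := by
  have h : m.zeros = m.onesᶜ := by
    ext i
    simp only [Cube.zeros, Cube.ones, Finset.mem_filter, Finset.mem_univ, true_and,
      Finset.mem_compl]
    generalize m.coord i = x
    fin_cases x <;> simp
  rw [m.card_eq_ones, h, Finset.card_compl, Fintype.card_fin]
  have := Finset.card_le_univ m.ones
  rw [Fintype.card_fin] at this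
  omega

/-- Vertices of the cube as subsets. -/
def onesIso (n : ℕ) : Cube.{w} n ≃o Finset (Fin n) where
  toFun := Cube.ones
  invFun := Cube.ofOnes
  left_inv m := by
    ext i
    simp only [Cube.ofOnes, Cube.ones, Finset.mem_filter, Finset.mem_univ, true_and]
    generalize m.coord i = x
    fin_cases x <;> rfl
  right_inv s := by ext i; simp [Cube.ofOnes, Cube.ones]
  map_rel_iff' {m m'} := by
    simp only [Equiv.coe_fn_mk, Cube.le_def, Cube.ones, Finset.subset_iff,
      Finset.mem_filter, Finset.mem_univ, true_and]
    refine forall_congr' fun i => ?_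
    generalize m.coord i = x
    generalize m'.coord i = y
    fin_cases x <;> fin_cases y <;> decide

/-- Vertices of the cube as subsets, by their vanishing coordinates. -/
def zerosIso (n : ℕ) : (Cube.{w} n)ᵒᵈ ≃o Finset (Fin n) where
  toFun m := (OrderDual.ofDual m).zeros
  invFun s := OrderDual.toDual (Cube.ofZeros s)
  left_inv m := by
    refine congrArg OrderDual.toDual (Cube.ext fun i => ?_)
    simp only [Cube.ofZeros, Cube.zeros, Finset.mem_filter, Finset.mem_univ, true_and]
    change _ = (OrderDual.ofDual m).coord i
    generalize (OrderDual.ofDual m).coord i = x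
    fin_cases x <;> rfl
  right_inv s := by ext i; simp [Cube.ofZeros, Cube.zeros]
  map_rel_iff' {m m'} := by
    rw [← OrderDual.ofDual_le_ofDual]
    simp only [Equiv.coe_fn_mk, Cube.le_def, Cube.zeros, Finset.subset_iff,
      Finset.mem_filter, Finset.mem_univ, true_and]
    refine forall_congr' fun i => ?_
    generalize (OrderDual.ofDual m).coord i = x
    generalize (OrderDual.ofDual m').coord i = y
    fin_cases x <;> fin_cases y <;> decide

end cube

/-! ### Strongly (co)cartesian cubes and their two-dimensional faces. -/

section squares

section
variable {D : Prederivator.{w, v, u}} {B B' : Type w} [PartialOrder B] [PartialOrder B']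

theorem colimAt_triple_iff (f : B' ↪o B) (X : val D (Cat.of B))
    {x y z b : B'} (hb : b ∈ upperBounds {x, y, z}) :
    ColimAt D ((res D (monoHom (f : B' →o B))).obj X) {x, y, z} b ↔
      ColimAt D X {f x, f y, f z} (f b) := by
  refine colimAt_restrict_iff (f : B' →o B) X ?_ hb ?_ ?_
  · rintro m (rfl | rfl | rfl) <;> simp
  · rintro m (rfl | rfl | rfl) <;> exact f.monotone (hb (by simp))
  · rintro m (rfl | rfl | rfl)
    · exact ⟨x, by simp, le_rfl, fun r _ h => f.le_iff_le.1 h⟩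
    · exact ⟨y, by simp, le_rfl, fun r _ h => f.le_iff_le.1 h⟩
    · exact ⟨z, by simp, le_rfl, fun r _ h => f.le_iff_le.1 h⟩

theorem limAt_triple_iff (f : B' ↪o B) (X : val D (Cat.of B))
    {x y z b : B'} (hb : b ∈ lowerBounds {x, y, z}) :
    LimAt D ((res D (monoHom (f : B' →o B))).obj X) {x, y, z} b ↔
      LimAt D X {f x, f y, f z} (f b) := by
  refine limAt_restrict_iff (f : B' →o B) X ?_ hb ?_ ?_
  · rintro m (rfl | rfl | rfl) <;> simp
  · rintro m (rfl | rfl | rfl) <;> exact f.monotone (hb (by simp))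
  · rintro m (rfl | rfl | rfl)
    · exact ⟨x, by simp, le_rfl, fun r _ h => f.le_iff_le.1 h⟩
    · exact ⟨y, by simp, le_rfl, fun r _ h => f.le_iff_le.1 h⟩
    · exact ⟨z, by simp, le_rfl, fun r _ h => f.le_iff_le.1 h⟩

end

variable {D : Prederivator.{w, v, u}} [IsDerivator D] {α : Type*} [DecidableEq α]
  {B : Type w} [PartialOrder B]

theorem preimage_triple {X Y : Type*} (e : X ≃ Y) (a b c : Y) :
    {x | e x ∈ ({a, b, c} : Set Y)} = {e.symm a, e.symm b, e.symm c} := by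
  ext x
  simp [Equiv.eq_symm_apply]

/-- The star-to-square principle for the predicate "the value at b is the colimit over S",
transported along e; its three axioms are finality, transitivity of extensions and the terminal
vertex. -/
theorem isLeftExt_iff_forall_square (e : B ≃o Finset α) (X : val D (Cat.of B)) :
    IsLeftExt D (setIncl {m | (e m).card ≤ 1}) X ↔
      ∀ (U : Finset α) (s t : α), s ∉ U → t ∉ U → s ≠ t →
        ColimAt D X {e.symm U, e.symm (insert s U), e.symm (insert t U)}
          (e.symm (insert s (insert t U))) := by
  have key := forall_star_iff_forall_square
    (fun S b => ColimAt D X {m | e m ∈ S} (e.symm b)) ?_ ?_ ?_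
  · rw [isLeftExt_setIncl_iff, ← e.symm.forall_congr_right]
    refine Iff.trans (forall_congr' fun b => ?_) (key.trans ?_)
    · have : {m | (e m).card ≤ 1} ∩ Set.Iic (e.symm b) =
          {m | e m ∈ {x : Finset α | x.card ≤ 1} ∩ Set.Iic b} := by
        ext m; simp [OrderIso.le_symm_apply]
      rw [← this]
      rfl
    · simp only [← e.coe_toEquiv, preimage_triple]
      rfl
  · intro S T b hST hb hf
    refine colimAt_iff_of_final (fun m hm => hST hm) (fun m hm => e.le_symm_apply.2 (hb hm)) ?_
    intro t ht
    obtain ⟨s, hs, hts, hmin⟩ := hf (e t) ht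
    refine ⟨e.symm s, by simpa using hs, e.le_symm_apply.2 hts, fun r hr htr => ?_⟩
    exact e.symm_apply_le.2 (hmin _ hr (e.monotone htr))
  · intro S T b hST hb hT
    refine colimAt_iff_of_ext (fun m hm => hST hm) (fun m hm => e.le_symm_apply.2 (hb hm)) ?_
    intro t ht
    have := hT (e t) ht
    have h : {m | e m ∈ S} ∩ Set.Iic t = {m | e m ∈ S ∩ Set.Iic (e t)} := by
      ext m; simp
    rw [h]
    simpa using this
  · intro S b hb hbS
    exact colimAt_of_mem (fun m hm => e.le_symm_apply.2 (hb hm)) (by simpa using hbS)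

/-- As e reverses the order, lower bounds become upper bounds, and limits satisfy the axioms of the
same combinatorial principle. -/
theorem isRightExt_iff_forall_square (e : Bᵒᵈ ≃o Finset α) (X : val D (Cat.of B)) :
    IsRightExt D (setIncl {m : B | (e (OrderDual.toDual m)).card ≤ 1}) X ↔
      ∀ (U : Finset α) (s t : α), s ∉ U → t ∉ U → s ≠ t →
        LimAt D X {OrderDual.ofDual (e.symm U), OrderDual.ofDual (e.symm (insert s U)),
          OrderDual.ofDual (e.symm (insert t U))}
          (OrderDual.ofDual (e.symm (insert s (insert t U)))) := by
  have key := forall_star_iff_forall_square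
    (fun S b => LimAt D X {m : B | e (OrderDual.toDual m) ∈ S} (OrderDual.ofDual (e.symm b)))
    ?_ ?_ ?_
  · rw [isRightExt_setIncl_iff, ← (e.symm.toEquiv.trans OrderDual.ofDual).forall_congr_right]
    refine Iff.trans (forall_congr' fun b => ?_) (key.trans ?_)
    · have : {m : B | (e (OrderDual.toDual m)).card ≤ 1} ∩
          Set.Ici ((e.symm.toEquiv.trans OrderDual.ofDual) b) =
          {m | e (OrderDual.toDual m) ∈ {x : Finset α | x.card ≤ 1} ∩ Set.Iic b} := by
        ext m
        simp [← OrderIso.le_symm_apply, OrderDual.toDual_le]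
      rw [this]
      rfl
    · have h : ∀ a b c, {m : B | e (OrderDual.toDual m) ∈ ({a, b, c} : Set (Finset α))} = _ :=
        preimage_triple (OrderDual.toDual.trans e.toEquiv)
      simp only [h]
      rfl
  · intro S T b hST hb hf
    refine limAt_iff_of_initial (fun m hm => hST hm)
      (fun m hm => OrderDual.toDual_le_toDual.1 (e.le_symm_apply.2 (hb hm))) ?_
    intro t ht
    obtain ⟨s, hs, hts, hmin⟩ := hf (e (OrderDual.toDual t)) ht
    refine ⟨OrderDual.ofDual (e.symm s), by simpa using hs,
      OrderDual.toDual_le_toDual.1 (e.le_symm_apply.2 hts), fun r hr htr => ?_⟩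
    exact OrderDual.toDual_le_toDual.1 (e.symm_apply_le.2
      (hmin _ hr (e.monotone (OrderDual.toDual_le_toDual.2 htr))))
  · intro S T b hST hb hT
    refine limAt_iff_of_ext (fun m hm => hST hm)
      (fun m hm => OrderDual.toDual_le_toDual.1 (e.le_symm_apply.2 (hb hm))) ?_
    intro t ht
    have := hT (e (OrderDual.toDual t)) ht
    have h : {m : B | e (OrderDual.toDual m) ∈ S} ∩ Set.Ici t =
        {m | e (OrderDual.toDual m) ∈ S ∩ Set.Iic (e (OrderDual.toDual t))} := by
      ext m; simp
    rw [h]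
    simpa using this
  · intro S b hb hbS
    exact limAt_of_mem (fun m hm => OrderDual.toDual_le_toDual.1 (e.le_symm_apply.2 (hb hm)))
      (by simpa using hbS)

/-- Two distinct directions exhaust the coordinates, so U is empty and only the square itself is
left, up to exchange of its two directions. -/
theorem forall_fin_two_iff (Q : Finset (Fin 2) → Fin 2 → Fin 2 → Prop)
    (hQ : Q ∅ 0 1 → Q ∅ 1 0) :
    (∀ U s t, s ∉ U → t ∉ U → s ≠ t → Q U s t) ↔ Q ∅ 0 1 := by
  refine ⟨fun h => h _ _ _ (by simp) (by simp) (by simp), fun h U s t hs ht hst => ?_⟩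
  have hU : U = ∅ := by
    refine Finset.eq_empty_of_forall_notMem fun x hx => ?_
    have h₁ : x ≠ s := fun e => hs (e ▸ hx)
    have h₂ : x ≠ t := fun e => ht (e ▸ hx)
    omega
  subst hU
  fin_cases s <;> fin_cases t
  · exact absurd rfl hst
  · exact h
  · exact hQ h
  · exact absurd rfl hst

variable {n : ℕ}

/-- The two-dimensional face of the cube through `c` in the directions `s` and `t`. -/
def face (c : Cube.{w} n) {s t : Fin n} (hst : s ≠ t) : Cube.{w} 2 ↪o Cube.{w} n :=
  OrderEmbedding.ofMapLEIff
    (fun x => ⟨fun i => if i = s then x.coord 0 else if i = t then x.coord 1 else c.coord i⟩)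
    fun x y => by
      constructor
      · intro h i
        have hs := h s
        have ht := h t
        simp only [if_true, if_neg hst.symm] at hs ht
        fin_cases i
        · exact hs
        · exact ht
      · intro h i
        dsimp only
        split_ifs
        · exact h 0
        · exact h 1
        · exact le_rfl

/-- The restriction of a cube to a two-dimensional face. -/
def faceHom (c : Cube.{w} n) {s t : Fin n} (hst : s ≠ t) : cube.{w} 2 ⟶ cube.{w} n :=
  monoHom (face c hst : Cube.{w} 2 →o Cube.{w} n)

theorem isStronglyCocartesian_iff_isLeftExt (X : val D (cube.{w} n)) :
    IsStronglyCocartesian D X ↔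
      IsLeftExt D (setIncl {m : Cube.{w} n | ((onesIso n) m).card ≤ 1}) X := by
  have h : {m : Cube.{w} n | ((onesIso n) m).card ≤ 1} = {m | m.card ≤ 1} :=
    Set.ext fun m => by rw [Set.mem_ofPred_eq, Set.mem_ofPred_eq, m.card_eq_ones]; rfl
  rw [h]
  exact essImage_lan_iff (setIncl {m : Cube.{w} n | m.card ≤ 1}) X

theorem isStronglyCartesian_iff_isRightExt (X : val D (cube.{w} n)) :
    IsStronglyCartesian D X ↔ IsRightExt D
      (setIncl {m : Cube.{w} n | ((zerosIso n) (OrderDual.toDual m)).card ≤ 1}) X := by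
  have h : {m : Cube.{w} n | ((zerosIso n) (OrderDual.toDual m)).card ≤ 1} =
      {m | n - 1 ≤ m.card} := Set.ext fun m => by
    -- For n = 0 the truncated n - 1 is 0 and both conditions always hold.
    have := m.card_add_zeros
    change m.zeros.card ≤ 1 ↔ n - 1 ≤ m.card
    omega
  rw [h]
  exact essImage_ran_iff (setIncl {m : Cube.{w} n | n - 1 ≤ m.card}) X

theorem isCocartesian_iff (X : val D (cube.{w} 2)) :
    IsCocartesian D X ↔
      ColimAt D X {Cube.ofOnes ∅, Cube.ofOnes {0}, Cube.ofOnes {1}} (Cube.ofOnes {0, 1}) := by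
  -- For n = 2 the bounds n - 1 and 1 coincide, so cocartesian and strongly cocartesian have the
  -- same definition.
  refine (isStronglyCocartesian_iff_isLeftExt X).trans
    ((isLeftExt_iff_forall_square (onesIso 2) X).trans ?_)
  refine (forall_fin_two_iff _ fun h => ?_).trans Iff.rfl
  rw [Set.pair_comm]
  rwa [Finset.insert_comm]

theorem isCartesian_iff (X : val D (cube.{w} 2)) :
    IsCartesian D X ↔
      LimAt D X {Cube.ofZeros ∅, Cube.ofZeros {0}, Cube.ofZeros {1}} (Cube.ofZeros {0, 1}) := by
  refine (isStronglyCartesian_iff_isRightExt X).trans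
    ((isRightExt_iff_forall_square (zerosIso 2) X).trans ?_)
  refine (forall_fin_two_iff _ fun h => ?_).trans Iff.rfl
  rw [Set.pair_comm]
  rwa [Finset.insert_comm]

theorem face_ofOnes {U : Finset (Fin n)} {s t : Fin n} (hs : s ∉ U) (ht : t ∉ U) (hst : s ≠ t)
    (c : Cube.{w} n) (hc : ∀ i, i ≠ s → i ≠ t → c.coord i = if i ∈ U then 1 else 0) :
    face c hst (Cube.ofOnes ∅) = Cube.ofOnes U ∧
      face c hst (Cube.ofOnes {0}) = Cube.ofOnes (insert s U) ∧
      face c hst (Cube.ofOnes {1}) = Cube.ofOnes (insert t U) ∧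
      face c hst (Cube.ofOnes {0, 1}) = Cube.ofOnes (insert s (insert t U)) := by
  refine ⟨?_, ?_, ?_, ?_⟩
  all_goals
    refine Cube.ext fun i => ?_
    change (if i = s then _ else if i = t then _ else _) = _
    by_cases h₁ : i = s
    · subst h₁; simp [Cube.ofOnes, hs, hst]
    · by_cases h₂ : i = t
      · subst h₂; simp [Cube.ofOnes, ht, h₁]
      · simp [Cube.ofOnes, h₁, h₂, hc i h₁ h₂]

theorem face_ofZeros {U : Finset (Fin n)} {s t : Fin n} (hs : s ∉ U) (ht : t ∉ U) (hst : s ≠ t)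
    (c : Cube.{w} n) (hc : ∀ i, i ≠ s → i ≠ t → c.coord i = if i ∈ U then 0 else 1) :
    face c hst (Cube.ofZeros ∅) = Cube.ofZeros U ∧
      face c hst (Cube.ofZeros {0}) = Cube.ofZeros (insert s U) ∧
      face c hst (Cube.ofZeros {1}) = Cube.ofZeros (insert t U) ∧
      face c hst (Cube.ofZeros {0, 1}) = Cube.ofZeros (insert s (insert t U)) := by
  refine ⟨?_, ?_, ?_, ?_⟩
  all_goals
    refine Cube.ext fun i => ?_
    change (if i = s then _ else if i = t then _ else _) = _
    by_cases h₁ : i = s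
    · subst h₁; simp [Cube.ofZeros, hs, hst]
    · by_cases h₂ : i = t
      · subst h₂; simp [Cube.ofZeros, ht, h₁]
      · simp [Cube.ofZeros, h₁, h₂, hc i h₁ h₂]

theorem isCocartesian_face_iff {U : Finset (Fin n)} {s t : Fin n} (hs : s ∉ U) (ht : t ∉ U)
    (hst : s ≠ t) (c : Cube.{w} n)
    (hc : ∀ i, i ≠ s → i ≠ t → c.coord i = if i ∈ U then 1 else 0) (X : val D (cube.{w} n)) :
    IsCocartesian D ((res D (faceHom c hst)).obj X) ↔
      ColimAt D X {Cube.ofOnes U, Cube.ofOnes (insert s U), Cube.ofOnes (insert t U)}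
        (Cube.ofOnes (insert s (insert t U))) := by
  obtain ⟨h₁, h₂, h₃, h₄⟩ := face_ofOnes hs ht hst c hc
  refine (isCocartesian_iff _).trans ((colimAt_triple_iff (face c hst) X ?_).trans ?_)
  · rintro m (rfl | rfl | rfl) <;> exact (onesIso 2).symm.monotone (by simp)
  · rw [h₁, h₂, h₃, h₄]

theorem isCartesian_face_iff {U : Finset (Fin n)} {s t : Fin n} (hs : s ∉ U) (ht : t ∉ U)
    (hst : s ≠ t) (c : Cube.{w} n)
    (hc : ∀ i, i ≠ s → i ≠ t → c.coord i = if i ∈ U then 0 else 1) (X : val D (cube.{w} n)) :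
    IsCartesian D ((res D (faceHom c hst)).obj X) ↔
      LimAt D X {Cube.ofZeros U, Cube.ofZeros (insert s U), Cube.ofZeros (insert t U)}
        (Cube.ofZeros (insert s (insert t U))) := by
  obtain ⟨h₁, h₂, h₃, h₄⟩ := face_ofZeros hs ht hst c hc
  refine (isCartesian_iff _).trans ((limAt_triple_iff (face c hst) X ?_).trans ?_)
  · rintro m (rfl | rfl | rfl) <;>
      exact OrderDual.toDual_le_toDual.1 ((zerosIso 2).symm.monotone (by simp))
  · rw [h₁, h₂, h₃, h₄]

/-- A cube is strongly cocartesian if and only if all its two-dimensional faces are cocartesian. -/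
theorem isStronglyCocartesian_iff_faces (X : val D (cube.{w} n)) :
    IsStronglyCocartesian D X ↔ ∀ (c : Cube.{w} n) (s t : Fin n) (hst : s ≠ t),
      IsCocartesian D ((res D (faceHom c hst)).obj X) := by
  rw [isStronglyCocartesian_iff_isLeftExt]
  refine (isLeftExt_iff_forall_square (onesIso n) X).trans ⟨fun h c s t hst => ?_,
    fun h U s t hs ht hst => ?_⟩
  -- The face depends on c only outside the directions s and t, so U consists of the remaining
  -- coordinates of c equal to 1.
  · have hs : s ∉ c.ones \ {s, t} := by simp
    have ht : t ∉ c.ones \ {s, t} := by simp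
    refine (isCocartesian_face_iff hs ht hst c (fun i h₁ h₂ => ?_) X).2 (h _ s t hs ht hst)
    have : (i ∈ c.ones \ {s, t}) ↔ c.coord i = 1 := by simp [Cube.ones, h₁, h₂]
    rw [if_congr this rfl rfl]
    generalize c.coord i = x
    fin_cases x <;> rfl
  · exact (isCocartesian_face_iff hs ht hst (Cube.ofOnes U) (fun i _ _ => rfl) X).1
      (h (Cube.ofOnes U) s t hst)

/-- A cube is strongly cartesian if and only if all its two-dimensional faces are cartesian. -/
theorem isStronglyCartesian_iff_faces (X : val D (cube.{w} n)) :
    IsStronglyCartesian D X ↔ ∀ (c : Cube.{w} n) (s t : Fin n) (hst : s ≠ t),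
      IsCartesian D ((res D (faceHom c hst)).obj X) := by
  rw [isStronglyCartesian_iff_isRightExt]
  refine (isRightExt_iff_forall_square (zerosIso n) X).trans ⟨fun h c s t hst => ?_,
    fun h U s t hs ht hst => ?_⟩
  · have hs : s ∉ c.zeros \ {s, t} := by simp
    have ht : t ∉ c.zeros \ {s, t} := by simp
    refine (isCartesian_face_iff hs ht hst c (fun i h₁ h₂ => ?_) X).2 (h _ s t hs ht hst)
    have : (i ∈ c.zeros \ {s, t}) ↔ c.coord i = 0 := by simp [Cube.zeros, h₁, h₂]
    rw [if_congr this rfl rfl]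
    generalize c.coord i = x
    fin_cases x <;> rfl
  · exact (isCartesian_face_iff hs ht hst (Cube.ofZeros U) (fun i _ _ => rfl) X).1
      (h (Cube.ofZeros U) s t hst)

/-- Both conditions are tested on the same two-dimensional faces, where stability identifies them.
-/
theorem isStronglyCartesian_iff_isStronglyCocartesian {D : Prederivator.{w, v, u}} [IsStable D]
    (X : val D (cube.{w} n)) : IsStronglyCartesian D X ↔ IsStronglyCocartesian D X := by
  rw [isStronglyCartesian_iff_faces, isStronglyCocartesian_iff_faces]
  exact forall_congr' fun c => forall_congr' fun s => forall_congr' fun t =>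
    forall_congr' fun hst => IsStable.stable _

end squares

/-! ### The mate correspondence in a bicategory. -/

section mates
variable {B : Type u₁} [Bicategory.{w₁, v₁} B] {c d e f : B} {g g' : c ⟶ e} {h h' : d ⟶ f}
  {l₁ : c ⟶ d} {r₁ : d ⟶ c} {l₂ : e ⟶ f} {r₂ : f ⟶ e}
  (adj₁ : Bicategory.Adjunction l₁ r₁) (adj₂ : Bicategory.Adjunction l₂ r₂)

/-- Naturality of mates in the two unadjoined 1-cells; it carries the structure 2-cells of
pseudofunctors across the correspondence. -/
theorem mateEquiv_whisker (x : g' ⟶ g) (α : g ≫ l₂ ⟶ l₁ ≫ h) (y : h ⟶ h') :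
    Bicategory.mateEquiv adj₁ adj₂ (x ▷ l₂ ≫ α ≫ l₁ ◁ y) =
      r₁ ◁ x ≫ Bicategory.mateEquiv adj₁ adj₂ α ≫ y ▷ r₂ := by
  rw [Bicategory.mateEquiv_apply', Bicategory.mateEquiv_apply']
  calc
    _ = 𝟙 _ ⊗≫ r₁ ◁ (g' ◁ adj₂.unit ≫ x ▷ (l₂ ≫ r₂)) ⊗≫ r₁ ◁ α ▷ r₂ ⊗≫
          ((r₁ ≫ l₁) ◁ y ≫ adj₁.counit ▷ h') ▷ r₂ ⊗≫ 𝟙 _ := by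
      bicategory
    _ = _ := by
      rw [whisker_exchange, whisker_exchange]
      bicategory

/-- The unit of the second adjunction in the mate cancels against the counit of the transposition,
by a triangle identity. This yields the compatibility of counits with mates. -/
theorem homEquiv₁_eq (α : g ≫ l₂ ⟶ l₁ ≫ h) :
    adj₁.homEquiv₁ α =
      (α_ _ _ _).inv ≫ adj₂.homEquiv₂.symm (Bicategory.mateEquiv adj₁ adj₂ α) := by
  rw [Bicategory.mateEquiv_apply', Bicategory.Adjunction.homEquiv₁_apply,
    Bicategory.Adjunction.homEquiv₂_symm_apply]
  symm
  calc
    _ = 𝟙 _ ⊗≫ r₁ ◁ g ◁ adj₂.unit ▷ l₂ ⊗≫ r₁ ◁ α ▷ (r₂ ≫ l₂) ⊗≫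
          (adj₁.counit ▷ h ▷ (r₂ ≫ l₂) ≫ (𝟙 _ ≫ h) ◁ adj₂.counit) ⊗≫ 𝟙 _ := by
      bicategory
    _ = 𝟙 _ ⊗≫ r₁ ◁ g ◁ adj₂.unit ▷ l₂ ⊗≫ r₁ ◁ (α ▷ (r₂ ≫ l₂) ≫ (l₁ ≫ h) ◁ adj₂.counit) ⊗≫
          adj₁.counit ▷ h ⊗≫ 𝟙 _ := by
      rw [← whisker_exchange]
      bicategory
    _ = 𝟙 _ ⊗≫ r₁ ◁ g ◁ leftZigzag adj₂.unit adj₂.counit ⊗≫ r₁ ◁ α ⊗≫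
          adj₁.counit ▷ h ⊗≫ 𝟙 _ := by
      rw [← whisker_exchange]
      bicategory
    _ = _ := by
      rw [adj₂.left_triangle]
      bicategory

/-- In the equation relating a mate to the two units, every factor other than the whiskered mate is
invertible. -/
theorem isIso_mateEquiv_symm_whiskerRight (β : r₁ ≫ g ⟶ h ≫ r₂) [IsIso β] [IsIso adj₁.unit]
    [IsIso adj₂.unit] : IsIso ((Bicategory.mateEquiv adj₁ adj₂).symm β ▷ r₂) := by
  have := (mateEquiv_eq_iff adj₁ adj₂ ((Bicategory.mateEquiv adj₁ adj₂).symm β) β).1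
    (Equiv.apply_symm_apply _ _)
  rw [Bicategory.Adjunction.homEquiv₁_symm_apply, Bicategory.Adjunction.homEquiv₂_apply] at this
  have h₁ : IsIso ((λ_ g).inv ≫ adj₁.unit ▷ g ≫ (α_ l₁ r₁ g).hom ≫ l₁ ◁ β) := inferInstance
  rw [this] at h₁
  have h₂ := IsIso.of_isIso_comp_right ((ρ_ g).inv ≫ g ◁ adj₂.unit ≫ (α_ g l₂ r₂).inv ≫
    (Bicategory.mateEquiv adj₁ adj₂).symm β ▷ r₂) (α_ l₁ h r₂).hom
  have h₃ := IsIso.of_isIso_comp_left (ρ_ g).inv (g ◁ adj₂.unit ≫ (α_ g l₂ r₂).inv ≫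
    (Bicategory.mateEquiv adj₁ adj₂).symm β ▷ r₂)
  have h₄ := IsIso.of_isIso_comp_left (g ◁ adj₂.unit) ((α_ g l₂ r₂).inv ≫
    (Bicategory.mateEquiv adj₁ adj₂).symm β ▷ r₂)
  exact IsIso.of_isIso_comp_left (α_ g l₂ r₂).inv _

theorem isIso_mateEquiv_whiskerRight (α : g ≫ l₂ ⟶ l₁ ≫ h) [IsIso α] [IsIso adj₁.counit]
    [IsIso adj₂.counit] : IsIso (Bicategory.mateEquiv adj₁ adj₂ α ▷ l₂) := by
  have := homEquiv₁_eq adj₁ adj₂ α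
  rw [Bicategory.Adjunction.homEquiv₂_symm_apply, Bicategory.Adjunction.homEquiv₁_apply] at this
  have h₁ : IsIso (r₁ ◁ α ≫ (α_ r₁ l₁ h).inv ≫ adj₁.counit ▷ h ≫ (λ_ h).hom) := inferInstance
  rw [this] at h₁
  have h₂ := IsIso.of_isIso_comp_left (α_ r₁ g l₂).inv
    (Bicategory.mateEquiv adj₁ adj₂ α ▷ l₂ ≫ (α_ h r₂ l₂).hom ≫ h ◁ adj₂.counit ≫ (ρ_ h).hom)
  exact IsIso.of_isIso_comp_right _ ((α_ h r₂ l₂).hom ≫ h ◁ adj₂.counit ≫ (ρ_ h).hom)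

end mates

/-! ### Assembling pointwise adjoints into pseudo-natural ones. -/

section doctrinal
variable {B : Type u₁} [Bicategory.{w₁, v₁} B] {C : Type u₂} [Bicategory.{w₂, v₂} C]
  {F G : Pseudofunctor B C} (ρ : F ⟶ G)

section left
variable (L : ∀ b, G.obj b ⟶ F.obj b) (adj : ∀ b, Bicategory.Adjunction (L b) (ρ.app b))

/-- The mate of the naturality constraint, for pointwise left adjoints. -/
def leftAdjMate {a b : B} (f : a ⟶ b) : G.map f ≫ L b ⟶ L a ≫ F.map f :=
  (Bicategory.mateEquiv (adj a) (adj b)).symm (ρ.naturality f).inv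

theorem mateEquiv_leftAdjMate {a b : B} (f : a ⟶ b) :
    Bicategory.mateEquiv (adj a) (adj b) (leftAdjMate ρ L adj f) = (ρ.naturality f).inv :=
  Equiv.apply_symm_apply _ _

/-- Under the injective mate correspondence this axiom, and likewise the unit and composition axioms
below, becomes the same axiom for the inverse constraints of ρ. -/
theorem leftAdjMate_naturality {a b : B} {f g : a ⟶ b} (η : f ⟶ g) :
    G.map₂ η ▷ L b ≫ leftAdjMate ρ L adj g = leftAdjMate ρ L adj f ≫ L a ◁ F.map₂ η := by
  apply (Bicategory.mateEquiv (adj a) (adj b)).injective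
  have h₁ := mateEquiv_whisker (adj a) (adj b) (G.map₂ η) (leftAdjMate ρ L adj g) (𝟙 _)
  have h₂ := mateEquiv_whisker (adj a) (adj b) (𝟙 _) (leftAdjMate ρ L adj f) (F.map₂ η)
  simp only [Bicategory.whiskerLeft_id, Bicategory.id_whiskerRight, Category.comp_id,
    Category.id_comp, mateEquiv_leftAdjMate] at h₁ h₂
  rw [h₁, h₂, Iso.eq_inv_comp, ← Category.assoc, Iso.comp_inv_eq]
  exact (ρ.naturality_naturality η).symm

theorem leftAdjMate_id (a : B) :
    leftAdjMate ρ L adj (𝟙 a) ≫ L a ◁ (F.mapId a).hom =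
      (G.mapId a).hom ▷ L a ≫ (λ_ (L a)).hom ≫ (ρ_ (L a)).inv := by
  rw [← cancel_mono (L a ◁ (F.mapId a).inv)]
  apply (Bicategory.mateEquiv (adj a) (adj a)).injective
  have h := mateEquiv_whisker (adj a) (adj a) (G.mapId a).hom ((λ_ (L a)).hom ≫ (ρ_ (L a)).inv)
    (F.mapId a).inv
  rw [mateEquiv_leftUnitor_hom_rightUnitor_inv] at h
  simp only [Category.assoc] at h ⊢
  rw [h, ← Bicategory.whiskerLeft_comp, Iso.hom_inv_id, Bicategory.whiskerLeft_id,
    Category.comp_id, mateEquiv_leftAdjMate, Pseudofunctor.StrongTrans.naturality_id_inv]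

theorem leftAdjMate_comp {a b c : B} (f : a ⟶ b) (g : b ⟶ c) :
    leftAdjMate ρ L adj (f ≫ g) ≫ L a ◁ (F.mapComp f g).hom =
      (G.mapComp f g).hom ▷ L c ≫ (α_ _ _ _).hom ≫ G.map f ◁ leftAdjMate ρ L adj g ≫
        (α_ _ _ _).inv ≫ leftAdjMate ρ L adj f ▷ F.map g ≫ (α_ _ _ _).hom := by
  rw [← cancel_mono (L a ◁ (F.mapComp f g).inv)]
  apply (Bicategory.mateEquiv (adj a) (adj c)).injective
  have h := mateEquiv_whisker (adj a) (adj c) (G.mapComp f g).hom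
    (leftAdjointSquare.vcomp (leftAdjMate ρ L adj f) (leftAdjMate ρ L adj g)) (F.mapComp f g).inv
  rw [mateEquiv_vcomp (adj a) (adj b) (adj c), mateEquiv_leftAdjMate, mateEquiv_leftAdjMate] at h
  simp only [leftAdjointSquare.vcomp, rightAdjointSquare.vcomp, Category.assoc] at h ⊢
  rw [h, ← Bicategory.whiskerLeft_comp, Iso.hom_inv_id, Bicategory.whiskerLeft_id,
    Category.comp_id, mateEquiv_leftAdjMate, Pseudofunctor.StrongTrans.naturality_comp_inv]

theorem isIso_leftAdjMate_whiskerRight (h : ∀ b, IsIso (adj b).unit) {a b : B} (f : a ⟶ b) :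
    IsIso (leftAdjMate ρ L adj f ▷ ρ.app b) :=
  isIso_mateEquiv_symm_whiskerRight (adj a) (adj b) _

variable [∀ {a b : B} (f : a ⟶ b), IsIso (leftAdjMate ρ L adj f)]

/-- Pointwise left adjoints whose mates are invertible assemble to a strong transformation. -/
def leftAdjTrans : G ⟶ F where
  app := L
  naturality f := asIso (leftAdjMate ρ L adj f)
  naturality_naturality η := leftAdjMate_naturality ρ L adj η
  naturality_id a := leftAdjMate_id ρ L adj a
  naturality_comp f g := leftAdjMate_comp ρ L adj f g

/-- The strong transformation of pointwise left adjoints is left adjoint. -/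
def leftAdjTransAdj : Bicategory.Adjunction (leftAdjTrans ρ L adj) ρ where
  unit :=
    { as :=
      { app := fun b => (adj b).unit
        naturality := fun {a b} f => by
          have := (mateEquiv_eq_iff (adj a) (adj b) _ _).1 (mateEquiv_leftAdjMate ρ L adj f)
          rw [Bicategory.Adjunction.homEquiv₁_symm_apply, Bicategory.Adjunction.homEquiv₂_apply]
            at this
          change G.map f ◁ (adj b).unit ≫ (α_ _ _ _).inv ≫ leftAdjMate ρ L adj f ▷ ρ.app b ≫
            (α_ _ _ _).hom ≫ L a ◁ (ρ.naturality f).hom ≫ (α_ _ _ _).inv =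
              ((ρ_ (G.map f)).hom ≫ (λ_ (G.map f)).inv) ≫ (adj a).unit ▷ G.map f
          rw [Category.assoc, ← Iso.inv_comp_eq,
            ← cancel_mono ((α_ _ _ _).hom ≫ L a ◁ (ρ.naturality f).inv)]
          simp only [Category.assoc] at this
          simp only [Category.assoc, this, Iso.inv_hom_id_assoc, whiskerLeft_hom_inv,
            Category.comp_id] } }
  counit :=
    { as :=
      { app := fun b => (adj b).counit
        naturality := fun {a b} f => by
          have := homEquiv₁_eq (adj a) (adj b) (leftAdjMate ρ L adj f)
          rw [Bicategory.Adjunction.homEquiv₂_symm_apply, Bicategory.Adjunction.homEquiv₁_apply,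
            mateEquiv_leftAdjMate] at this
          change F.map f ◁ (adj b).counit ≫ (ρ_ (F.map f)).hom ≫ (λ_ (F.map f)).inv =
            ((α_ _ _ _).inv ≫ (ρ.naturality f).hom ▷ L b ≫ (α_ _ _ _).hom ≫
              ρ.app a ◁ leftAdjMate ρ L adj f ≫ (α_ _ _ _).inv) ≫ (adj a).counit ▷ F.map f
          rw [← cancel_mono (λ_ (F.map f)).hom]
          simp only [Category.assoc, this, Iso.inv_hom_id, Category.comp_id,
            Iso.hom_inv_id_assoc, hom_inv_whiskerRight_assoc, Iso.inv_hom_id_assoc] } }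
  left_triangle := Pseudofunctor.StrongTrans.homCategory.ext fun b => (adj b).left_triangle
  right_triangle := Pseudofunctor.StrongTrans.homCategory.ext fun b => (adj b).right_triangle

end left

section right
variable (R : ∀ b, G.obj b ⟶ F.obj b) (adj : ∀ b, Bicategory.Adjunction (ρ.app b) (R b))

/-- The mate of the naturality constraint, for pointwise right adjoints. -/
def rightAdjMate {a b : B} (f : a ⟶ b) : R a ≫ F.map f ⟶ G.map f ≫ R b :=
  Bicategory.mateEquiv (adj a) (adj b) (ρ.naturality f).hom

theorem rightAdjMate_naturality {a b : B} {f g : a ⟶ b} (η : f ⟶ g) :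
    R a ◁ F.map₂ η ≫ rightAdjMate ρ R adj g = rightAdjMate ρ R adj f ≫ G.map₂ η ▷ R b := by
  have h₁ := mateEquiv_whisker (adj a) (adj b) (F.map₂ η) (ρ.naturality g).hom (𝟙 _)
  have h₂ := mateEquiv_whisker (adj a) (adj b) (𝟙 _) (ρ.naturality f).hom (G.map₂ η)
  simp only [Bicategory.whiskerLeft_id, Bicategory.id_whiskerRight, Category.comp_id,
    Category.id_comp] at h₁ h₂
  exact h₁.symm.trans ((congrArg _ (ρ.naturality_naturality η)).trans h₂)

theorem rightAdjMate_id (a : B) :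
    rightAdjMate ρ R adj (𝟙 a) =
      R a ◁ (F.mapId a).hom ≫ ((ρ_ (R a)).hom ≫ (λ_ (R a)).inv) ≫ (G.mapId a).inv ▷ R a := by
  have h := mateEquiv_whisker (adj a) (adj a) (F.mapId a).hom
    ((λ_ (ρ.app a)).hom ≫ (ρ_ (ρ.app a)).inv) (G.mapId a).inv
  rw [mateEquiv_leftUnitor_hom_rightUnitor_inv] at h
  rw [← h, rightAdjMate, Pseudofunctor.StrongTrans.naturality_id_hom]
  simp only [Category.assoc]

theorem rightAdjMate_comp {a b c : B} (f : a ⟶ b) (g : b ⟶ c) :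
    rightAdjMate ρ R adj (f ≫ g) =
      R a ◁ (F.mapComp f g).hom ≫ rightAdjointSquare.vcomp (rightAdjMate ρ R adj f)
        (rightAdjMate ρ R adj g) ≫ (G.mapComp f g).inv ▷ R c := by
  have h := mateEquiv_whisker (adj a) (adj c) (F.mapComp f g).hom
    (leftAdjointSquare.vcomp (ρ.naturality f).hom (ρ.naturality g).hom) (G.mapComp f g).inv
  rw [mateEquiv_vcomp (adj a) (adj b) (adj c)] at h
  refine Eq.trans ?_ h
  rw [rightAdjMate, Pseudofunctor.StrongTrans.naturality_comp_hom]
  simp only [leftAdjointSquare.vcomp, Category.assoc]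

theorem isIso_rightAdjMate_whiskerRight (h : ∀ b, IsIso (adj b).counit) {a b : B} (f : a ⟶ b) :
    IsIso (rightAdjMate ρ R adj f ▷ ρ.app b) :=
  isIso_mateEquiv_whiskerRight (adj a) (adj b) _

variable [∀ {a b : B} (f : a ⟶ b), IsIso (rightAdjMate ρ R adj f)]

/-- Pointwise right adjoints whose mates are invertible assemble to a strong transformation. -/
def rightAdjTrans : G ⟶ F where
  app := R
  -- The mate for right adjoints points against the convention for naturality constraints, so its
  -- inverse is used.
  naturality f := (asIso (rightAdjMate ρ R adj f)).symm
  naturality_naturality {a b f g} η := by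
    change _ ≫ inv _ = inv _ ≫ _
    rw [IsIso.comp_inv_eq, Category.assoc, IsIso.eq_inv_comp]
    exact (rightAdjMate_naturality ρ R adj η).symm
  naturality_id a := by
    change inv (rightAdjMate ρ R adj (𝟙 a)) ≫ _ = _
    rw [IsIso.inv_comp_eq, rightAdjMate_id]
    simp
  naturality_comp f g := by
    change inv (rightAdjMate ρ R adj (f ≫ g)) ≫ _ = _ ≫ _ ≫ _ ◁ inv (rightAdjMate ρ R adj g) ≫
      _ ≫ inv (rightAdjMate ρ R adj f) ▷ _ ≫ _
    rw [IsIso.inv_comp_eq, rightAdjMate_comp, rightAdjointSquare.vcomp]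
    simp

/-- The strong transformation of pointwise right adjoints is right adjoint. -/
def rightAdjTransAdj : Bicategory.Adjunction ρ (rightAdjTrans ρ R adj) where
  unit :=
    { as :=
      { app := fun b => (adj b).unit
        naturality := fun {a b} f => by
          have := (mateEquiv_eq_iff (adj a) (adj b) _ _).1
            (rfl : _ = rightAdjMate ρ R adj f)
          rw [Bicategory.Adjunction.homEquiv₁_symm_apply, Bicategory.Adjunction.homEquiv₂_apply]
            at this
          change F.map f ◁ (adj b).unit ≫ (α_ _ _ _).inv ≫ (ρ.naturality f).hom ▷ R b ≫
            (α_ _ _ _).hom ≫ ρ.app a ◁ inv (rightAdjMate ρ R adj f) ≫ (α_ _ _ _).inv =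
              ((ρ_ (F.map f)).hom ≫ (λ_ (F.map f)).inv) ≫ (adj a).unit ▷ F.map f
          rw [Category.assoc, ← Iso.inv_comp_eq,
            ← cancel_mono ((α_ _ _ _).hom ≫ ρ.app a ◁ rightAdjMate ρ R adj f)]
          simp only [Category.assoc] at this
          simp only [Category.assoc, this, Iso.inv_hom_id_assoc, Iso.inv_hom_id_assoc,
            ← Bicategory.whiskerLeft_comp, IsIso.inv_hom_id, Bicategory.whiskerLeft_id,
            Category.comp_id] } }
  counit :=
    { as :=
      { app := fun b => (adj b).counit
        naturality := fun {a b} f => by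
          have : _ = _ ≫ (adj b).homEquiv₂.symm (rightAdjMate ρ R adj f) :=
            homEquiv₁_eq (adj a) (adj b) (ρ.naturality f).hom
          rw [Bicategory.Adjunction.homEquiv₂_symm_apply, Bicategory.Adjunction.homEquiv₁_apply]
            at this
          change G.map f ◁ (adj b).counit ≫ (ρ_ (G.map f)).hom ≫ (λ_ (G.map f)).inv =
            ((α_ _ _ _).inv ≫ inv (rightAdjMate ρ R adj f) ▷ ρ.app b ≫ (α_ _ _ _).hom ≫
              R a ◁ (ρ.naturality f).hom ≫ (α_ _ _ _).inv) ≫ (adj a).counit ▷ G.map f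
          rw [← cancel_mono (λ_ (G.map f)).hom]
          simp only [Category.assoc, this, Iso.inv_hom_id, Category.comp_id,
            Iso.hom_inv_id_assoc, ← comp_whiskerRight_assoc, IsIso.inv_hom_id,
            Bicategory.id_whiskerRight, Category.id_comp]
          rw [Iso.inv_hom_id_assoc] } }
  left_triangle := Pseudofunctor.StrongTrans.homCategory.ext fun b => (adj b).left_triangle
  right_triangle := Pseudofunctor.StrongTrans.homCategory.ext fun b => (adj b).right_triangle

end right

end doctrinal

/-! ### Detecting invertibility after restriction. -/

section ext
variable {D : Prederivator.{w, v, u}} {A B : Cat.{w, w}}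

/-- Restriction is fully faithful on maps between left extensions: the inverse downstairs lifts, and
the identities lift with it. -/
theorem IsLeftExt.isIso (f : A ⟶ B) {M N : val D B} (hM : IsLeftExt D f M)
    (hN : IsLeftExt D f N) (φ : M ⟶ N)
    (hφ : IsIso ((res D f).map φ)) : IsIso φ := by
  obtain ⟨ψ, hψ⟩ := (hN M).2 (inv ((res D f).map φ))
  refine ⟨ψ, (hM M).1 ?_, (hN N).1 ?_⟩ <;> simp [hψ]

theorem IsRightExt.isIso (f : A ⟶ B) {M N : val D B} (hM : IsRightExt D f M)
    (hN : IsRightExt D f N) (φ : M ⟶ N)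
    (hφ : IsIso ((res D f).map φ)) : IsIso φ := by
  obtain ⟨ψ, hψ⟩ := (hM N).2 (inv ((res D f).map φ))
  refine ⟨ψ, (hM M).1 ?_, (hN N).1 ?_⟩ <;> simp [hψ]

end ext

section conservative
variable {X Y Y' Z : Cat.{v, u}}

/-- A transformation is invertible if its whiskering is, for a functor which is conservative on a
class of objects containing all values. -/
theorem isIso_of_isIso_whiskerRight {f g : X ⟶ Y} (σ : f ⟶ g) (r : Y ⟶ Z) (P : Y → Prop)
    (hP : ∀ {M N : Y} (φ : M ⟶ N), P M → P N → IsIso (r.toFunctor.map φ) → IsIso φ)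
    (hf : ∀ x, P (f.toFunctor.obj x)) (hg : ∀ x, P (g.toFunctor.obj x)) [IsIso (σ ▷ r)] :
    IsIso σ := by
  have h (x : X) : IsIso (σ.toNatTrans.app x) := by
    refine hP _ (hf x) (hg x) ?_
    exact inferInstanceAs (IsIso ((Cat.Hom.toNatIso (asIso (σ ▷ r))).hom.app x))
  exact isIso_of_isIso_app σ

end conservative

section pseudofunctor
variable {B : Type u₁} [Bicategory.{w₁, v₁} B] {C : Type u₂} [Bicategory.{w₂, v₂} C]
  {F G : Pseudofunctor B C}

theorem isIso_modification {η θ : F ⟶ G} (Γ : η ⟶ θ) (h : ∀ b, IsIso (Γ.as.app b)) :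
    IsIso Γ :=
  ⟨(Pseudofunctor.StrongTrans.isoMk (fun b => asIso (Γ.as.app b)) fun f =>
      Γ.as.naturality f).inv,
    Pseudofunctor.StrongTrans.homCategory.ext fun b => IsIso.hom_inv_id (Γ.as.app b),
    Pseudofunctor.StrongTrans.homCategory.ext fun b => IsIso.inv_hom_id (Γ.as.app b)⟩

end pseudofunctor

/-! ### Adjunctions and equivalences of prederivators. -/

section pder
variable {D E : Prederivator.{w, v, u}}

theorem isIso_pder {F G : toPDER D ⟶ toPDER E} (Γ : F ⟶ G) (h : ∀ C, IsIso (Γ.hom.as.app C)) :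
    IsIso Γ := by
  have := isIso_modification Γ.hom h
  exact ⟨⟨inv Γ.hom⟩, InducedBicategory.hom₂_ext (IsIso.hom_inv_id Γ.hom),
    InducedBicategory.hom₂_ext (IsIso.inv_hom_id Γ.hom)⟩

theorem isIso_app_of_isIso {F G : toPDER D ⟶ toPDER E} (Γ : F ⟶ G) [IsIso Γ] (C) :
    IsIso (Γ.hom.as.app C) :=
  ⟨(inv Γ).hom.as.app C,
    congrArg (fun t => Pseudofunctor.StrongTrans.Modification.app
      (Pseudofunctor.StrongTrans.Hom.as (InducedBicategory.Hom₂.hom t)) C) (IsIso.hom_inv_id Γ),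
    congrArg (fun t => Pseudofunctor.StrongTrans.Modification.app
      (Pseudofunctor.StrongTrans.Hom.as (InducedBicategory.Hom₂.hom t)) C) (IsIso.inv_hom_id Γ)⟩

/-- An adjunction between pseudo-natural transformations is one between morphisms of
prederivators. -/
def pderAdj {l : D.toPseudofunctor ⟶ E.toPseudofunctor}
    {r : E.toPseudofunctor ⟶ D.toPseudofunctor} (adj : Bicategory.Adjunction l r) :
    Bicategory.Adjunction (InducedBicategory.mkHom l : toPDER D ⟶ toPDER E)
      (InducedBicategory.mkHom r : toPDER E ⟶ toPDER D) where
  unit := ⟨adj.unit⟩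
  counit := ⟨adj.counit⟩
  left_triangle := InducedBicategory.hom₂_ext adj.left_triangle
  right_triangle := InducedBicategory.hom₂_ext adj.right_triangle

/-- A morphism of prederivators which is pointwise an equivalence is an equivalence. -/
theorem exists_equivalence (r : toPDER D ⟶ toPDER E)
    (h : ∀ C, (r.hom.app C).toFunctor.IsEquivalence) :
    ∃ e : Bicategory.Equivalence (toPDER E) (toPDER D), e.inv = r := by
  let L (C) : E.obj C ⟶ D.obj C := (r.hom.app C).toFunctor.inv.toCatHom
  let adj (C) : Bicategory.Adjunction (L C) (r.hom.app C) :=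
    (r.hom.app C).toFunctor.asEquivalence.symm.toAdjunction.toCat
  have hu (C) : IsIso (adj C).unit :=
    (Cat.Hom.isoMk (r.hom.app C).toFunctor.asEquivalence.symm.unitIso).isIso_hom
  have hc (C) : IsIso (adj C).counit :=
    (Cat.Hom.isoMk (r.hom.app C).toFunctor.asEquivalence.symm.counitIso).isIso_hom
  -- An equivalence reflects all isomorphisms, so no condition on objects is needed here.
  have hσ {C C'} (f : C ⟶ C') : IsIso (leftAdjMate r.hom L adj f) := by
    have := isIso_leftAdjMate_whiskerRight r.hom L adj hu f
    exact isIso_of_isIso_whiskerRight _ (r.hom.app C') (fun _ => True)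
      (fun φ _ _ _ => isIso_of_reflects_iso φ (r.hom.app C').toFunctor) (fun _ => trivial)
      (fun _ => trivial)
  let a := pderAdj (leftAdjTransAdj r.hom L adj)
  have := isIso_pder a.unit hu
  have := isIso_pder a.counit hc
  exact ⟨.mkOfAdjointifyCounit (asIso a.unit) (asIso a.counit), rfl⟩

end pder

/-! ### Kan extension morphisms along fully faithful functors. -/

section restr
variable (D : Prederivator.{w, v, u}) {A B : Cat.{w, w}} (f : A ⟶ B)

theorem atObj_map {C C' : (Cat.{w, w})ᵒᵖ} (X : (shift B D).obj C) (g : C ⟶ C') (c : C'.unop) :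
    (res D (atObj B c)).obj (((shift B D).map g).toFunctor.obj X) =
      (res D (atObj B (g.unop.toFunctor.obj c))).obj X := by
  have h₁ := congrArg Quiver.Hom.op (atObj_comp B g.unop c)
  have h₂ := D.map_comp ((𝟭 B).prod g.unop.toFunctor).toCatHom.op (atObj B c).op
  exact Functor.congr_obj (congrArg Cat.Hom.toFunctor (h₂.symm.trans (congrArg D.map h₁))) X

variable [IsDerivator D]

/-- Extensions are tested at objects of the parameter category, and restricting along g only
reindexes these. This places the codomain of the mate among the left extensions. -/
theorem IsLeftExt.map {C C' : (Cat.{w, w})ᵒᵖ} {X : (shift B D).obj C}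
    (hX : IsLeftExt D (prodMap f C.unop) X) (g : C ⟶ C') :
    IsLeftExt D (prodMap f C'.unop) (((shift B D).map g).toFunctor.obj X) := by
  refine (isLeftExt_prodMap_iff f _).2 fun c => ?_
  rw [atObj_map]
  exact (isLeftExt_prodMap_iff (C := C.unop) f X).1 hX _

theorem IsRightExt.map {C C' : (Cat.{w, w})ᵒᵖ} {X : (shift B D).obj C}
    (hX : IsRightExt D (prodMap f C.unop) X) (g : C ⟶ C') :
    IsRightExt D (prodMap f C'.unop) (((shift B D).map g).toFunctor.obj X) := by
  refine (isRightExt_prodMap_iff f _).2 fun c => ?_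
  rw [atObj_map]
  exact (isRightExt_prodMap_iff (C := C.unop) f X).1 hX _

variable [f.toFunctor.Full] [f.toFunctor.Faithful]

theorem isIso_lanAdj_unit : IsIso (lanAdj D f).unit :=
  have (Y : val D A) := isIso_of_isUniv f _ (isUniv_unit f Y)
  NatIso.isIso_of_isIso_app _

theorem isIso_ranAdj_counit : IsIso (ranAdj D f).counit :=
  have (Y : val D A) := isIso_of_isCouniv f _ (isCouniv_counit f Y)
  NatIso.isIso_of_isIso_app _

/-- A triangle identity makes the restricted counit inverse to the invertible unit, and both ends of
the counit are left extensions. -/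
theorem isIso_lanAdj_counit_app {X : val D B} (hX : IsLeftExt D f X) :
    IsIso ((lanAdj D f).counit.app X) := by
  have := isIso_lanAdj_unit D f
  refine (isLeftExt_lan f _).isIso f hX _ ?_
  refine @IsIso.of_isIso_comp_left _ _ _ _ _ ((lanAdj D f).unit.app ((res D f).obj X)) _ _ ?_
  exact ((lanAdj D f).right_triangle_components X).symm ▸ IsIso.id _

theorem isIso_ranAdj_unit_app {X : val D B} (hX : IsRightExt D f X) :
    IsIso ((ranAdj D f).unit.app X) := by
  have := isIso_ranAdj_counit D f
  refine hX.isIso f (isRightExt_ran f _) _ ?_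
  refine @IsIso.of_isIso_comp_right _ _ _ _ _ _ ((ranAdj D f).counit.app ((res D f).obj X)) _ ?_
  exact ((ranAdj D f).left_triangle_components X).symm ▸ IsIso.id _

/-- Restriction along a fully faithful functor has a left adjoint in `PDER`. -/
theorem exists_leftAdj_restr : ∃ (L : toPDER (shift A D) ⟶ toPDER (shift B D))
    (adj : Bicategory.Adjunction L (restr f D)), IsIso adj.unit ∧
      (∀ C X, IsLeftExt D (prodMap f (unop C)) ((L.hom.app C).toFunctor.obj X)) ∧
      ∀ C X, IsLeftExt D (prodMap f (unop C)) X →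
        IsIso ((adj.counit.hom.as.app C).toNatTrans.app X) := by
  let L (C) : (shift A D).obj C ⟶ (shift B D).obj C := (lan D (prodMap f C.unop)).toCatHom
  let adj (C) : Bicategory.Adjunction (L C) ((restr f D).hom.app C) :=
    (lanAdj D (prodMap f C.unop)).toCat
  have hu (C) : IsIso (adj C).unit :=
    have := isIso_lanAdj_unit D (prodMap f C.unop)
    (Cat.Hom.isoMk (asIso (lanAdj D (prodMap f C.unop)).unit)).isIso_hom
  -- The mate runs between left extensions, on which restriction reflects isomorphisms, and its
  -- restriction is invertible because the units are.
  have hσ {C C'} (g : C ⟶ C') : IsIso (leftAdjMate (restr f D).hom L adj g) := by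
    have := isIso_leftAdjMate_whiskerRight (restr f D).hom L adj hu g
    exact isIso_of_isIso_whiskerRight _ ((restr f D).hom.app C')
      (fun X => IsLeftExt D (prodMap f C'.unop) X)
      (fun φ hM hN h => hM.isIso (prodMap f C'.unop) hN φ h) (fun X => isLeftExt_lan _ _)
      (fun X => (isLeftExt_lan (prodMap f C.unop) X).map D f g)
  let a := pderAdj (leftAdjTransAdj (restr f D).hom L adj)
  exact ⟨_, a, isIso_pder a.unit hu, fun C X => isLeftExt_lan _ _,
    fun C X hX => isIso_lanAdj_counit_app D _ hX⟩

/-- Restriction along a fully faithful functor has a right adjoint in `PDER`. -/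
theorem exists_rightAdj_restr : ∃ (R : toPDER (shift A D) ⟶ toPDER (shift B D))
    (adj : Bicategory.Adjunction (restr f D) R),
      ∀ C X, IsRightExt D (prodMap f (unop C)) X →
        IsIso ((adj.unit.hom.as.app C).toNatTrans.app X) := by
  let R (C) : (shift A D).obj C ⟶ (shift B D).obj C := (ran D (prodMap f C.unop)).toCatHom
  let adj (C) : Bicategory.Adjunction ((restr f D).hom.app C) (R C) :=
    (ranAdj D (prodMap f C.unop)).toCat
  have hu (C) : IsIso (adj C).counit :=
    have := isIso_ranAdj_counit D (prodMap f C.unop)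
    (Cat.Hom.isoMk (asIso (ranAdj D (prodMap f C.unop)).counit)).isIso_hom
  have hσ {C C'} (g : C ⟶ C') : IsIso (rightAdjMate (restr f D).hom R adj g) := by
    have := isIso_rightAdjMate_whiskerRight (restr f D).hom R adj hu g
    exact isIso_of_isIso_whiskerRight _ ((restr f D).hom.app C')
      (fun X => IsRightExt D (prodMap f C'.unop) X)
      (fun φ hM hN h => hM.isIso (prodMap f C'.unop) hN φ h)
      (fun X => (isRightExt_ran (prodMap f C.unop) X).map D f g) (fun X => isRightExt_ran _ _)
  let a := pderAdj (rightAdjTransAdj (restr f D).hom R adj)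
  exact ⟨_, a, fun C X hX => isIso_ranAdj_unit_app D _ hX⟩

end restr

/-! ### Formal comparison of adjoints with inverse equivalences. -/

section glue
variable {B : Type u₁} [Bicategory.{w₁, v₁} B] {P Q S : B} {i : S ⟶ Q} {r : Q ⟶ P}

/-- An inverse of `i ≫ r` followed by `i` agrees with a left adjoint of `r` whose counit is
invertible on `i`. -/
theorem nonempty_iso_of_leftAdj {L : P ⟶ Q} (adj : Bicategory.Adjunction L r)
    (e : Bicategory.Equivalence P S) (he : e.inv = i ≫ r) [IsIso (i ◁ adj.counit)] :
    Nonempty (e.hom ≫ i ≅ L) :=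
  -- The inverse counit inserts r ≫ L after i; the factor i ≫ r is e.inv, which cancels against
  -- e.hom.
  ⟨whiskerLeftIso e.hom ((ρ_ i).symm ≪≫ (asIso (i ◁ adj.counit)).symm ≪≫ (α_ i r L).symm) ≪≫
    (α_ _ _ _).symm ≪≫ whiskerRightIso (whiskerLeftIso e.hom (eqToIso he.symm) ≪≫ e.unit.symm) L ≪≫
    λ_ L⟩

/-- An inverse of `i ≫ r` followed by `i` agrees with a right adjoint of `r` whose unit is
invertible on `i`. -/
theorem nonempty_iso_of_rightAdj {R : P ⟶ Q} (adj : Bicategory.Adjunction r R)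
    (e : Bicategory.Equivalence P S) (he : e.inv = i ≫ r) [IsIso (i ◁ adj.unit)] :
    Nonempty (e.hom ≫ i ≅ R) :=
  ⟨whiskerLeftIso e.hom ((ρ_ i).symm ≪≫ asIso (i ◁ adj.unit) ≪≫ (α_ i r R).symm) ≪≫
    (α_ _ _ _).symm ≪≫ whiskerRightIso (whiskerLeftIso e.hom (eqToIso he.symm) ≪≫ e.unit.symm) R ≪≫
    λ_ R⟩

/-- A 1-cell which becomes an equivalence after composition with an equivalence is an
equivalence. -/
theorem exists_equivalence_of_iso {f : P ⟶ Q} (e : Bicategory.Equivalence P S)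
    (e' : Bicategory.Equivalence Q S) (a : f ≅ e.hom ≫ e'.inv) :
    ∃ e'' : Bicategory.Equivalence P Q, e''.hom = f :=
  ⟨.mkOfAdjointifyCounit (f := f) (g := e'.hom ≫ e.inv)
    (e.unit ≪≫ whiskerRightIso ((ρ_ _).symm ≪≫ whiskerLeftIso _ e'.counit.symm ≪≫
      (α_ _ _ _).symm ≪≫ whiskerRightIso a.symm _) _ ≪≫ α_ _ _ _)
    (whiskerLeftIso _ a ≪≫ α_ _ _ _ ≪≫ whiskerLeftIso _ ((α_ _ _ _).symm ≪≫
      whiskerRightIso e.counit _ ≪≫ λ_ _) ≪≫ e'.unit.symm), rfl⟩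

end glue

/-! ### Strongly bicartesian cubes as diagrams on the source or the sink. -/

section sbc
variable (D : Prederivator.{w, v, u}) (n : ℕ)

instance (k : ℕ) : (inclLE.{w} n k).toFunctor.Full :=
  inferInstanceAs (setIncl {m : Cube.{w} n | m.card ≤ k}).toFunctor.Full

instance (k : ℕ) : (inclLE.{w} n k).toFunctor.Faithful :=
  inferInstanceAs (setIncl {m : Cube.{w} n | m.card ≤ k}).toFunctor.Faithful

instance (k : ℕ) : (inclGE.{w} n k).toFunctor.Full :=
  inferInstanceAs (setIncl {m : Cube.{w} n | k ≤ m.card}).toFunctor.Full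

instance (k : ℕ) : (inclGE.{w} n k).toFunctor.Faithful :=
  inferInstanceAs (setIncl {m : Cube.{w} n | k ≤ m.card}).toFunctor.Faithful

section
variable [IsDerivator D] {D}

theorem isLeftExt_prodMap_iff_isStronglyCocartesian {C : Cat.{w, w}}
    (X : val D (Cat.of (cube.{w} n × C))) : IsLeftExt D (prodMap (inclLE n 1) C) X ↔
      ∀ c : C, IsStronglyCocartesian D ((res D (atObj (cube n) c)).obj X) :=
  (isLeftExt_prodMap_iff (inclLE n 1) X).trans
    (forall_congr' fun _ => (essImage_lan_iff (inclLE n 1) _).symm)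

theorem isRightExt_prodMap_iff_isStronglyCartesian {C : Cat.{w, w}}
    (X : val D (Cat.of (cube.{w} n × C))) : IsRightExt D (prodMap (inclGE n (n - 1)) C) X ↔
      ∀ c : C, IsStronglyCartesian D ((res D (atObj (cube n) c)).obj X) :=
  (isRightExt_prodMap_iff (inclGE n (n - 1)) X).trans
    (forall_congr' fun _ => (essImage_ran_iff (inclGE n (n - 1)) _).symm)

end

variable [IsStable D]

/-- By stability the cartesian half of the definition is redundant, and the other half is the
parametrized extension condition. -/
theorem stronglyBicartesianProp_iff_isLeftExt {C : (Cat.{w, w})ᵒᵖ}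
    (X : (shift (cube.{w} n) D).obj C) : (stronglyBicartesianProp D n).prop C X ↔
      IsLeftExt D (prodMap (inclLE n 1) C.unop) X :=
  Iff.trans (forall_congr' fun _ =>
    and_iff_right_of_imp (isStronglyCartesian_iff_isStronglyCocartesian _).2)
    (isLeftExt_prodMap_iff_isStronglyCocartesian (C := C.unop) n X).symm

theorem stronglyBicartesianProp_iff_isRightExt {C : (Cat.{w, w})ᵒᵖ}
    (X : (shift (cube.{w} n) D).obj C) : (stronglyBicartesianProp D n).prop C X ↔
      IsRightExt D (prodMap (inclGE n (n - 1)) C.unop) X :=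
  Iff.trans (forall_congr' fun _ =>
    and_iff_left_of_imp (isStronglyCartesian_iff_isStronglyCocartesian _).1)
    (isRightExt_prodMap_iff_isStronglyCartesian (C := C.unop) n X).symm

/-- Restriction to the source identifies the strongly bicartesian cubes with `D^source`. -/
theorem exists_equivalence_source : ∃ e : Bicategory.Equivalence
    (toPDER (shift (source n) D)) (toPDER (StronglyBicartesianCubes D n)),
      e.inv = stronglyBicartesianIncl D n ≫ restr (inclLE n 1) D := by
  refine exists_equivalence _ fun C => ?_
  let P := (stronglyBicartesianProp D n).prop C
  change (P.ι ⋙ res D (prodMap (inclLE n 1) C.unop)).IsEquivalence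
  have hP (X : P.FullSubcategory) := (stronglyBicartesianProp_iff_isLeftExt D n X.obj).1 X.property
  refine { faithful := ⟨?_⟩, full := ⟨?_⟩, essSurj := ⟨?_⟩ }
  -- Maps out of the left extension X are determined by their restrictions, and every map of
  -- restrictions lifts.
  · intro X Y a b h
    exact P.ι.map_injective ((hP X Y.obj).1 h)
  · intro X Y g
    obtain ⟨m, hm⟩ := (hP X Y.obj).2 g
    exact ⟨P.ι.preimage m, (congrArg _ (P.ι.map_preimage m)).trans hm⟩
  · intro Y
    obtain ⟨X, hX, hY⟩ := exists_isLeftExt (prodMap (inclLE n 1) C.unop) Y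
    exact ⟨⟨X, (stronglyBicartesianProp_iff_isLeftExt D n X).2 hX⟩, hY⟩

/-- Restriction to the sink identifies the strongly bicartesian cubes with `D^sink`. -/
theorem exists_equivalence_sink : ∃ e : Bicategory.Equivalence
    (toPDER (shift (sink n) D)) (toPDER (StronglyBicartesianCubes D n)),
      e.inv = stronglyBicartesianIncl D n ≫ restr (inclGE n (n - 1)) D := by
  refine exists_equivalence _ fun C => ?_
  let P := (stronglyBicartesianProp D n).prop C
  change (P.ι ⋙ res D (prodMap (inclGE n (n - 1)) C.unop)).IsEquivalence
  have hP (X : P.FullSubcategory) := (stronglyBicartesianProp_iff_isRightExt D n X.obj).1 X.property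
  refine { faithful := ⟨?_⟩, full := ⟨?_⟩, essSurj := ⟨?_⟩ }
  · intro X Y a b h
    exact P.ι.map_injective ((hP Y X.obj).1 h)
  -- Here the codomain Y is the right extension that governs the lifting.
  · intro X Y g
    obtain ⟨m, hm⟩ := (hP Y X.obj).2 g
    exact ⟨P.ι.preimage m, (congrArg _ (P.ι.map_preimage m)).trans hm⟩
  · intro Y
    obtain ⟨X, hX, hY⟩ := exists_isRightExt (prodMap (inclGE n (n - 1)) C.unop) Y
    exact ⟨⟨X, (stronglyBicartesianProp_iff_isRightExt D n X).2 hX⟩, hY⟩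

variable {D n}

theorem isIso_incl_whiskerLeft {F G : toPDER (shift (cube n) D) ⟶ toPDER (shift (cube n) D)}
    (Γ : F ⟶ G) (h : ∀ C X, (stronglyBicartesianProp D n).prop C X →
      IsIso ((Γ.hom.as.app C).toNatTrans.app X)) : IsIso (stronglyBicartesianIncl D n ◁ Γ) := by
  refine isIso_pder _ fun C => ?_
  have (X : (StronglyBicartesianCubes D n).obj C) :
      IsIso (((stronglyBicartesianIncl D n ◁ Γ).hom.as.app C).toNatTrans.app X) :=
    h C X.obj X.property
  exact isIso_of_isIso_app _

end sbc

/-! ### Restriction as a pseudo-natural transformation in exact morphisms. -/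

section interchange
variable {B : Type u₁} [Bicategory.{w₁, v₁} B] {C : Type u₂} [Bicategory.{w₂, v₂} C]
  {E : Type u₃} [Bicategory.{w₃, v₃} E] {G H : Pseudofunctor C E} {P Q : Pseudofunctor B C}

/-- This is naturality of F at the 2-cell m, with the constraints of F at the two composites
expanded. -/
theorem interchange_aux (F : G ⟶ H) {a b a' b' : C} {f : a ⟶ b} {f' : a' ⟶ b'} {x : a ⟶ a'}
    {y : b ⟶ b'} (m : f ≫ y ≅ x ≫ f') :
    G.map f ◁ (F.naturality y).hom ≫ (α_ _ _ _).inv ≫ (F.naturality f).hom ▷ H.map y ≫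
        (α_ _ _ _).hom ≫
        F.app a ◁ ((H.mapComp f y).inv ≫ H.map₂ m.hom ≫ (H.mapComp x f').hom) ≫ (α_ _ _ _).inv =
      ((α_ _ _ _).inv ≫ ((G.mapComp f y).inv ≫ G.map₂ m.hom ≫ (G.mapComp x f').hom) ▷ F.app b' ≫
        (α_ _ _ _).hom ≫ G.map x ◁ (F.naturality f').hom ≫ (α_ _ _ _).inv) ≫
        (F.naturality x).hom ▷ H.map f' := by
  have h := F.naturality_naturality m.hom
  rw [Pseudofunctor.StrongTrans.naturality_comp_hom,
    Pseudofunctor.StrongTrans.naturality_comp_hom] at h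
  rw [← cancel_epi ((G.mapComp f y).hom ▷ F.app b' ≫ (α_ _ _ _).hom),
    ← cancel_mono ((α_ _ _ _).hom ≫ F.app a ◁ (H.mapComp x f').inv)]
  simp only [Category.assoc] at h
  simp only [Category.assoc, Bicategory.whiskerLeft_comp, comp_whiskerRight,
    Iso.inv_hom_id_assoc, Iso.hom_inv_id_assoc, hom_inv_whiskerRight_assoc,
    whiskerLeft_hom_inv, Category.comp_id]
  exact h.symm

/-- The interchange isomorphism of two pseudo-natural transformations. -/
def interchange (F : G ⟶ H) (θ : P ⟶ Q) :
    postcomp₁ G θ ≫ precomp₁ Q F ≅ precomp₁ P F ≫ postcomp₁ H θ :=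
  Pseudofunctor.StrongTrans.isoMk (fun b => F.naturality (θ.app b))
    fun f => interchange_aux F (θ.naturality f)

end interchange

theorem comp_assoc₅_aux {C : Type u₁} [Category.{v₁} C] {X₀ X₁ X₂ X₃ X₄ X₅ : C} {f₁ : X₀ ⟶ X₁}
    {f₂ : X₁ ⟶ X₂} {f₃ : X₂ ⟶ X₃} {f₄ : X₃ ⟶ X₄} {f₅ : X₄ ⟶ X₅} {k : X₀ ⟶ X₅} {p : X₅ ⟶ X₅}
    {q : X₀ ⟶ X₀} (hk : k = (((f₁ ≫ f₂) ≫ f₃) ≫ f₄) ≫ f₅) (hp : p = 𝟙 _) (hq : q = 𝟙 _) :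
    k ≫ p = q ≫ f₁ ≫ f₂ ≫ f₃ ≫ f₄ ≫ f₅ := by
  subst hk hp hq
  simp

/-- The restriction morphisms along `f` are pseudo-natural with respect to exact morphisms. -/
def restrTrans {A B : Cat.{w, w}} (f : A ⟶ B) :
    shiftFunctor.{w, v, u} B ⟶ shiftFunctor.{w, v, u} A where
  app D := restr f D.pre
  -- The constraint at F is the naturality of F at the functors f × C, read backwards.
  naturality F := InducedBicategory.isoMk (interchange (ExactMor.hom F).hom (prodRight f)).symm
  naturality_naturality {D E F G} α := pder₂_ext fun C => by
    change (ExactMor₂.hom α).hom.as.app _ ▷ _ ≫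
      ((ExactMor.hom G).hom.naturality ((prodRight f).app C)).inv =
      ((ExactMor.hom F).hom.naturality ((prodRight f).app C)).inv ≫
        _ ◁ (ExactMor₂.hom α).hom.as.app _
    rw [Iso.comp_inv_eq, Category.assoc, Iso.eq_inv_comp]
    exact ((ExactMor₂.hom α).hom.as.naturality ((prodRight f).app C)).symm
  naturality_id D := pder₂_ext fun C => by
    change ((λ_ _).hom ≫ (ρ_ _).inv) ≫ _ ◁ 𝟙 _ = 𝟙 _ ▷ _ ≫ (λ_ _).hom ≫ (ρ_ _).inv
    simp
  naturality_comp F G := pder₂_ext fun C => by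
    let x := (prodRight f).app C
    let p := (ExactMor.hom F).hom
    let q := (ExactMor.hom G).hom
    change ((p ≫ q).naturality x).inv ≫ _ ◁ 𝟙 _ = 𝟙 _ ▷ _ ≫ (α_ _ _ _).hom ≫
      _ ◁ (q.naturality x).inv ≫ (α_ _ _ _).inv ≫ (p.naturality x).inv ▷ _ ≫ (α_ _ _ _).hom
    exact comp_assoc₅_aux (Pseudofunctor.StrongTrans.categoryStruct_comp_naturality_inv p q x)
      (Bicategory.whiskerLeft_id _ _) (Bicategory.id_whiskerRight _ _)

/-! ### Exact morphisms preserve strongly cocartesian cubes. -/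

section exact
variable {D E : Prederivator.{w, v, u}} (F : toPDER D ⟶ toPDER E) {A B : Cat.{w, w}}

/-- A morphism of prederivators commutes with restriction. -/
def appRes (f : A ⟶ B) (X : val D B) :
    (F.hom.app (op A)).toFunctor.obj ((res D f).obj X) ≅
      (res E f).obj ((F.hom.app (op B)).toFunctor.obj X) :=
  (Cat.Hom.toNatIso (F.hom.naturality f.op)).app X

variable {F} [IsStable D] [IsStable E] {n : ℕ}

/-- All faces of X are cocartesian, hence bicartesian by stability. F preserves these squares and
commutes with restriction to faces, so the face criterion applies again. -/
theorem IsExact.isStronglyCocartesian (hF : IsExact F) {X : val D (cube.{w} n)}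
    (hX : IsStronglyCocartesian D X) :
    IsStronglyCocartesian E ((F.hom.app (op (cube n))).toFunctor.obj X) := by
  rw [isStronglyCocartesian_iff_faces] at hX ⊢
  intro c s t hst
  have h := hX c s t hst
  exact (lan E _).essImage.prop_of_iso (appRes F (faceHom c hst) X)
    (hF.bicartesian _ ⟨(IsStable.stable _).2 h, h⟩).2

theorem IsExact.isLeftExt (hF : IsExact F) {C : Cat.{w, w}}
    {X : val D (Cat.of (cube.{w} n × C))} (hX : IsLeftExt D (prodMap (inclLE n 1) C) X) :
    IsLeftExt E (prodMap (inclLE n 1) C)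
      ((F.hom.app (op (Cat.of (cube.{w} n × C)))).toFunctor.obj X) := by
  rw [isLeftExt_prodMap_iff_isStronglyCocartesian] at hX ⊢
  exact fun c => (lan E _).essImage.prop_of_iso (appRes F (atObj (cube n) c) X)
    (hF.isStronglyCocartesian (hX c))

end exact

/-- Pointwise left adjoints of restriction to the source are pseudo-natural with respect to exact
morphisms. -/
theorem isIso_leftAdjMate_restrTrans (n : ℕ)
    (L : ∀ D : StableDerivator.{w, v, u},
      toPDER (shift (source n) D.pre) ⟶ toPDER (shift (cube n) D.pre))
    (adj : ∀ D, Bicategory.Adjunction (L D) (restr (inclLE n 1) D.pre))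
    (hu : ∀ D, IsIso (adj D).unit)
    (hL : ∀ D C X, IsLeftExt D.pre (prodMap (inclLE n 1) (unop C))
      (((L D).hom.app C).toFunctor.obj X))
    {D E : StableDerivator.{w, v, u}} (F : D ⟶ E) :
    IsIso (leftAdjMate (restrTrans (inclLE n 1)) L adj F) := by
  have h := isIso_leftAdjMate_whiskerRight (restrTrans (inclLE n 1)) L adj hu F
  refine isIso_pder _ fun C => ?_
  have : IsIso ((leftAdjMate (restrTrans (inclLE n 1)) L adj F).hom.as.app C ▷
      (restr (inclLE n 1) E.pre).hom.app C) :=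
    isIso_app_of_isIso
      (leftAdjMate (restrTrans (inclLE n 1)) L adj F ▷ (restrTrans (inclLE n 1)).app E) C
  -- Exactness enters for the codomain: F sends the left extensions produced by `L D` to left
  -- extensions.
  exact isIso_of_isIso_whiskerRight _ ((restr (inclLE n 1) E.pre).hom.app C)
    (fun X => IsLeftExt E.pre (prodMap (inclLE n 1) C.unop) X)
    (fun φ hM hN h => hM.isIso (prodMap (inclLE n 1) C.unop) hN φ h)
    (fun X => hL E C _) (fun X => (ExactMor.exact F).isLeftExt (hL D C X))

end Derivators

end

/-! ### Assembly of the strong stable equivalence. -/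

theorem mainTheorem7 (n : ℕ) :
    ∃ Φ : StrongStableEquivalence.{w, v, u} (source n) (sink n),
      ∀ D : StableDerivator.{w, v, u},
        (∀ X : val D.pre (cube n), IsStronglyCartesian D.pre X ↔ IsStronglyCocartesian D.pre X) ∧
        ∃ (L : toPDER (shift (source n) D.pre) ⟶ toPDER (shift (cube n) D.pre))
          (R : toPDER (shift (sink n) D.pre) ⟶ toPDER (shift (cube n) D.pre))
          (_ : Bicategory.Adjunction L (restr (inclLE n 1) D.pre))
          (_ : Bicategory.Adjunction (restr (inclGE n (n - 1)) D.pre) R)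
          (eL : Bicategory.Equivalence (toPDER (shift (source n) D.pre))
            (toPDER (StronglyBicartesianCubes D.pre n)))
          (eR : Bicategory.Equivalence (toPDER (shift (sink n) D.pre))
            (toPDER (StronglyBicartesianCubes D.pre n))),
          Nonempty (eL.hom ≫ stronglyBicartesianIncl D.pre n ≅ L) ∧
          Nonempty (eR.hom ≫ stronglyBicartesianIncl D.pre n ≅ R) ∧
          Nonempty (Φ.trans.app D ≫ eR.hom ≅ eL.hom) := by
  choose L adjL hu hL hc using fun D : StableDerivator.{w, v, u} =>
    exists_leftAdj_restr D.pre (inclLE.{w} n 1)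
  choose R adjR hu' using fun D : StableDerivator.{w, v, u} =>
    exists_rightAdj_restr D.pre (inclGE.{w} n (n - 1))
  choose eL heL using fun D : StableDerivator.{w, v, u} => exists_equivalence_source D.pre n
  choose eR heR using fun D : StableDerivator.{w, v, u} => exists_equivalence_sink D.pre n
  -- Strongly bicartesian cubes are left extensions from the source and right extensions from the
  -- sink, so the counit and the unit are invertible on them; this factors L and R through eL and
  -- eR.
  have hLι (D : StableDerivator.{w, v, u}) :
      IsIso (stronglyBicartesianIncl D.pre n ◁ (adjL D).counit) :=
    isIso_incl_whiskerLeft _ fun C X hX =>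
      hc D C X ((stronglyBicartesianProp_iff_isLeftExt D.pre n X).1 hX)
  have hRι (D : StableDerivator.{w, v, u}) :
      IsIso (stronglyBicartesianIncl D.pre n ◁ (adjR D).unit) :=
    isIso_incl_whiskerLeft _ fun C X hX =>
      hu' D C X ((stronglyBicartesianProp_iff_isRightExt D.pre n X).1 hX)
  have iL (D : StableDerivator.{w, v, u}) := nonempty_iso_of_leftAdj (adjL D) (eL D) (heL D)
  have iR (D : StableDerivator.{w, v, u}) := nonempty_iso_of_rightAdj (adjR D) (eR D) (heR D)
  have hσ {D E : StableDerivator.{w, v, u}} (F : D ⟶ E) :=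
    isIso_leftAdjMate_restrTrans n L adjL hu hL F
  -- Extending from the source and restricting to the sink agrees with eL followed by the inverse of
  -- eR. This gives both the equivalence property of the components of Φ and, on cancelling eR, the
  -- compatibility.
  have a (D : StableDerivator.{w, v, u}) :
      L D ≫ restr (inclGE n (n - 1)) D.pre ≅ (eL D).hom ≫ (eR D).inv :=
    whiskerRightIso (iL D).some.symm _ ≪≫ α_ _ _ _ ≪≫ whiskerLeftIso _ (eqToIso (heR D).symm)
  refine ⟨⟨leftAdjTrans (restrTrans (inclLE n 1)) L adjL ≫ restrTrans (inclGE n (n - 1)),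
    fun D => exists_equivalence_of_iso (eL D) (eR D) (a D)⟩, fun D =>
    ⟨isStronglyCartesian_iff_isStronglyCocartesian, L D, R D, adjL D, adjR D, eL D, eR D, iL D,
      iR D, ⟨whiskerRightIso (a D) _ ≪≫ α_ _ _ _ ≪≫ whiskerLeftIso _ (eR D).counit ≪≫ ρ_ _⟩⟩⟩
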